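/- Let $d,k\in\mathbb N$, let $\mathcal D$ be a set of designs, and let $G:\mathbb R^d\times\mathcal D\to\mathbb R^k$ be linear in the parameter, $G(u,p)=A(p)u$ with $A(p)\in\mathbb R^{k\times d}$. Let $y=G(u,p)+\eta$ with prior $u\sim\mu_0=\mathcal N(m_0,\Sigma_0)$ and independent noise $\eta\sim\mathcal N(0,\Gamma)$, where $\Sigma_0\in\mathbb R^{d\times d}$ and $\Gamma\in\mathbb R^{k\times k}$ are symmetric positive definite. Fix $p\in\mathcal D$. Denote by $\mu_{u,y|p}$ the joint law of $(u,y)$, by $\mu_{y|p}$ the law of $y$, and by $\mu_{u|y,p}$ the posterior, i.e. the probability measure with density proportional to $\exp\left(-\tfrac12\langle y-A(p)u,\Gamma^{-1}(y-A(p)u)\rangle\right)$ with respect to $\mu_0$. Let $(u^{(j)},y^{(j)})_{j\ge1}$ be i.i.d. with law $\mu_{u,y|p}$. For $J\ge1$ let $\widetilde m_u=\frac1J\sum_{j\le J}u^{(j)}$, $\widetilde m_y=\frac1J\sum_{j\le J}y^{(j)}$ be the empirical means and $\widetilde C_{ab}=\frac1J\sum_{j\le J}(a^{(j)}-\widetilde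 m_a)(b^{(j)}-\widetilde m_b)^\top$, $a,b\in\{u,y\}$, the empirical covariances ($\widetilde C_a:=\widetilde C_{aa}$). Set $$\tilde\mu^{(J)}_{y|p}=\mathcal N(\widetilde m_y,\widetilde C_y),\qquad \tilde\mu^{(J)}_{u|y,p}=\mathcal N\left(\widetilde m_u+\widetilde C_{uy}\widetilde C_y^{-1}(y-\widetilde m_y),\ \widetilde C_u-\widetilde C_{uy}\widetilde C_y^{-1}\widetilde C_{uy}^\top\right).$$ (For all sufficiently large $J$ the empirical covariances involved are almost surely positive definite.) Then, with $L^2$ norms taken over the samples, as $J\to\infty$: 1. $\left\|D_{\mathrm{KL}}\left(\mu_{y|p}\,\|\,\tilde\mu^{(J)}_{y|p}\right)\right\|_{L^2}=\mathcal O(J^{-1})$; in particular this divergence tends to $0$ in $L^2$. 2. For every fixed $y\in\mathbb R^k$, $\left\|D_{\mathrm{KL}}\left(\mu_{u|y,p}\,\|\,\tilde\mu^{(J)}_{u|y,p}\right)\right\|_{L^2}=\mathcal O(J^{-1})$; in particular this divergence tends to $0$ in $L^2$. 3. Let $\mathrm{EIG}(p)=\mathbb E_{y|p}\left[D_{\mathrm{KL}}(\mu_{u|y,p}\,\|\,\mu_0)\right]$,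 which is finite, and, writing $\pi$ and $\tilde\pi$ for Lebesgue densities and taking expectations over $(u,y)\sim\mu_{u,y|p}$ with the samples held fixed, $$U_J=\mathbb E_{u,y|p}\left[\log\frac{\pi_{y|u,p}(y)}{\tilde\pi^{(J)}_{y|p}(y)}\right],\qquad L_J=\mathbb E_{u,y|p}\left[\log\frac{\tilde\pi^{(J)}_{u|y,p}(u)}{\pi_0(u)}\right].$$ For all sufficiently large $J$, almost surely both integrands are integrable and $L_J\le\mathrm{EIG}(p)\le U_J$. The bounds become tight: $\|U_J-\mathrm{EIG}(p)\|_{L^2}=\mathcal O(J^{-1})$ and $\|\mathrm{EIG}(p)-L_J\|_{L^2}=\mathcal O(J^{-1})$, so both differences tend to $0$ in $L^2$. -/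

import Mathlib

open MeasureTheory ProbabilityTheory InformationTheory Filter Topology Asymptotics
open scoped ENNReal Matrix

namespace BOED

noncomputable section

/-- The quadratic form `⟨x, S⁻¹ x⟩` (the square of the `S`-rescaled norm of `x`). -/
def quadInv {n : ℕ} (S : Matrix (Fin n) (Fin n) ℝ) (x : EuclideanSpace ℝ (Fin n)) : ℝ :=
  x.ofLp ⬝ᵥ (S⁻¹ *ᵥ x.ofLp)

/-- The Lebesgue density at `x` of the Gaussian law `N(m, S)` on `ℝⁿ`, for `S` positive definite. -/
def gaussianDensity {n : ℕ} (m : EuclideanSpace ℝ (Fin n)) (S : Matrix (Fin n) (Fin n) ℝ)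
    (x : EuclideanSpace ℝ (Fin n)) : ℝ :=
  (Real.sqrt ((2 * Real.pi) ^ n * S.det))⁻¹ * Real.exp (-(1 / 2) * quadInv S (x - m))

section Model

/-! The model `y = g(u) + η` at a fixed design, with prior `u ~ N(m₀, S₀)` and independent noise
`η ~ N(0, Γ)`. -/

variable {d k : ℕ}

/-- The joint law of `(u, y)`. -/
def jointLaw (m₀ : EuclideanSpace ℝ (Fin d)) (S₀ : Matrix (Fin d) (Fin d) ℝ)
    (Γ : Matrix (Fin k) (Fin k) ℝ) (g : EuclideanSpace ℝ (Fin d) → EuclideanSpace ℝ (Fin k)) :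
    Measure (EuclideanSpace ℝ (Fin d) × EuclideanSpace ℝ (Fin k)) :=
  ((multivariateGaussian m₀ S₀).prod (multivariateGaussian 0 Γ)).map
    (fun z ↦ (z.1, g z.1 + z.2))

/-- The law of the data `y`. -/
def marginalLaw (m₀ : EuclideanSpace ℝ (Fin d)) (S₀ : Matrix (Fin d) (Fin d) ℝ)
    (Γ : Matrix (Fin k) (Fin k) ℝ) (g : EuclideanSpace ℝ (Fin d) → EuclideanSpace ℝ (Fin k)) :
    Measure (EuclideanSpace ℝ (Fin k)) :=
  (jointLaw m₀ S₀ Γ g).snd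

/-- The posterior of `u` given the data `y`: the probability measure whose density with respect
to the prior is proportional to `exp (-½ ⟨y - g(u), Γ⁻¹ (y - g(u))⟩)`. -/
def posteriorLaw (m₀ : EuclideanSpace ℝ (Fin d)) (S₀ : Matrix (Fin d) (Fin d) ℝ)
    (Γ : Matrix (Fin k) (Fin k) ℝ) (g : EuclideanSpace ℝ (Fin d) → EuclideanSpace ℝ (Fin k))
    (y : EuclideanSpace ℝ (Fin k)) : Measure (EuclideanSpace ℝ (Fin d)) :=
  (multivariateGaussian m₀ S₀).tilted (fun u ↦ -((1 / 2) * quadInv Γ (y - g u)))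

/-- The expected information gain: the mean over `y` of the Kullback-Leibler divergence of the
posterior from the prior. -/
def EIG (m₀ : EuclideanSpace ℝ (Fin d)) (S₀ : Matrix (Fin d) (Fin d) ℝ)
    (Γ : Matrix (Fin k) (Fin k) ℝ) (g : EuclideanSpace ℝ (Fin d) → EuclideanSpace ℝ (Fin k)) :
    ℝ≥0∞ :=
  ∫⁻ y, klDiv (posteriorLaw m₀ S₀ Γ g y) (multivariateGaussian m₀ S₀) ∂(marginalLaw m₀ S₀ Γ g)

end Model

section Empirical

/-- The empirical mean of the first `J` sample points. -/
def empMean {n : ℕ} (x : ℕ → EuclideanSpace ℝ (Fin n)) (J : ℕ) : EuclideanSpace ℝ (Fin n) :=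
  (J : ℝ)⁻¹ • ∑ j ∈ Finset.range J, x j

/-- The empirical cross covariance, normalized by `1 / J`, of the first `J` sample points. -/
def empCov {a b : ℕ} (x : ℕ → EuclideanSpace ℝ (Fin a)) (z : ℕ → EuclideanSpace ℝ (Fin b))
    (J : ℕ) : Matrix (Fin a) (Fin b) ℝ :=
  (J : ℝ)⁻¹ • ∑ j ∈ Finset.range J,
    Matrix.vecMulVec (x j - empMean x J).ofLp (z j - empMean z J).ofLp

variable {d k : ℕ} (u : ℕ → EuclideanSpace ℝ (Fin d)) (y : ℕ → EuclideanSpace ℝ (Fin k)) (J : ℕ)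

/-- The empirical Gaussian approximation of the law of the data. -/
def approxMarginal : Measure (EuclideanSpace ℝ (Fin k)) :=
  multivariateGaussian (empMean y J) (empCov y y J)

/-- The empirical (Kalman) conditional mean of `u` given the data value `y₀`. -/
def approxPostMean (y₀ : EuclideanSpace ℝ (Fin k)) : EuclideanSpace ℝ (Fin d) :=
  empMean u J +
    WithLp.toLp 2 ((empCov u y J * (empCov y y J)⁻¹) *ᵥ (y₀ - empMean y J).ofLp)

/-- The empirical (Kalman) conditional covariance of `u` given the data. -/
def approxPostCov : Matrix (Fin d) (Fin d) ℝ :=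
  empCov u u J - empCov u y J * (empCov y y J)⁻¹ * (empCov u y J)ᵀ

/-- The empirical Gaussian approximation of the posterior given the data value `y₀`. -/
def approxPosterior (y₀ : EuclideanSpace ℝ (Fin k)) : Measure (EuclideanSpace ℝ (Fin d)) :=
  multivariateGaussian (approxPostMean u y J y₀) (approxPostCov u y J)

/-- The integrand `log (π(y | u) / π̃(y))` of the upper bound, at `z = (u, y)`. -/
def upperIntegrand (Γ : Matrix (Fin k) (Fin k) ℝ)
    (g : EuclideanSpace ℝ (Fin d) → EuclideanSpace ℝ (Fin k))
    (z : EuclideanSpace ℝ (Fin d) × EuclideanSpace ℝ (Fin k)) : ℝ :=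
  Real.log (gaussianDensity (g z.1) Γ z.2 / gaussianDensity (empMean y J) (empCov y y J) z.2)

/-- The integrand `log (π̃(u | y) / π₀(u))` of the lower bound, at `z = (u, y)`. -/
def lowerIntegrand (m₀ : EuclideanSpace ℝ (Fin d)) (S₀ : Matrix (Fin d) (Fin d) ℝ)
    (z : EuclideanSpace ℝ (Fin d) × EuclideanSpace ℝ (Fin k)) : ℝ :=
  Real.log (gaussianDensity (approxPostMean u y J z.2) (approxPostCov u y J) z.1 /
    gaussianDensity m₀ S₀ z.1)

/-- The upper bound on the EIG: the mean of `log (π(y | u) / π̃(y))` over the joint law. -/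
def eigUpper (m₀ : EuclideanSpace ℝ (Fin d)) (S₀ : Matrix (Fin d) (Fin d) ℝ)
    (Γ : Matrix (Fin k) (Fin k) ℝ)
    (g : EuclideanSpace ℝ (Fin d) → EuclideanSpace ℝ (Fin k)) : ℝ :=
  ∫ z, upperIntegrand y J Γ g z ∂(jointLaw m₀ S₀ Γ g)

/-- The lower bound on the EIG: the mean of `log (π̃(u | y) / π₀(u))` over the joint law. -/
def eigLower (m₀ : EuclideanSpace ℝ (Fin d)) (S₀ : Matrix (Fin d) (Fin d) ℝ)
    (Γ : Matrix (Fin k) (Fin k) ℝ)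
    (g : EuclideanSpace ℝ (Fin d) → EuclideanSpace ℝ (Fin k)) : ℝ :=
  ∫ z, lowerIntegrand u y J m₀ S₀ z ∂(jointLaw m₀ S₀ Γ g)

end Empirical

/-- The random variables `X J` tend to `0` in `L²(P)` as `J → ∞` and their `L²` norms are
`O(r J)`. (The first clause also says that `X J` is measurable up to a null set and square
integrable for all large `J`.) -/
def TendstoZeroL2WithRate {Ω : Type*} [MeasurableSpace Ω] (P : Measure Ω) {E : Type*}
    [TopologicalSpace E] [ENorm E] (X : ℕ → Ω → E) (r : ℕ → ℝ) : Prop :=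
  (∀ᶠ J in atTop, MemLp (X J) 2 P) ∧
    Tendsto (fun J ↦ eLpNorm (X J) 2 P) atTop (𝓝 0) ∧
    (fun J ↦ (eLpNorm (X J) 2 P).toReal) =O[atTop] r

end

end BOED

/-!
By Gaussian conditioning the marginal and the posterior are Gaussian, so both divergences, and
also the gaps `U_J - EIG` and (up to one trace term) `EIG - L_J`, are Gaussian divergences between
a limit and its plug-in estimator. Such a divergence vanishes to second order at the limit: it is
bounded by quadratic expressions in the errors of the mean and of the covariance, with the inverse
of the estimated covariance as coefficient. The errors are `O(J^{-1/2})` in every `L^q`, so Hölder's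
inequality gives the rate `J⁻¹` once the inverse empirical covariances are bounded in every `L^q`.

The last point rests on the Gaussian mass `∫ exp (-½ ⟨v, C v⟩) dv`, which is a constant multiple of
`(det C)^{-1/2}`: it turns moments of the inverse determinant into integrals of
`𝔼 exp (-½ r ⟨v, C_J v⟩)`, and pairing the independent sample points makes the exponent a sum of
independent squares, whose Laplace transform is explicit. The posterior covariance is a Schur
complement, so its determinant is controlled in the same way through the joint covariance.
-/

namespace BOED

section Rates

open scoped NNReal

variable {Ω : Type*} [MeasurableSpace Ω] {P : Measure Ω} {E F : Type*} [NormedAddCommGroup E]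
  [NormedAddCommGroup F] {e e' : ℕ}

lemma holderTriple_two_mul (q : ℕ) :
    ENNReal.HolderTriple ((2 * q : ℕ) : ℝ≥0∞) ((2 * q : ℕ) : ℝ≥0∞) (q : ℝ≥0∞) := by
  constructor
  push_cast
  rw [ENNReal.mul_inv (by simp) (by simp), ← add_mul, ENNReal.inv_two_add_inv_two, one_mul]

/-- For every finite `q`, the `L^q(P)` norm of `X J` is `O(J ^ (-e / 2))` as `J → ∞`. -/
def HasLpRate (P : Measure Ω) (e : ℕ) (X : ℕ → Ω → E) : Prop :=
  ∀ q : ℕ, q ≠ 0 → ∃ c : ℝ≥0, ∀ᶠ J : ℕ in atTop,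
    AEStronglyMeasurable (X J) P ∧ eLpNorm (X J) q P ≤ (c * (NNReal.sqrt J)⁻¹ ^ e : ℝ≥0)

namespace HasLpRate

lemma aestronglyMeasurable {X : ℕ → Ω → E} (hX : HasLpRate P e X) :
    ∀ᶠ J in atTop, AEStronglyMeasurable (X J) P := by
  obtain ⟨c, hc⟩ := hX 1 one_ne_zero
  exact hc.mono fun J h ↦ h.1

lemma of_norm_le {X : ℕ → Ω → E} {Y : ℕ → Ω → F} (hY : HasLpRate P e Y)
    (hX : ∀ᶠ J in atTop, AEStronglyMeasurable (X J) P)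
    (h : ∀ᶠ J in atTop, ∀ᵐ ω ∂P, ‖X J ω‖ ≤ ‖Y J ω‖) : HasLpRate P e X := by
  intro q hq
  obtain ⟨c, hc⟩ := hY q hq
  refine ⟨c, ?_⟩
  filter_upwards [hc, hX, h] with J hY hX hle
  exact ⟨hX, (eLpNorm_mono_ae hle).trans hY.2⟩

lemma congr {X Y : ℕ → Ω → E} (hX : HasLpRate P e X) (h : ∀ᶠ J in atTop, X J =ᵐ[P] Y J) :
    HasLpRate P e Y := by
  intro q hq
  obtain ⟨c, hc⟩ := hX q hq
  refine ⟨c, ?_⟩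
  filter_upwards [hc, h] with J hX hXY
  exact ⟨hX.1.congr hXY, (eLpNorm_congr_ae hXY).symm.le.trans hX.2⟩

lemma mono {X : ℕ → Ω → E} (hX : HasLpRate P e X) (h : e' ≤ e) : HasLpRate P e' X := by
  intro q hq
  obtain ⟨c, hc⟩ := hX q hq
  refine ⟨c, ?_⟩
  filter_upwards [hc, eventually_ge_atTop 1] with J hX hJ
  refine ⟨hX.1, hX.2.trans (ENNReal.coe_le_coe.2 ?_)⟩
  have : (1 : ℝ≥0) ≤ NNReal.sqrt J := NNReal.one_le_sqrt.2 (by exact_mod_cast hJ)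
  exact mul_le_mul_right (pow_le_pow_of_le_one zero_le (inv_le_one_of_one_le₀ this) h) c

lemma const [IsFiniteMeasure P] (a : E) : HasLpRate P 0 (fun _ _ ↦ a) := fun q _ ↦ by
  have ha : MemLp (fun _ : Ω ↦ a) q P := memLp_const a
  refine ⟨(eLpNorm (fun _ : Ω ↦ a) q P).toNNReal, Eventually.of_forall fun J ↦ ⟨ha.1, ?_⟩⟩
  rw [pow_zero, mul_one, ENNReal.coe_toNNReal ha.eLpNorm_ne_top]

lemma zero : HasLpRate P e (fun _ _ ↦ (0 : E)) := fun _ _ ↦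
  ⟨0, Eventually.of_forall fun _ ↦ ⟨aestronglyMeasurable_const, by simp⟩⟩

lemma add {X Y : ℕ → Ω → E} (hX : HasLpRate P e X) (hY : HasLpRate P e Y) :
    HasLpRate P e (fun J ω ↦ X J ω + Y J ω) := by
  intro q hq
  obtain ⟨c, hc⟩ := hX q hq
  obtain ⟨c', hc'⟩ := hY q hq
  refine ⟨c + c', ?_⟩
  filter_upwards [hc, hc'] with J hX hY
  refine ⟨hX.1.add hY.1, (eLpNorm_add_le hX.1 hY.1 ?_).trans ?_⟩
  · exact_mod_cast Nat.one_le_iff_ne_zero.2 hq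
  · rw [add_mul, ENNReal.coe_add]
    exact add_le_add hX.2 hY.2

lemma neg {X : ℕ → Ω → E} (hX : HasLpRate P e X) : HasLpRate P e (fun J ω ↦ -X J ω) :=
  hX.of_norm_le (hX.aestronglyMeasurable.mono fun _ h ↦ h.neg)
    (Eventually.of_forall fun _ ↦ Eventually.of_forall fun _ ↦ (norm_neg _).le)

lemma sub {X Y : ℕ → Ω → E} (hX : HasLpRate P e X) (hY : HasLpRate P e Y) :
    HasLpRate P e (fun J ω ↦ X J ω - Y J ω) := by
  simpa only [sub_eq_add_neg] using hX.add hY.neg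

lemma sum {ι : Type*} (s : Finset ι) {X : ι → ℕ → Ω → E} (hX : ∀ i ∈ s, HasLpRate P e (X i)) :
    HasLpRate P e (fun J ω ↦ ∑ i ∈ s, X i J ω) := by
  classical
  induction s using Finset.induction_on with
  | empty => simpa only [Finset.sum_empty] using zero
  | insert a s ha ih =>
    simp only [Finset.sum_insert ha]
    exact (hX a (Finset.mem_insert_self a s)).add
      (ih fun i hi ↦ hX i (Finset.mem_insert_of_mem hi))

lemma of_sub_const [IsFiniteMeasure P] {X : ℕ → Ω → E} {a : E}
    (hX : HasLpRate P e (fun J ω ↦ X J ω - a)) : HasLpRate P 0 X := by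
  simpa only [sub_add_cancel] using (hX.mono zero_le).add (const a)

lemma smul [NormedSpace ℝ E] {X : ℕ → Ω → ℝ} {Y : ℕ → Ω → E} (hX : HasLpRate P e X)
    (hY : HasLpRate P e' Y) : HasLpRate P (e + e') (fun J ω ↦ X J ω • Y J ω) := by
  intro q hq
  obtain ⟨c, hc⟩ := hX (2 * q) (mul_ne_zero two_ne_zero hq)
  obtain ⟨c', hc'⟩ := hY (2 * q) (mul_ne_zero two_ne_zero hq)
  have := holderTriple_two_mul q
  refine ⟨c * c', ?_⟩
  filter_upwards [hc, hc'] with J hX hY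
  refine ⟨hX.1.smul hY.1, ?_⟩
  calc eLpNorm (fun ω ↦ X J ω • Y J ω) q P
      ≤ eLpNorm (X J) (2 * q : ℕ) P * eLpNorm (Y J) (2 * q : ℕ) P :=
        eLpNorm_smul_le_mul_eLpNorm hY.1 hX.1
    _ ≤ (c * (NNReal.sqrt J)⁻¹ ^ e : ℝ≥0) * (c' * (NNReal.sqrt J)⁻¹ ^ e' : ℝ≥0) :=
        mul_le_mul' hX.2 hY.2
    _ = (c * c' * (NNReal.sqrt J)⁻¹ ^ (e + e') : ℝ≥0) := by
        rw [← ENNReal.coe_mul, mul_mul_mul_comm, pow_add]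

lemma mul {X Y : ℕ → Ω → ℝ} (hX : HasLpRate P e X) (hY : HasLpRate P e' Y) :
    HasLpRate P (e + e') (fun J ω ↦ X J ω * Y J ω) := hX.smul hY

lemma prod [IsFiniteMeasure P] {ι : Type*} (s : Finset ι) {X : ι → ℕ → Ω → ℝ}
    (hX : ∀ i ∈ s, HasLpRate P 0 (X i)) : HasLpRate P 0 (fun J ω ↦ ∏ i ∈ s, X i J ω) := by
  classical
  induction s using Finset.induction_on with
  | empty => simpa only [Finset.prod_empty] using const (1 : ℝ)
  | insert a s ha ih =>
    simp only [Finset.prod_insert ha]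
    exact (hX a (Finset.mem_insert_self a s)).mul
      (ih fun i hi ↦ hX i (Finset.mem_insert_of_mem hi))

lemma continuousLinearMap_comp [NormedSpace ℝ E] [NormedSpace ℝ F] (L : E →L[ℝ] F)
    {X : ℕ → Ω → E} (hX : HasLpRate P e X) : HasLpRate P e (fun J ω ↦ L (X J ω)) := by
  intro q hq
  obtain ⟨c, hc⟩ := hX q hq
  refine ⟨‖L‖₊ * c, hc.mono fun J hJ ↦ ⟨L.continuous.comp_aestronglyMeasurable hJ.1, ?_⟩⟩
  calc eLpNorm (fun ω ↦ L (X J ω)) q P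
      ≤ ‖L‖₊ * eLpNorm (X J) q P :=
        eLpNorm_le_nnreal_smul_eLpNorm_of_ae_le_mul
          (Eventually.of_forall fun ω ↦ L.le_opNNNorm (X J ω)) _
    _ ≤ ‖L‖₊ * (c * (NNReal.sqrt J)⁻¹ ^ e : ℝ≥0) := mul_le_mul_right hJ.2 _
    _ = (‖L‖₊ * c * (NNReal.sqrt J)⁻¹ ^ e : ℝ≥0) := by rw [mul_assoc, ← ENNReal.coe_mul]

lemma const_mul {X : ℕ → Ω → ℝ} (a : ℝ) (hX : HasLpRate P e X) :
    HasLpRate P e (fun J ω ↦ a * X J ω) :=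
  hX.continuousLinearMap_comp (a • ContinuousLinearMap.id ℝ ℝ)

end HasLpRate

lemma hasLpRate_euclideanSpace_iff {ι : Type*} [Fintype ι] {X : ℕ → Ω → EuclideanSpace ℝ ι} :
    HasLpRate P e X ↔ ∀ i, HasLpRate P e (fun J ω ↦ X J ω i) := by
  classical
  refine ⟨fun hX i ↦ hX.continuousLinearMap_comp (EuclideanSpace.proj i), fun hX ↦ ?_⟩
  have hsum := HasLpRate.sum Finset.univ fun i _ ↦ (hX i).continuousLinearMap_comp
    (.toSpanSingleton ℝ (EuclideanSpace.basisFun ι ℝ i))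
  convert hsum using 3 with J ω
  exact ((EuclideanSpace.basisFun ι ℝ).sum_repr _).symm

open scoped Matrix.Norms.Elementwise

lemma hasLpRate_matrix_iff {ι κ : Type*} [Fintype ι] [Fintype κ] {X : ℕ → Ω → Matrix ι κ ℝ} :
    HasLpRate P e X ↔ ∀ i j, HasLpRate P e (fun J ω ↦ X J ω i j) := by
  classical
  refine ⟨fun hX i j ↦ ?_, fun hX ↦ ?_⟩
  · exact hX.continuousLinearMap_comp (Matrix.entryLinearMap ℝ ℝ i j).toContinuousLinearMap
  have := HasLpRate.sum Finset.univ fun i _ ↦ HasLpRate.sum Finset.univ fun j _ ↦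
    (hX i j).continuousLinearMap_comp (Matrix.singleLinearMap ℝ i j).toContinuousLinearMap
  simpa [← Matrix.matrix_eq_sum_single] using this

variable {ι κ l : Type*} [Fintype ι] [Fintype κ] [Fintype l]

namespace HasLpRate

lemma transpose {M : ℕ → Ω → Matrix ι κ ℝ} (hM : HasLpRate P e M) :
    HasLpRate P e (fun J ω ↦ (M J ω)ᵀ) :=
  hasLpRate_matrix_iff.2 fun i j ↦ hasLpRate_matrix_iff.1 hM j i

lemma matrix_mul {M : ℕ → Ω → Matrix l κ ℝ} {N : ℕ → Ω → Matrix κ ι ℝ}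
    (hM : HasLpRate P e M) (hN : HasLpRate P e' N) :
    HasLpRate P (e + e') (fun J ω ↦ M J ω * N J ω) :=
  hasLpRate_matrix_iff.2 fun i j ↦ by
    simpa only [Matrix.mul_apply] using HasLpRate.sum _ fun k _ ↦
      (hasLpRate_matrix_iff.1 hM i k).mul (hasLpRate_matrix_iff.1 hN k j)

lemma trace {M : ℕ → Ω → Matrix ι ι ℝ} (hM : HasLpRate P e M) :
    HasLpRate P e (fun J ω ↦ (M J ω).trace) :=
  HasLpRate.sum _ fun k _ ↦ hasLpRate_matrix_iff.1 hM k k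

variable [IsFiniteMeasure P]

lemma matrix_mul_sub_mul {M : ℕ → Ω → Matrix l κ ℝ} {N : ℕ → Ω → Matrix κ ι ℝ}
    {A : Matrix l κ ℝ} {B : Matrix κ ι ℝ} (hM : HasLpRate P e (fun J ω ↦ M J ω - A))
    (hN : HasLpRate P e (fun J ω ↦ N J ω - B)) :
    HasLpRate P e (fun J ω ↦ M J ω * N J ω - A * B) := by
  have hsum := ((hM.matrix_mul hN.of_sub_const).mono (add_zero e).ge).add
    (((const A).matrix_mul hN).mono (zero_add e).ge)
  have hsplit : ∀ J ω, (M J ω - A) * N J ω + A * (N J ω - B) = M J ω * N J ω - A * B :=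
    fun J ω ↦ by rw [Matrix.sub_mul, Matrix.mul_sub, sub_add_sub_cancel]
  simpa only [hsplit] using hsum

variable [DecidableEq ι]

lemma det {M : ℕ → Ω → Matrix ι ι ℝ} (hM : HasLpRate P 0 M) :
    HasLpRate P 0 (fun J ω ↦ (M J ω).det) := by
  simp only [Matrix.det_apply']
  exact HasLpRate.sum _ fun σ _ ↦
    (HasLpRate.prod _ fun i _ ↦ hasLpRate_matrix_iff.1 hM (σ i) i).const_mul _

lemma matrix_inv {M : ℕ → Ω → Matrix ι ι ℝ} (hM : HasLpRate P 0 M)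
    (hdet : HasLpRate P 0 (fun J ω ↦ (M J ω).det⁻¹)) : HasLpRate P 0 (fun J ω ↦ (M J ω)⁻¹) := by
  refine hasLpRate_matrix_iff.2 fun i j ↦ ?_
  simp only [Matrix.inv_def, Ring.inverse_eq_inv', Matrix.smul_apply, smul_eq_mul,
    Matrix.adjugate_apply]
  refine hdet.mul (det (hasLpRate_matrix_iff.2 fun a b ↦ ?_))
  simp only [Matrix.updateRow_apply]
  split_ifs
  · exact const _
  · exact hasLpRate_matrix_iff.1 hM a b

lemma matrix_inv_sub_inv {M : ℕ → Ω → Matrix ι ι ℝ} {A : Matrix ι ι ℝ} (hA : IsUnit A)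
    (hM : HasLpRate P e (fun J ω ↦ M J ω - A)) (hinv : HasLpRate P 0 (fun J ω ↦ (M J ω)⁻¹))
    (hunit : ∀ᶠ J in atTop, ∀ᵐ ω ∂P, IsUnit (M J ω)) :
    HasLpRate P e (fun J ω ↦ (M J ω)⁻¹ - A⁻¹) := by
  refine (((hinv.matrix_mul hM).matrix_mul (const A⁻¹)).neg.mono (zero_add e).ge).congr ?_
  filter_upwards [hunit] with J hJ
  filter_upwards [hJ] with ω hω
  rw [Matrix.inv_sub_inv (iff_of_true hω hA), ← neg_sub (M J ω) A, Matrix.mul_neg, Matrix.neg_mul]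

end HasLpRate

lemma tendstoZeroL2WithRate_of_enorm_le {ε : Type*} [TopologicalSpace ε] [ENorm ε]
    {X : ℕ → Ω → ε} {Y : ℕ → Ω → E} (hY : HasLpRate P 2 Y)
    (hX : ∀ᶠ J in atTop, AEStronglyMeasurable (X J) P)
    (h : ∀ᶠ J in atTop, ∀ᵐ ω ∂P, ‖X J ω‖ₑ ≤ ‖Y J ω‖ₑ) :
    TendstoZeroL2WithRate P X (fun J ↦ (J : ℝ)⁻¹) := by
  obtain ⟨c, hc⟩ := hY 2 two_ne_zero
  have hle : ∀ᶠ J : ℕ in atTop, eLpNorm (X J) 2 P ≤ (c * (J : ℝ≥0)⁻¹ : ℝ≥0) := by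
    filter_upwards [hc, h] with J hY hXY
    rw [inv_pow, NNReal.sq_sqrt] at hY
    exact (eLpNorm_mono_enorm_ae hXY).trans hY.2
  have hlim : Tendsto (fun J : ℕ ↦ ((c * (J : ℝ≥0)⁻¹ : ℝ≥0) : ℝ≥0∞)) atTop (𝓝 0) := by
    have := (tendsto_inv_atTop_nhds_zero_nat (𝕜 := ℝ≥0)).const_mul c
    rwa [mul_zero, ← ENNReal.tendsto_coe, ENNReal.coe_zero] at this
  refine ⟨?_, ?_, ?_⟩
  · filter_upwards [hle, hX] with J hJ hXJ
    exact ⟨hXJ, hJ.trans_lt ENNReal.coe_lt_top⟩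
  · exact tendsto_of_tendsto_of_tendsto_of_le_of_le' tendsto_const_nhds hlim
      (Eventually.of_forall fun _ ↦ zero_le) hle
  · refine IsBigO.of_bound c (hle.mono fun J hJ ↦ ?_)
    rw [Real.norm_of_nonneg ENNReal.toReal_nonneg, Real.norm_of_nonneg (by positivity)]
    simpa using ENNReal.toReal_mono ENNReal.coe_ne_top hJ

lemma HasLpRate.tendstoZeroL2WithRate {X : ℕ → Ω → E} (hX : HasLpRate P 2 X) :
    TendstoZeroL2WithRate P X (fun J ↦ (J : ℝ)⁻¹) :=
  tendstoZeroL2WithRate_of_enorm_le hX hX.aestronglyMeasurable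
    (Eventually.of_forall fun _ ↦ Eventually.of_forall fun _ ↦ le_rfl)

lemma HasLpRate.tendstoZeroL2WithRate_of_ae_eq_ofReal {X : ℕ → Ω → ℝ≥0∞} {Y : ℕ → Ω → ℝ}
    (hY : HasLpRate P 2 Y) (h : ∀ᶠ J in atTop, X J =ᵐ[P] fun ω ↦ ENNReal.ofReal (Y J ω)) :
    TendstoZeroL2WithRate P X (fun J ↦ (J : ℝ)⁻¹) := by
  refine tendstoZeroL2WithRate_of_enorm_le hY ?_ ?_
  · filter_upwards [h, hY.aestronglyMeasurable] with J hXY hYJ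
    exact hYJ.aemeasurable.ennreal_ofReal.aestronglyMeasurable.congr hXY.symm
  · filter_upwards [h] with J hXY
    filter_upwards [hXY] with ω hω
    rw [hω, enorm_eq_self]
    exact Real.ofReal_le_enorm _

end Rates

section Averages

open scoped NNReal

variable {Ω : Type*} [MeasurableSpace Ω] {P : Measure Ω}

lemma eLpNorm_le_of_lintegral_enorm_pow_le {E : Type*} [NormedAddCommGroup E] {X : Ω → E} {q : ℕ}
    (hq : q ≠ 0) {t : ℝ≥0∞} (h : ∫⁻ ω, ‖X ω‖ₑ ^ q ∂P ≤ t ^ q) : eLpNorm X q P ≤ t := by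
  rw [eLpNorm_eq_lintegral_rpow_enorm_toReal (Nat.cast_ne_zero.2 hq) (ENNReal.natCast_ne_top q)]
  simp only [ENNReal.toReal_natCast, ENNReal.rpow_natCast]
  calc (∫⁻ ω, ‖X ω‖ₑ ^ q ∂P) ^ (1 / (q : ℝ))
      ≤ (t ^ q) ^ (1 / (q : ℝ)) := ENNReal.rpow_le_rpow h (by positivity)
    _ = t := by rw [one_div, ENNReal.pow_rpow_inv_natCast hq]

lemma lintegral_enorm_pow_two_mul {X : Ω → ℝ} {m : ℕ}
    (hX : Integrable (fun ω ↦ X ω ^ (2 * m)) P) :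
    ∫⁻ ω, ‖X ω‖ₑ ^ (2 * m) ∂P = ENNReal.ofReal (∫ ω, X ω ^ (2 * m) ∂P) := by
  rw [ofReal_integral_eq_lintegral_ofReal hX
    (Eventually.of_forall fun ω ↦ (even_two_mul m).pow_nonneg _)]
  refine lintegral_congr fun ω ↦ ?_
  rw [Real.enorm_eq_ofReal_abs, ← ENNReal.ofReal_pow (abs_nonneg _), (even_two_mul m).pow_abs]

lemma abs_pow_le_one_add_pow {k m : ℕ} (hk : k ≤ 2 * m) (s : ℝ) : |s ^ k| ≤ 1 + s ^ (2 * m) := by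
  rw [abs_pow, ← (even_two_mul m).pow_abs]
  rcases le_total |s| 1 with hs | hs
  · exact (pow_le_one₀ (abs_nonneg s) hs).trans (le_add_of_nonneg_right (by positivity))
  · exact (pow_le_pow_right₀ hs hk).trans (le_add_of_nonneg_left zero_le_one)

variable [IsProbabilityMeasure P] {S ξ : Ω → ℝ}

lemma integrable_pow_of_memLp {q : ℕ} (hS : MemLp S q P) : Integrable (fun ω ↦ S ω ^ q) P :=
  hS.integrable_norm_pow'.mono (hS.1.pow q) (Eventually.of_forall fun ω ↦ by
    rw [norm_pow, norm_pow, norm_norm])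

lemma abs_integral_pow_le (hS : ∀ q : ℕ, MemLp S q P) {k m : ℕ} (hk : k ≤ 2 * m) :
    |∫ ω, S ω ^ k ∂P| ≤ 1 + ∫ ω, S ω ^ (2 * m) ∂P :=
  calc |∫ ω, S ω ^ k ∂P|
      ≤ ∫ ω, |S ω ^ k| ∂P := abs_integral_le_integral_abs
    _ ≤ ∫ ω, (1 + S ω ^ (2 * m)) ∂P :=
        integral_mono (integrable_pow_of_memLp (hS k)).abs
          ((integrable_const _).add (integrable_pow_of_memLp (hS _)))
          fun ω ↦ abs_pow_le_one_add_pow hk _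
    _ = 1 + ∫ ω, S ω ^ (2 * m) ∂P := by
        rw [integral_add (integrable_const _) (integrable_pow_of_memLp (hS _)), integral_const,
          probReal_univ, one_smul]

lemma integral_add_pow_of_indepFun (hindep : IndepFun S ξ P) (hS : ∀ q : ℕ, MemLp S q P)
    (hξ : ∀ q : ℕ, MemLp ξ q P) (n : ℕ) :
    ∫ ω, (S ω + ξ ω) ^ n ∂P = ∑ k ∈ Finset.range (n + 1),
      (∫ ω, S ω ^ k ∂P) * (∫ ω, ξ ω ^ (n - k) ∂P) * (n.choose k : ℝ) := by
  have hpow : ∀ a b : ℕ, IndepFun (fun ω ↦ S ω ^ a) (fun ω ↦ ξ ω ^ b) P := fun a b ↦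
    hindep.comp (measurable_id.pow_const a) (measurable_id.pow_const b)
  have hint : ∀ k, Integrable (fun ω ↦ S ω ^ k * ξ ω ^ (n - k)) P := fun k ↦
    (hpow k (n - k)).integrable_mul (integrable_pow_of_memLp (hS k))
      (integrable_pow_of_memLp (hξ (n - k)))
  simp_rw [add_pow]
  rw [integral_finsetSum _ fun k _ ↦ (hint k).mul_const _]
  refine Finset.sum_congr rfl fun k _ ↦ ?_
  rw [integral_mul_const, (hpow k (n - k)).integral_fun_mul_eq_mul_integral ((hS k).1.pow k)
    ((hξ k).1.pow (n - k))]

lemma integral_add_pow_le_of_indepFun (hindep : IndepFun S ξ P) (hS : ∀ q : ℕ, MemLp S q P)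
    (hξ : ∀ q : ℕ, MemLp ξ q P) (hmean : ∫ ω, ξ ω ∂P = 0) (m : ℕ) :
    ∫ ω, (S ω + ξ ω) ^ (2 * m + 2) ∂P ≤ ∫ ω, S ω ^ (2 * m + 2) ∂P +
      (∑ k ∈ Finset.range (2 * m + 1),
        |∫ ω, ξ ω ^ (2 * m + 2 - k) ∂P| * ((2 * m + 2).choose k : ℝ)) *
      (1 + ∫ ω, S ω ^ (2 * m) ∂P) := by
  rw [integral_add_pow_of_indepFun hindep hS hξ, Finset.sum_range_succ, Finset.sum_range_succ]
  -- the term of degree one in `ξ` vanishes, which is what brings the exponent of `S` down by two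
  have hlin : 2 * m + 2 - (2 * m + 1) = 1 := by omega
  simp only [hlin, pow_one, hmean, mul_zero, zero_mul, add_zero, Nat.sub_self, pow_zero,
    integral_const, probReal_univ, smul_eq_mul, mul_one, Nat.choose_self, Nat.cast_one]
  rw [add_comm, Finset.sum_mul]
  refine add_le_add_right (Finset.sum_le_sum fun k hk ↦ ?_) _
  calc (∫ ω, S ω ^ k ∂P) * (∫ ω, ξ ω ^ (2 * m + 2 - k) ∂P) * ((2 * m + 2).choose k : ℝ)
      ≤ |∫ ω, S ω ^ k ∂P| * |∫ ω, ξ ω ^ (2 * m + 2 - k) ∂P| * ((2 * m + 2).choose k : ℝ) := by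
        rw [← abs_mul]; gcongr; exact le_abs_self _
    _ ≤ (1 + ∫ ω, S ω ^ (2 * m) ∂P) * |∫ ω, ξ ω ^ (2 * m + 2 - k) ∂P| *
          ((2 * m + 2).choose k : ℝ) := by
        gcongr; exact abs_integral_pow_le hS (Nat.lt_succ_iff.1 (Finset.mem_range.1 hk))
    _ = |∫ ω, ξ ω ^ (2 * m + 2 - k) ∂P| * ((2 * m + 2).choose k : ℝ) *
          (1 + ∫ ω, S ω ^ (2 * m) ∂P) := by ring

section Sequence

variable {ξ : ℕ → Ω → ℝ}

lemma exists_integral_sum_pow_le (hindep : iIndepFun ξ P)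
    (hident : ∀ j, IdentDistrib (ξ j) (ξ 0) P P) (hmem : ∀ q : ℕ, MemLp (ξ 0) q P)
    (hmean : ∫ ω, ξ 0 ω ∂P = 0) (m : ℕ) :
    ∃ c : ℝ≥0, ∀ J : ℕ, ∫ ω, (∑ j ∈ Finset.range J, ξ j ω) ^ (2 * m) ∂P ≤ c * (J : ℝ) ^ m := by
  have hmem' : ∀ j (q : ℕ), MemLp (ξ j) q P := fun j q ↦ (hident j).memLp_iff.2 (hmem q)
  induction m with
  | zero => exact ⟨1, fun J ↦ by simp⟩
  | succ m ih =>
    obtain ⟨c, hc⟩ := ih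
    set K := ∑ k ∈ Finset.range (2 * m + 1),
      |∫ ω, ξ 0 ω ^ (2 * m + 2 - k) ∂P| * ((2 * m + 2).choose k : ℝ) with hK
    have hK0 : 0 ≤ K := Finset.sum_nonneg fun k _ ↦ by positivity
    refine ⟨K.toNNReal * (1 + c), fun J ↦ ?_⟩
    rw [NNReal.coe_mul, Real.coe_toNNReal _ hK0, NNReal.coe_add, NNReal.coe_one, mul_add_one]
    induction J with
    | zero => simp
    | succ J ihJ =>
      have hind : IndepFun (fun ω ↦ ∑ j ∈ Finset.range J, ξ j ω) (ξ J) P := by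
        simpa only [← Finset.sum_apply] using
          hindep.indepFun_sum_range_succ₀ (fun i ↦ (hmem' i 1).1.aemeasurable) J
      have hmoment : ∀ q : ℕ, ∫ ω, ξ J ω ^ q ∂P = ∫ ω, ξ 0 ω ^ q ∂P := fun q ↦
        ((hident J).comp (measurable_id.pow_const q)).integral_eq
      have hstep := integral_add_pow_le_of_indepFun hind
        (fun q ↦ memLp_finsetSum _ fun j _ ↦ hmem' j q) (hmem' J)
        ((hident J).integral_eq.trans hmean) m
      simp only [hmoment, ← hK, ← Finset.sum_range_succ] at hstep
      have hone : (1 : ℝ) ≤ ((J : ℝ) + 1) ^ m := one_le_pow₀ (le_add_of_nonneg_left J.cast_nonneg)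
      have hJ : (J : ℝ) ^ m ≤ ((J : ℝ) + 1) ^ m := by gcongr; linarith
      push_cast
      calc ∫ ω, (∑ j ∈ Finset.range (J + 1), ξ j ω) ^ (2 * m + 2) ∂P
          ≤ K * (1 + c) * (J : ℝ) ^ (m + 1) + K * (1 + c * (J : ℝ) ^ m) :=
            hstep.trans (add_le_add ihJ (mul_le_mul_of_nonneg_left
              (add_le_add_right (hc J) 1) hK0))
        _ ≤ K * (1 + c) * (((J : ℝ) + 1) ^ m * J) +
              K * (((J : ℝ) + 1) ^ m + c * ((J : ℝ) + 1) ^ m) := by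
            rw [pow_succ]; gcongr
        _ = K * (1 + c) * ((J : ℝ) + 1) ^ (m + 1) := by ring

lemma hasLpRate_average (hindep : iIndepFun ξ P) (hident : ∀ j, IdentDistrib (ξ j) (ξ 0) P P)
    (hmem : ∀ q : ℕ, MemLp (ξ 0) q P) (hmean : ∫ ω, ξ 0 ω ∂P = 0) :
    HasLpRate P 1 (fun J ω ↦ (J : ℝ)⁻¹ * ∑ j ∈ Finset.range J, ξ j ω) := by
  intro q hq
  obtain ⟨c, hc⟩ := exists_integral_sum_pow_le hindep hident hmem hmean q
  have hS : ∀ (J : ℕ) (r : ℕ), MemLp (fun ω ↦ (J : ℝ)⁻¹ * ∑ j ∈ Finset.range J, ξ j ω) r P :=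
    fun J r ↦ (memLp_finsetSum _ fun j _ ↦ (hident j).memLp_iff.2 (hmem r)).const_mul _
  refine ⟨c ^ (2 * q : ℝ)⁻¹, (eventually_ge_atTop 1).mono fun J hJ ↦ ⟨(hS J 1).1, ?_⟩⟩
  have hJ0 : (J : ℝ) ≠ 0 := by positivity
  refine (eLpNorm_le_eLpNorm_of_exponent_le (q := (2 * q : ℕ))
    (by exact_mod_cast Nat.le_mul_of_pos_left q two_pos) (hS J 1).1).trans
    (eLpNorm_le_of_lintegral_enorm_pow_le (mul_ne_zero two_ne_zero hq) ?_)
  calc ∫⁻ ω, ‖(J : ℝ)⁻¹ * ∑ j ∈ Finset.range J, ξ j ω‖ₑ ^ (2 * q) ∂P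
      = ENNReal.ofReal ((J : ℝ)⁻¹ ^ (2 * q) *
          ∫ ω, (∑ j ∈ Finset.range J, ξ j ω) ^ (2 * q) ∂P) := by
        rw [lintegral_enorm_pow_two_mul (integrable_pow_of_memLp (hS J _)), ← integral_const_mul]
        simp only [mul_pow]
    _ ≤ ENNReal.ofReal ((J : ℝ)⁻¹ ^ (2 * q) * (c * (J : ℝ) ^ q)) :=
        ENNReal.ofReal_le_ofReal (mul_le_mul_of_nonneg_left (hc J) (by positivity))
    _ = ((c * (J : ℝ≥0)⁻¹ ^ q : ℝ≥0) : ℝ≥0∞) := by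
        rw [← ENNReal.ofReal_coe_nnreal]
        push_cast
        congr 1
        rw [two_mul, pow_add, mul_left_comm, mul_assoc, inv_pow,
          inv_mul_cancel₀ (pow_ne_zero q hJ0), mul_one]
    _ = ((c ^ (2 * q : ℝ)⁻¹ * (NNReal.sqrt J)⁻¹ ^ 1 : ℝ≥0) : ℝ≥0∞) ^ (2 * q) := by
        rw [← ENNReal.coe_pow, mul_pow, pow_one, pow_mul (NNReal.sqrt _)⁻¹,
          inv_pow (NNReal.sqrt _) 2, NNReal.sq_sqrt, ← NNReal.rpow_natCast (c ^ _),
          ← NNReal.rpow_mul, Nat.cast_mul, Nat.cast_two, inv_mul_cancel₀ (by positivity),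
          NNReal.rpow_one]

end Sequence

end Averages

section Density

variable {E : Type*} [NormedAddCommGroup E] [InnerProductSpace ℝ E] [FiniteDimensional ℝ E]
  [MeasurableSpace E] [BorelSpace E]

open scoped RealInnerProductSpace

lemma integrable_exp_neg_half_sq_norm : Integrable fun x : E ↦ Real.exp (-(1 / 2) * ‖x‖ ^ 2) := by
  have h := (GaussianFourier.integrable_cexp_neg_mul_sq_norm_add (V := E) (b := 1 / 2)
    (by norm_num) 0 0).re
  refine h.congr (.of_forall fun x ↦ ?_)
  have h_real : -(1 / 2 : ℂ) * (‖x‖ : ℂ) ^ 2 + 0 * (⟪(0 : E), x⟫ : ℝ) =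
      ((-(1 / 2) * ‖x‖ ^ 2 : ℝ) : ℂ) := by
    push_cast; ring
  simp only [h_real, ← Complex.ofReal_exp, RCLike.re_to_complex, Complex.ofReal_re]

lemma integral_exp_neg_half_sq_norm_mul_cexp_inner (t : E) :
    ∫ x : E, (Real.exp (-(1 / 2) * ‖x‖ ^ 2) : ℂ) * Complex.exp (⟪x, t⟫ * Complex.I) =
      √((2 * Real.pi) ^ Module.finrank ℝ E) * Complex.exp (-‖t‖ ^ 2 / 2) := by
  have h_const : ((Real.pi : ℂ) / (1 / 2)) ^ ((Module.finrank ℝ E : ℂ) / 2) =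
      (√((2 * Real.pi) ^ Module.finrank ℝ E) : ℝ) := by
    rw [Real.sqrt_eq_rpow, ← Real.rpow_natCast_mul (by positivity),
      Complex.ofReal_cpow (by positivity)]
    push_cast
    congr 1 <;> ring
  have h_exponent : Complex.I ^ 2 * (‖t‖ : ℂ) ^ 2 / (4 * (1 / 2)) = -‖t‖ ^ 2 / 2 := by
    rw [Complex.I_sq]
    ring
  rw [← h_const, ← h_exponent, ← GaussianFourier.integral_cexp_neg_mul_sq_norm_add
    (V := E) (b := 1 / 2) (by norm_num) Complex.I t]
  refine integral_congr_ae (.of_forall fun x ↦ ?_)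
  simp only [Complex.ofReal_exp, ← Complex.exp_add, real_inner_comm t x]
  push_cast
  ring_nf

lemma stdGaussian_eq_withDensity :
    stdGaussian E = volume.withDensity fun x ↦ ENNReal.ofReal
      ((√((2 * Real.pi) ^ Module.finrank ℝ E))⁻¹ * Real.exp (-(1 / 2) * ‖x‖ ^ 2)) := by
  set c := √((2 * Real.pi) ^ Module.finrank ℝ E)
  have hc_pos : 0 < c := by positivity
  have : IsFiniteMeasure (volume.withDensity fun x : E ↦ ENNReal.ofReal
      (c⁻¹ * Real.exp (-(1 / 2) * ‖x‖ ^ 2))) :=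
    isFiniteMeasure_withDensity_ofReal (integrable_exp_neg_half_sq_norm.const_mul c⁻¹).2
  refine Measure.ext_of_charFun (funext fun t ↦ ?_)
  rw [charFun_stdGaussian, charFun_apply, integral_withDensity_eq_integral_toReal_smul
    (by fun_prop) (.of_forall fun x ↦ ENNReal.ofReal_lt_top)]
  calc Complex.exp (-‖t‖ ^ 2 / 2)
    _ = (c⁻¹ : ℝ) * (c * Complex.exp (-‖t‖ ^ 2 / 2)) := by
        rw [← mul_assoc, ← Complex.ofReal_mul, inv_mul_cancel₀ hc_pos.ne', Complex.ofReal_one,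
          one_mul]
    _ = ∫ x : E, (c⁻¹ : ℝ) *
          ((Real.exp (-(1 / 2) * ‖x‖ ^ 2) : ℂ) * Complex.exp (⟪x, t⟫ * Complex.I)) := by
        rw [integral_const_mul, integral_exp_neg_half_sq_norm_mul_cexp_inner]
    _ = _ := by
        refine integral_congr_ae (.of_forall fun x ↦ ?_)
        simp only [ENNReal.toReal_ofReal (show 0 ≤ c⁻¹ * Real.exp (-(1 / 2) * ‖x‖ ^ 2) by
          positivity), Complex.real_smul, Complex.ofReal_mul, mul_assoc]

end Density

section MultivariateDensity

open scoped MatrixOrder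

variable {ι : Type*} [Fintype ι]

/-- The quadratic form `⟨v, S v⟩` of a matrix. -/
noncomputable def quadForm (S : Matrix ι ι ℝ) (v : EuclideanSpace ℝ ι) : ℝ :=
  v.ofLp ⬝ᵥ (S *ᵥ v.ofLp)

@[fun_prop]
lemma continuous_quadForm (S : Matrix ι ι ℝ) : Continuous (quadForm S) := by
  unfold quadForm
  fun_prop

variable [DecidableEq ι]

lemma det_toEuclideanCLM (L : Matrix ι ι ℝ) :
    (Matrix.toEuclideanCLM (𝕜 := ℝ) L).det = L.det := by
  rw [ContinuousLinearMap.det, Matrix.coe_toEuclideanCLM_eq_toEuclideanLin,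
    Matrix.toEuclideanLin_eq_toLin_orthonormal, LinearMap.det_toLin]

lemma isUnit_cfcSqrt {S : Matrix ι ι ℝ} (hS : S.PosDef) : IsUnit (CFC.sqrt S) :=
  CFC.isUnit_sqrt_iff_isStrictlyPositive.2 hS.isStrictlyPositive

lemma quadForm_inv_toEuclideanCLM_cfcSqrt {S : Matrix ι ι ℝ} (hS : S.PosDef)
    (x : EuclideanSpace ℝ ι) :
    quadForm S⁻¹ (Matrix.toEuclideanCLM (𝕜 := ℝ) (CFC.sqrt S) x) = ‖x‖ ^ 2 := by
  set L := CFC.sqrt S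
  have hL_sq : L * L = S := CFC.sqrt_mul_sqrt_self _ hS.posSemidef.nonneg
  have hL_symm : Lᵀ = L := (Matrix.nonneg_iff_posSemidef.1 (CFC.sqrt_nonneg S)).1
  have hL_det : IsUnit L.det := (Matrix.isUnit_iff_isUnit_det _).1 (isUnit_cfcSqrt hS)
  have hL_inv : L * (S⁻¹ * L) = 1 := by
    rw [← hL_sq, Matrix.mul_inv_rev, Matrix.mul_assoc, Matrix.nonsing_inv_mul _ hL_det,
      Matrix.mul_one, Matrix.mul_nonsing_inv _ hL_det]
  rw [quadForm, Matrix.ofLp_toEuclideanCLM, Matrix.mulVec_mulVec, dotProduct_comm,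
    Matrix.dotProduct_mulVec, ← Matrix.mulVec_transpose, hL_symm, Matrix.mulVec_mulVec, hL_inv,
    Matrix.one_mulVec, EuclideanSpace.real_norm_sq_eq]
  simp only [dotProduct, sq]

lemma multivariateGaussian_eq_withDensity (m : EuclideanSpace ℝ ι) {S : Matrix ι ι ℝ}
    (hS : S.PosDef) :
    multivariateGaussian m S = volume.withDensity fun x ↦ ENNReal.ofReal
      ((√((2 * Real.pi) ^ Fintype.card ι * S.det))⁻¹ *
        Real.exp (-(1 / 2) * quadForm S⁻¹ (x - m))) := by
  set L := CFC.sqrt S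
  set T : EuclideanSpace ℝ ι → EuclideanSpace ℝ ι :=
    fun x ↦ m + Matrix.toEuclideanCLM (𝕜 := ℝ) L x with hT
  have hT_bij : Function.Bijective T := (AddGroup.addLeft_bijective m).comp
    (ContinuousLinearMap.isUnit_iff_bijective.1 ((isUnit_cfcSqrt hS).map Matrix.toEuclideanCLM))
  have hT_deriv (x) : HasFDerivAt T (Matrix.toEuclideanCLM (𝕜 := ℝ) L) x :=
    (Matrix.toEuclideanCLM (𝕜 := ℝ) L).hasFDerivAt.const_add m
  have h_det : √S.det = |L.det| := by
    rw [← CFC.sqrt_mul_sqrt_self S hS.posSemidef.nonneg, Matrix.det_mul, ← sq, Real.sqrt_sq_eq_abs]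
  have h_det_ne : |L.det| ≠ 0 := h_det ▸ (Real.sqrt_pos.2 hS.det_pos).ne'
  have hT_meas : Measurable T := by fun_prop
  ext s hs
  rw [multivariateGaussian, stdGaussian_eq_withDensity, Measure.map_apply hT_meas hs,
    withDensity_apply _ (hT_meas hs), withDensity_apply _ hs,
    ← Set.image_preimage_eq s hT_bij.surjective,
    lintegral_image_eq_lintegral_abs_det_fderiv_mul _ (hT_meas hs)
      (fun x _ ↦ (hT_deriv x).hasFDerivWithinAt) hT_bij.injective.injOn,
    Set.image_preimage_eq s hT_bij.surjective, det_toEuclideanCLM]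
  refine lintegral_congr fun x ↦ ?_
  rw [← ENNReal.ofReal_mul (abs_nonneg _), hT, add_sub_cancel_left,
    quadForm_inv_toEuclideanCLM_cfcSqrt hS, finrank_euclideanSpace,
    Real.sqrt_mul (by positivity), h_det]
  congr 1
  field_simp

lemma lintegral_exp_neg_quadForm {S : Matrix ι ι ℝ} (hS : S.PosDef) :
    ∫⁻ v : EuclideanSpace ℝ ι, ENNReal.ofReal (Real.exp (-(1 / 2) * quadForm S v)) =
      ENNReal.ofReal √((2 * Real.pi) ^ Fintype.card ι / S.det) := by
  have h_mass : multivariateGaussian (0 : EuclideanSpace ℝ ι) S⁻¹ Set.univ = 1 := measure_univ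
  have h_det := hS.det_pos
  simp only [multivariateGaussian_eq_withDensity _ hS.inv,
    Matrix.nonsing_inv_nonsing_inv _ h_det.ne'.isUnit, Matrix.det_nonsing_inv,
    Ring.inverse_eq_inv', ← div_eq_mul_inv, sub_zero, withDensity_apply _ MeasurableSet.univ,
    Measure.restrict_univ, ENNReal.ofReal_mul (inv_nonneg.2 (Real.sqrt_nonneg _))] at h_mass
  rw [lintegral_const_mul _ (by fun_prop), ENNReal.ofReal_inv_of_pos (by positivity),
    mul_comm] at h_mass
  rw [ENNReal.eq_inv_of_mul_eq_one_left h_mass, inv_inv]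

end MultivariateDensity

section GaussianVector

open scoped RealInnerProductSpace NNReal

variable {ι κ : Type*} [Fintype ι] [Fintype κ] {Ω : Type*} [MeasurableSpace Ω] {P : Measure Ω}
  {X Y : Ω → EuclideanSpace ℝ ι} {m m' : EuclideanSpace ℝ ι} {C C' : Matrix ι ι ℝ}

lemma inner_eq_dotProduct (x y : EuclideanSpace ℝ ι) : ⟪x, y⟫ = x.ofLp ⬝ᵥ y.ofLp := by
  rw [EuclideanSpace.inner_eq_star_dotProduct, star_trivial, dotProduct_comm]

lemma quadForm_eq_sum (Q : Matrix ι ι ℝ) (x : EuclideanSpace ℝ ι) :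
    quadForm Q x = ∑ i, ∑ j, Q i j * (x i * x j) := by
  simp only [quadForm, dotProduct, Matrix.mulVec, Finset.mul_sum]
  exact Finset.sum_congr rfl fun i _ ↦ Finset.sum_congr rfl fun j _ ↦ by ring

lemma quadForm_nonneg (hC : C.PosSemidef) (v : EuclideanSpace ℝ ι) : 0 ≤ quadForm C v := by
  rw [quadForm, ← star_trivial v.ofLp]
  exact hC.dotProduct_mulVec_nonneg v.ofLp

variable [DecidableEq ι]

/-- The linear map `x ↦ B x` of Euclidean spaces given by a rectangular matrix, as a continuous
map. -/
noncomputable def matrixCLM (B : Matrix κ ι ℝ) : EuclideanSpace ℝ ι →L[ℝ] EuclideanSpace ℝ κ :=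
  (Matrix.toEuclideanLin B).toContinuousLinearMap

@[simp]
lemma ofLp_matrixCLM (B : Matrix κ ι ℝ) (x : EuclideanSpace ℝ ι) :
    (matrixCLM B x).ofLp = B *ᵥ x.ofLp := rfl

lemma matrixCLM_one : matrixCLM (1 : Matrix ι ι ℝ) = ContinuousLinearMap.id ℝ _ := by
  ext x
  rw [ofLp_matrixCLM, Matrix.one_mulVec, ContinuousLinearMap.id_apply]

lemma matrixCLM_zero : matrixCLM (0 : Matrix κ ι ℝ) = 0 := by
  ext x
  rw [ofLp_matrixCLM, Matrix.zero_mulVec, zero_apply, WithLp.ofLp_zero]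

lemma matrixCLM_neg (B : Matrix κ ι ℝ) : matrixCLM (-B) = -matrixCLM B := by
  ext x
  rw [ofLp_matrixCLM, Matrix.neg_mulVec, neg_apply, WithLp.ofLp_neg,
    ofLp_matrixCLM]

lemma matrixCLM_add (B L : Matrix κ ι ℝ) : matrixCLM (B + L) = matrixCLM B + matrixCLM L := by
  ext x
  rw [ofLp_matrixCLM, Matrix.add_mulVec, add_apply, WithLp.ofLp_add,
    ofLp_matrixCLM, ofLp_matrixCLM]

lemma matrixCLM_mul {ρ : Type*} [Fintype ρ] [DecidableEq κ] (L : Matrix ρ κ ℝ) (B : Matrix κ ι ℝ)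
    (x : EuclideanSpace ℝ ι) : matrixCLM (L * B) x = matrixCLM L (matrixCLM B x) := by
  ext i
  rw [ofLp_matrixCLM, ofLp_matrixCLM, ofLp_matrixCLM, Matrix.mulVec_mulVec]

lemma inner_matrixCLM_left [DecidableEq κ] (B : Matrix κ ι ℝ)
    (x : EuclideanSpace ℝ ι) (t : EuclideanSpace ℝ κ) :
    ⟪matrixCLM B x, t⟫ = ⟪x, matrixCLM Bᵀ t⟫ := by
  rw [inner_eq_dotProduct, inner_eq_dotProduct, ofLp_matrixCLM, ofLp_matrixCLM, dotProduct_comm,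
    Matrix.dotProduct_mulVec, dotProduct_comm, Matrix.mulVec_transpose]

lemma quadForm_matrixCLM (B : Matrix κ ι ℝ) (Q : Matrix κ κ ℝ) (x : EuclideanSpace ℝ ι) :
    quadForm Q (matrixCLM B x) = quadForm (Bᵀ * Q * B) x := by
  rw [quadForm, quadForm, ofLp_matrixCLM, ← Matrix.mulVec_mulVec, ← Matrix.mulVec_mulVec,
    Matrix.dotProduct_mulVec _ Bᵀ, ← Matrix.mulVec_transpose Bᵀ, Matrix.transpose_transpose]

lemma charFun_multivariateGaussian_eq (hC : C.PosSemidef) (t : EuclideanSpace ℝ ι) :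
    charFun (multivariateGaussian m C) t =
      Complex.exp (⟪m, t⟫ * Complex.I - quadForm C t / 2) := by
  rw [charFun_multivariateGaussian hC, real_inner_comm, quadForm]

lemma hasLaw_matrixCLM_add [DecidableEq κ] (hC : C.PosSemidef)
    (hX : HasLaw X (multivariateGaussian m C) P)
    (B : Matrix κ ι ℝ) (c : EuclideanSpace ℝ κ) :
    HasLaw (fun ω ↦ matrixCLM B (X ω) + c)
      (multivariateGaussian (matrixCLM B m + c) (B * C * Bᵀ)) P := by
  have hBC : (B * C * Bᵀ).PosSemidef := hC.mul_mul_conjTranspose_same B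
  have h_meas : Measurable fun x ↦ matrixCLM B x + c := by fun_prop
  refine HasLaw.comp (Y := fun x ↦ matrixCLM B x + c) ⟨h_meas.aemeasurable, ?_⟩ hX
  have := Measure.isProbabilityMeasure_map (μ := multivariateGaussian m C) h_meas.aemeasurable
  refine Measure.ext_of_charFun (funext fun t ↦ ?_)
  have h_split (x : EuclideanSpace ℝ ι) : Complex.exp (⟪matrixCLM B x + c, t⟫ * Complex.I) =
      Complex.exp (⟪c, t⟫ * Complex.I) * Complex.exp (⟪x, matrixCLM Bᵀ t⟫ * Complex.I) := by
    rw [inner_add_left, inner_matrixCLM_left, ← Complex.exp_add]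
    push_cast
    ring_nf
  rw [charFun_apply, integral_map h_meas.aemeasurable (by fun_prop)]
  simp only [h_split]
  rw [integral_const_mul, ← charFun_apply, charFun_multivariateGaussian_eq hC,
    charFun_multivariateGaussian_eq hBC, ← Complex.exp_add, inner_add_left, inner_matrixCLM_left,
    quadForm_matrixCLM, Matrix.transpose_transpose]
  push_cast
  ring_nf

lemma hasLaw_sub_const (hC : C.PosSemidef) (hX : HasLaw X (multivariateGaussian m C) P)
    (c : EuclideanSpace ℝ ι) : HasLaw (fun ω ↦ X ω - c) (multivariateGaussian (m - c) C) P := by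
  simpa only [matrixCLM_one, ContinuousLinearMap.id_apply, Matrix.one_mul, Matrix.transpose_one,
    Matrix.mul_one, ← sub_eq_add_neg] using hasLaw_matrixCLM_add hC hX 1 (-c)

lemma hasLaw_add (hC : C.PosSemidef) (hC' : C'.PosSemidef)
    (hX : HasLaw X (multivariateGaussian m C) P) (hY : HasLaw Y (multivariateGaussian m' C') P)
    (hXY : IndepFun X Y P) :
    HasLaw (fun ω ↦ X ω + Y ω) (multivariateGaussian (m + m') (C + C')) P := by
  have hP := hX.isProbabilityMeasure
  have h_meas := hX.aemeasurable.add hY.aemeasurable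
  have := Measure.isProbabilityMeasure_map h_meas
  refine ⟨h_meas, Measure.ext_of_charFun (funext fun t ↦ ?_)⟩
  rw [hXY.charFun_map_fun_add_eq_mul hX.aemeasurable hY.aemeasurable, hX.map_eq, hY.map_eq,
    Pi.mul_apply, charFun_multivariateGaussian_eq hC, charFun_multivariateGaussian_eq hC',
    charFun_multivariateGaussian_eq (hC.add hC'), ← Complex.exp_add, inner_add_left]
  simp only [quadForm, Matrix.add_mulVec, dotProduct_add]
  push_cast
  ring_nf

lemma hasLaw_inner (hC : C.PosSemidef) (hX : HasLaw X (multivariateGaussian m C) P)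
    (v : EuclideanSpace ℝ ι) :
    HasLaw (fun ω ↦ ⟪v, X ω⟫) (gaussianReal ⟪v, m⟫ (quadForm C v).toNNReal) P := by
  have h_meas : Measurable fun x : EuclideanSpace ℝ ι ↦ ⟪v, x⟫ := by fun_prop
  refine HasLaw.comp (Y := fun x ↦ ⟪v, x⟫) ⟨h_meas.aemeasurable, ?_⟩ hX
  have := Measure.isProbabilityMeasure_map (μ := multivariateGaussian m C) h_meas.aemeasurable
  refine Measure.ext_of_charFun (funext fun t ↦ ?_)
  have h_eq : charFun ((multivariateGaussian m C).map fun x ↦ ⟪v, x⟫) t =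
      charFun (multivariateGaussian m C) (t • v) := by
    rw [charFun_apply_real, charFun_apply, integral_map h_meas.aemeasurable (by fun_prop)]
    simp only [inner_smul_right, real_inner_comm v, Complex.ofReal_mul]
  rw [h_eq, charFun_multivariateGaussian_eq hC, charFun_gaussianReal, inner_smul_right,
    real_inner_comm, Real.coe_toNNReal _ (quadForm_nonneg hC v)]
  simp only [quadForm, WithLp.ofLp_smul, Matrix.mulVec_smul, smul_dotProduct, dotProduct_smul,
    smul_eq_mul]
  push_cast
  ring_nf

lemma memLp_apply (hX : HasLaw X (multivariateGaussian m C) P) (i : ι) {q : ℝ≥0∞} (hq : q ≠ ∞) :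
    MemLp (fun ω ↦ X ω i) q P :=
  (hX.hasGaussianLaw.memLp hq).eval_piLp i

lemma integrable_apply_mul_apply (hX : HasLaw X (multivariateGaussian m C) P) (i j : ι) :
    Integrable (fun ω ↦ X ω i * X ω j) P :=
  (memLp_apply hX i (q := 2) (by simp)).integrable_mul (memLp_apply hX j (q := 2) (by simp))

lemma integral_apply (hX : HasLaw X (multivariateGaussian m C) P) (i : ι) :
    ∫ ω, X ω i ∂P = m i := by
  have := hX.hasGaussianLaw.isProbabilityMeasure
  rw [← eval_integral_piLp fun j ↦ (memLp_apply hX j (q := 1) (by simp)).integrable le_rfl,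
    hX.integral_eq, integral_id_multivariateGaussian]

lemma integral_apply_mul_apply (hC : C.PosSemidef) (hX : HasLaw X (multivariateGaussian m C) P)
    (i j : ι) : ∫ ω, X ω i * X ω j ∂P = C i j + m i * m j := by
  have := hX.hasGaussianLaw.isProbabilityMeasure
  have h_cov : cov[fun ω ↦ X ω i, fun ω ↦ X ω j; P] = C i j := by
    rw [← covariance_eval_multivariateGaussian (μ := m) hC, ← hX.map_eq,
      covariance_map_fun (by fun_prop) (by fun_prop) hX.aemeasurable]
  have h_sub := covariance_eq_sub (memLp_apply hX i (q := 2) (by simp))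
    (memLp_apply hX j (q := 2) (by simp))
  rw [h_cov, integral_apply hX, integral_apply hX] at h_sub
  simp only [Pi.mul_apply] at h_sub
  linarith

lemma integrable_quadForm (hX : HasLaw X (multivariateGaussian m C) P) (Q : Matrix ι ι ℝ) :
    Integrable (fun ω ↦ quadForm Q (X ω)) P := by
  simp only [quadForm_eq_sum]
  exact integrable_finsetSum _ fun i _ ↦ integrable_finsetSum _ fun j _ ↦
    (integrable_apply_mul_apply hX i j).const_mul (Q i j)

lemma integral_quadForm (hC : C.PosSemidef) (hX : HasLaw X (multivariateGaussian m C) P)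
    (Q : Matrix ι ι ℝ) :
    ∫ ω, quadForm Q (X ω) ∂P = (Q * C).trace + quadForm Q m := by
  have h_int (i j) : Integrable (fun ω ↦ Q i j * (X ω i * X ω j)) P :=
    (integrable_apply_mul_apply hX i j).const_mul (Q i j)
  have h_symm (i j) : C i j = C j i := hC.1.apply i j ▸ (star_trivial _).symm
  simp only [quadForm_eq_sum, Matrix.trace, Matrix.diag, Matrix.mul_apply]
  rw [integral_finsetSum _ fun i _ ↦ integrable_finsetSum _ fun j _ ↦ h_int i j,
    ← Finset.sum_add_distrib]
  refine Finset.sum_congr rfl fun i _ ↦ ?_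
  rw [integral_finsetSum _ fun j _ ↦ h_int i j, ← Finset.sum_add_distrib]
  refine Finset.sum_congr rfl fun j _ ↦ ?_
  rw [integral_const_mul, integral_apply_mul_apply hC hX, h_symm]
  ring

end GaussianVector

section CrossEntropy

lemma llr_withDensity_ofReal {α : Type*} [MeasurableSpace α] {μ : Measure α} [SigmaFinite μ]
    {f g : α → ℝ} (hf : Measurable f) (hg : Measurable g) (hf_pos : ∀ x, 0 < f x)
    (hg_pos : ∀ x, 0 < g x) :
    llr (μ.withDensity fun x ↦ ENNReal.ofReal (f x)) (μ.withDensity fun x ↦ ENNReal.ofReal (g x))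
      =ᵐ[μ] fun x ↦ Real.log (f x) - Real.log (g x) := by
  have := SigmaFinite.withDensity_ofReal (μ := μ) f
  filter_upwards [Measure.rnDeriv_withDensity_right (μ.withDensity fun x ↦ ENNReal.ofReal (f x)) μ
    hg.ennreal_ofReal.aemeasurable (.of_forall fun x ↦ (ENNReal.ofReal_pos.2 (hg_pos x)).ne')
    (.of_forall fun x ↦ ENNReal.ofReal_ne_top),
    Measure.rnDeriv_withDensity μ hf.ennreal_ofReal] with x hx_right hx_left
  rw [llr, hx_right, hx_left, ENNReal.toReal_mul, ENNReal.toReal_inv,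
    ENNReal.toReal_ofReal (hf_pos x).le, ENNReal.toReal_ofReal (hg_pos x).le,
    Real.log_mul (inv_ne_zero (hg_pos x).ne') (hf_pos x).ne', Real.log_inv]
  ring

variable {n : ℕ} {m m' v : EuclideanSpace ℝ (Fin n)} {S S' C : Matrix (Fin n) (Fin n) ℝ}

lemma gaussianDensity_pos (m : EuclideanSpace ℝ (Fin n)) (hS : S.PosDef)
    (x : EuclideanSpace ℝ (Fin n)) : 0 < gaussianDensity m S x := by
  have := hS.det_pos
  unfold gaussianDensity
  positivity

lemma measurable_gaussianDensity (m : EuclideanSpace ℝ (Fin n)) (S : Matrix (Fin n) (Fin n) ℝ) :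
    Measurable (gaussianDensity m S) := by
  have : Measurable (quadInv S) := (continuous_quadForm S⁻¹).measurable
  unfold gaussianDensity
  fun_prop

lemma log_gaussianDensity (m : EuclideanSpace ℝ (Fin n)) (hS : S.PosDef)
    (x : EuclideanSpace ℝ (Fin n)) :
    Real.log (gaussianDensity m S x) = -(1 / 2) *
      (n * Real.log (2 * Real.pi) + Real.log S.det + quadForm S⁻¹ (x - m)) := by
  have h_det := hS.det_pos
  rw [gaussianDensity, Real.log_mul (by positivity) (Real.exp_pos _).ne', Real.log_exp,
    Real.log_inv, Real.log_sqrt (by positivity), Real.log_mul (by positivity) h_det.ne',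
    Real.log_pow, quadInv, quadForm]
  ring

lemma multivariateGaussian_eq_withDensity_gaussianDensity (m : EuclideanSpace ℝ (Fin n))
    (hS : S.PosDef) : multivariateGaussian m S =
      volume.withDensity fun x ↦ ENNReal.ofReal (gaussianDensity m S x) := by
  rw [multivariateGaussian_eq_withDensity m hS, Fintype.card_fin]
  rfl

/-- The cross entropy `-∫ log q dμ` of `μ = N(m + v, C)` relative to the Lebesgue density `q` of
`N(m, S)`; it does not depend on `m`. -/
noncomputable def gaussianCrossEntropy (C S : Matrix (Fin n) (Fin n) ℝ)
    (v : EuclideanSpace ℝ (Fin n)) : ℝ :=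
  (1 / 2) * (n * Real.log (2 * Real.pi) + Real.log S.det + ((S⁻¹ * C).trace + quadForm S⁻¹ v))

/-- The differential entropy of the Gaussian law with covariance `S`. -/
noncomputable def gaussianEntropy (S : Matrix (Fin n) (Fin n) ℝ) : ℝ :=
  gaussianCrossEntropy S S 0

section Integral

variable {Ω : Type*} [MeasurableSpace Ω] {P : Measure Ω} {X c : Ω → EuclideanSpace ℝ (Fin n)}

lemma integrable_log_gaussianDensity (hS : S.PosDef)
    (hX : HasLaw (fun ω ↦ X ω - c ω) (multivariateGaussian v C) P) :
    Integrable (fun ω ↦ Real.log (gaussianDensity (c ω) S (X ω))) P := by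
  have := hX.hasGaussianLaw.isProbabilityMeasure
  simp only [log_gaussianDensity _ hS]
  exact ((integrable_const _).add (integrable_quadForm hX S⁻¹)).const_mul _

lemma integral_log_gaussianDensity (hS : S.PosDef) (hC : C.PosSemidef)
    (hX : HasLaw (fun ω ↦ X ω - c ω) (multivariateGaussian v C) P) :
    ∫ ω, Real.log (gaussianDensity (c ω) S (X ω)) ∂P = -gaussianCrossEntropy C S v := by
  have := hX.hasGaussianLaw.isProbabilityMeasure
  simp only [log_gaussianDensity _ hS]
  rw [integral_const_mul, integral_add (integrable_const _) (integrable_quadForm hX S⁻¹),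
    integral_quadForm hC hX, integral_const, probReal_univ, one_smul, gaussianCrossEntropy]
  ring

end Integral

/-- The Kullback-Leibler divergence from `N(m, S)` of the Gaussian `N(m + v, C)`, in closed form;
it does not depend on `m`. -/
noncomputable def gaussianKL (C S : Matrix (Fin n) (Fin n) ℝ) (v : EuclideanSpace ℝ (Fin n)) : ℝ :=
  gaussianCrossEntropy C S v - gaussianEntropy C

lemma absolutelyContinuous_multivariateGaussian (hS : S.PosDef) (hS' : S'.PosDef) :
    multivariateGaussian m S ≪ multivariateGaussian m' S' := by
  rw [multivariateGaussian_eq_withDensity_gaussianDensity m hS,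
    multivariateGaussian_eq_withDensity_gaussianDensity m' hS']
  exact (withDensity_absolutelyContinuous _ _).trans (withDensity_absolutelyContinuous'
    (measurable_gaussianDensity m' S').ennreal_ofReal.aemeasurable
    (.of_forall fun x ↦ (ENNReal.ofReal_pos.2 (gaussianDensity_pos m' hS' x)).ne'))

lemma llr_multivariateGaussian (hS : S.PosDef) (hS' : S'.PosDef) :
    llr (multivariateGaussian m S) (multivariateGaussian m' S') =ᵐ[multivariateGaussian m S]
      fun x ↦ Real.log (gaussianDensity m S x) - Real.log (gaussianDensity m' S' x) := by
  rw [multivariateGaussian_eq_withDensity_gaussianDensity m hS,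
    multivariateGaussian_eq_withDensity_gaussianDensity m' hS']
  exact (withDensity_absolutelyContinuous _ _).ae_le (llr_withDensity_ofReal
    (measurable_gaussianDensity m S) (measurable_gaussianDensity m' S')
    (gaussianDensity_pos m hS) (gaussianDensity_pos m' hS'))

lemma integrable_llr_multivariateGaussian (hS : S.PosDef) (hS' : S'.PosDef) :
    Integrable (llr (multivariateGaussian m S) (multivariateGaussian m' S'))
      (multivariateGaussian m S) :=
  ((integrable_log_gaussianDensity hS (hasLaw_sub_const hS.posSemidef HasLaw.id m)).sub
    (integrable_log_gaussianDensity hS' (hasLaw_sub_const hS.posSemidef HasLaw.id m'))).congr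
    (llr_multivariateGaussian hS hS').symm

lemma toReal_klDiv_multivariateGaussian (hS : S.PosDef) (hS' : S'.PosDef) :
    (klDiv (multivariateGaussian m S) (multivariateGaussian m' S')).toReal =
      gaussianKL S S' (m - m') := by
  have h_law (c) :
      HasLaw (fun x ↦ x - c) (multivariateGaussian (m - c) S) (multivariateGaussian m S) :=
    hasLaw_sub_const hS.posSemidef HasLaw.id c
  rw [toReal_klDiv_of_measure_eq (absolutelyContinuous_multivariateGaussian hS hS')
      (by simp only [measure_univ]),
    integral_congr_ae (llr_multivariateGaussian hS hS'),
    integral_sub (integrable_log_gaussianDensity hS (h_law m))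
      (integrable_log_gaussianDensity hS' (h_law m')),
    integral_log_gaussianDensity hS hS.posSemidef (h_law m),
    integral_log_gaussianDensity hS' hS.posSemidef (h_law m'), sub_self, gaussianKL,
    gaussianEntropy]
  ring

lemma klDiv_multivariateGaussian (hS : S.PosDef) (hS' : S'.PosDef) :
    klDiv (multivariateGaussian m S) (multivariateGaussian m' S') =
      ENNReal.ofReal (gaussianKL S S' (m - m')) := by
  rw [← toReal_klDiv_multivariateGaussian hS hS', ENNReal.ofReal_toReal]
  exact klDiv_ne_top (absolutelyContinuous_multivariateGaussian hS hS')
    (integrable_llr_multivariateGaussian hS hS')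

lemma gaussianKL_nonneg (hC : C.PosDef) (hS : S.PosDef) (v : EuclideanSpace ℝ (Fin n)) :
    0 ≤ gaussianKL C S v := by
  rw [← sub_zero v, ← toReal_klDiv_multivariateGaussian hC hS]
  exact ENNReal.toReal_nonneg

lemma gaussianKL_eq (hC : C.PosDef) (v : EuclideanSpace ℝ (Fin n)) :
    gaussianKL C S v = (1 / 2) * ((S⁻¹ * C).trace - n + (Real.log S.det - Real.log C.det) +
      quadForm S⁻¹ v) := by
  rw [gaussianKL, gaussianEntropy, gaussianCrossEntropy, gaussianCrossEntropy,
    Matrix.nonsing_inv_mul _ hC.det_pos.ne'.isUnit, Matrix.trace_one, Fintype.card_fin]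
  simp only [quadForm, WithLp.ofLp_zero, zero_dotProduct]
  ring

/-- Adding the reverse divergence cancels the log-determinants. -/
lemma gaussianKL_le (hC : C.PosDef) (hS : S.PosDef) (v : EuclideanSpace ℝ (Fin n)) :
    gaussianKL C S v ≤
      (1 / 2) * ((S⁻¹ * (S - C) * (C⁻¹ * (S - C))).trace + quadForm S⁻¹ v) := by
  have h_reverse := gaussianKL_nonneg hS hC 0
  have hC_unit := hC.det_pos.ne'.isUnit
  have hS_unit := hS.det_pos.ne'.isUnit
  have h_mul : S⁻¹ * (S - C) * (C⁻¹ * (S - C)) = C⁻¹ * S - 1 - 1 + S⁻¹ * C := by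
    rw [Matrix.mul_sub, Matrix.mul_sub, Matrix.nonsing_inv_mul _ hC_unit,
      Matrix.nonsing_inv_mul _ hS_unit, Matrix.mul_sub, Matrix.sub_mul, Matrix.mul_one,
      Matrix.one_mul, ← Matrix.mul_assoc, Matrix.mul_assoc S⁻¹ C, Matrix.mul_nonsing_inv _ hC_unit,
      Matrix.mul_one, Matrix.nonsing_inv_mul _ hS_unit]
    abel
  rw [gaussianKL_eq hS] at h_reverse
  rw [gaussianKL_eq hC, h_mul, Matrix.trace_add, Matrix.trace_sub, Matrix.trace_sub,
    Matrix.trace_one, Fintype.card_fin]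
  simp only [quadForm, WithLp.ofLp_zero, zero_dotProduct] at h_reverse ⊢
  linarith

end CrossEntropy

section LinearGaussianAlgebra

variable {ι κ : Type*}

lemma transpose_eq_of_posDef {S : Matrix ι ι ℝ} (hS : S.PosDef) : Sᵀ = S := by
  rw [← Matrix.conjTranspose_eq_transpose_of_trivial, hS.1.eq]

lemma posDef_fromBlocks₂₂ {B : Matrix ι ι ℝ} {C : Matrix ι κ ℝ} {D : Matrix κ κ ℝ}
    (h : (Matrix.fromBlocks B C Cᵀ D).PosDef) : D.PosDef :=
  h.submatrix Sum.inr_injective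

variable [Fintype ι]

lemma quadForm_add_left (S T : Matrix ι ι ℝ) (v : EuclideanSpace ℝ ι) :
    quadForm (S + T) v = quadForm S v + quadForm T v := by
  rw [quadForm, quadForm, quadForm, Matrix.add_mulVec, dotProduct_add]

lemma quadForm_sub {S : Matrix ι ι ℝ} (hS : S.PosDef) (v w : EuclideanSpace ℝ ι) :
    quadForm S (v - w) = quadForm S v - 2 * (v.ofLp ⬝ᵥ S *ᵥ w.ofLp) + quadForm S w := by
  have h_symm : w.ofLp ⬝ᵥ S *ᵥ v.ofLp = v.ofLp ⬝ᵥ S *ᵥ w.ofLp := by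
    rw [Matrix.dotProduct_mulVec, ← Matrix.mulVec_transpose, transpose_eq_of_posDef hS,
      dotProduct_comm]
  simp only [quadForm, WithLp.ofLp_sub, Matrix.mulVec_sub, sub_dotProduct, dotProduct_sub, h_symm]
  ring

variable (S₀ : Matrix ι ι ℝ) (Γ : Matrix κ κ ℝ) (A : Matrix κ ι ℝ)

/-- The covariance of the data `y = A u + η` for parameter covariance `S₀` and noise
covariance `Γ`. -/
def dataCov : Matrix κ κ ℝ :=
  A * S₀ * Aᵀ + Γ

/-- The covariance of the pair `(u, y)` for `y = A u + η`. -/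
def jointCov : Matrix (ι ⊕ κ) (ι ⊕ κ) ℝ :=
  Matrix.fromBlocks S₀ (S₀ * Aᵀ) (S₀ * Aᵀ)ᵀ (dataCov S₀ Γ A)

variable {S₀ Γ}

lemma transpose_mul_transpose_of_posDef (hS₀ : S₀.PosDef) : (S₀ * Aᵀ)ᵀ = A * S₀ := by
  rw [Matrix.transpose_mul, Matrix.transpose_transpose, transpose_eq_of_posDef hS₀]

lemma fromRows_mul_mul_transpose_add [Fintype κ] [DecidableEq ι] [DecidableEq κ]
    (hS₀ : S₀.PosDef) :
    (Matrix.fromRows (1 : Matrix ι ι ℝ) (0 : Matrix κ ι ℝ) +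
        Matrix.fromRows (0 : Matrix ι κ ℝ) (1 : Matrix κ κ ℝ) * A) * S₀ *
      (Matrix.fromRows (1 : Matrix ι ι ℝ) (0 : Matrix κ ι ℝ) +
        Matrix.fromRows (0 : Matrix ι κ ℝ) (1 : Matrix κ κ ℝ) * A)ᵀ +
      Matrix.fromRows (0 : Matrix ι κ ℝ) (1 : Matrix κ κ ℝ) * Γ *
        (Matrix.fromRows (0 : Matrix ι κ ℝ) (1 : Matrix κ κ ℝ))ᵀ = jointCov S₀ Γ A := by
  have h_rows : Matrix.fromRows (1 : Matrix ι ι ℝ) (0 : Matrix κ ι ℝ) +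
      Matrix.fromRows (0 : Matrix ι κ ℝ) (1 : Matrix κ κ ℝ) * A = Matrix.fromRows 1 A := by
    rw [Matrix.fromRows_mul, Matrix.zero_mul, Matrix.one_mul]
    ext (i | i) j <;> simp
  rw [h_rows, jointCov, dataCov, transpose_mul_transpose_of_posDef A hS₀]
  simp only [Matrix.fromRows_mul, Matrix.transpose_fromRows, Matrix.mul_fromCols,
    Matrix.one_mul, Matrix.zero_mul, Matrix.transpose_one, Matrix.transpose_zero, Matrix.mul_one,
    Matrix.mul_zero]
  ext (i | i) (j | j) <;> simp

lemma schurComplement_jointCov [DecidableEq ι] (hS₀ : S₀.PosDef) :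
    dataCov S₀ Γ A - (S₀ * Aᵀ)ᵀ * S₀⁻¹ * (S₀ * Aᵀ) = Γ := by
  rw [transpose_mul_transpose_of_posDef A hS₀, dataCov,
    Matrix.mul_nonsing_inv_cancel_right _ _ hS₀.det_pos.ne'.isUnit, ← Matrix.mul_assoc,
    add_sub_cancel_left]

lemma posDef_dataCov [Finite κ] (hS₀ : S₀.PosDef) (hΓ : Γ.PosDef) : (dataCov S₀ Γ A).PosDef :=
  have := Fintype.ofFinite κ
  Matrix.PosDef.posSemidef_add (hS₀.posSemidef.mul_mul_conjTranspose_same A) hΓ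

variable [Fintype κ]

variable [DecidableEq κ]

/-- The conditional covariance of the first block given the second one, for the Gaussian law with
covariance blocks `B`, `C`, `Cᵀ`, `D`. -/
noncomputable def condCov (B : Matrix ι ι ℝ) (C : Matrix ι κ ℝ) (D : Matrix κ κ ℝ) :
    Matrix ι ι ℝ :=
  B - C * D⁻¹ * Cᵀ

variable (S₀ Γ) in
/-- The Kalman gain, the matrix of the regression of `u` on `y = A u + η`. -/
noncomputable def gain : Matrix ι κ ℝ :=
  S₀ * Aᵀ * (dataCov S₀ Γ A)⁻¹

variable (S₀ Γ) in
/-- The posterior covariance of `u` given `y = A u + η`. -/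
noncomputable def postCov : Matrix ι ι ℝ :=
  condCov S₀ (S₀ * Aᵀ) (dataCov S₀ Γ A)

lemma gain_mul_dataCov (hS₀ : S₀.PosDef) (hΓ : Γ.PosDef) :
    gain S₀ Γ A * dataCov S₀ Γ A = S₀ * Aᵀ := by
  rw [gain, Matrix.mul_assoc, Matrix.nonsing_inv_mul _ (posDef_dataCov A hS₀ hΓ).det_pos.ne'.isUnit,
    Matrix.mul_one]

lemma postCov_eq_sub_gain (hS₀ : S₀.PosDef) :
    postCov S₀ Γ A = S₀ - gain S₀ Γ A * (A * S₀) := by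
  rw [postCov, condCov, gain, transpose_mul_transpose_of_posDef A hS₀]

variable [DecidableEq ι]

lemma det_fromBlocks_eq_mul_det_condCov {B : Matrix ι ι ℝ} {C : Matrix ι κ ℝ} {D : Matrix κ κ ℝ}
    (hD : D.PosDef) : (Matrix.fromBlocks B C Cᵀ D).det = D.det * (condCov B C D).det := by
  let := hD.isUnit.invertible
  rw [Matrix.det_fromBlocks₂₂, Matrix.invOf_eq_nonsing_inv, condCov]

omit [Fintype ι] [DecidableEq ι] in
lemma posDef_condCov [Finite ι] {B : Matrix ι ι ℝ} {C : Matrix ι κ ℝ} {D : Matrix κ κ ℝ}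
    (h : (Matrix.fromBlocks B C Cᵀ D).PosDef) : (condCov B C D).PosDef := by
  classical
  have := Fintype.ofFinite ι
  have hD := posDef_fromBlocks₂₂ h
  let := hD.isUnit.invertible
  have h_semidef : (condCov B C D).PosSemidef := by
    have h_schur := h.posSemidef
    rwa [← Matrix.conjTranspose_eq_transpose_of_trivial C, Matrix.PosDef.fromBlocks₂₂ _ _ hD,
      Matrix.conjTranspose_eq_transpose_of_trivial, ← condCov] at h_schur
  rw [h_semidef.posDef_iff_det_ne_zero]
  have h_det := h.det_pos.ne'
  rw [det_fromBlocks_eq_mul_det_condCov hD] at h_det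
  exact right_ne_zero_of_mul h_det

lemma det_jointCov (hS₀ : S₀.PosDef) : (jointCov S₀ Γ A).det = S₀.det * Γ.det := by
  let := hS₀.isUnit.invertible
  rw [jointCov, Matrix.det_fromBlocks₁₁, Matrix.invOf_eq_nonsing_inv,
    schurComplement_jointCov A hS₀]

omit [Fintype κ] [DecidableEq ι] [DecidableEq κ] in
lemma posDef_jointCov [Finite κ] (hS₀ : S₀.PosDef) (hΓ : Γ.PosDef) :
    (jointCov S₀ Γ A).PosDef := by
  classical
  have := Fintype.ofFinite κ
  let := hS₀.isUnit.invertible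
  have h_semidef : (jointCov S₀ Γ A).PosSemidef := by
    rw [jointCov, ← Matrix.conjTranspose_eq_transpose_of_trivial (S₀ * Aᵀ),
      Matrix.PosDef.fromBlocks₁₁ _ _ hS₀, Matrix.conjTranspose_eq_transpose_of_trivial,
      schurComplement_jointCov A hS₀]
    exact hΓ.posSemidef
  rw [h_semidef.posDef_iff_det_ne_zero, det_jointCov A hS₀]
  exact mul_ne_zero hS₀.det_pos.ne' hΓ.det_pos.ne'

omit [DecidableEq ι] in
lemma posDef_postCov (hS₀ : S₀.PosDef) (hΓ : Γ.PosDef) : (postCov S₀ Γ A).PosDef :=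
  posDef_condCov (posDef_jointCov A hS₀ hΓ)

/-- Both sides are the determinant of the joint covariance. -/
lemma det_dataCov_mul_det_postCov (hS₀ : S₀.PosDef) (hΓ : Γ.PosDef) :
    (dataCov S₀ Γ A).det * (postCov S₀ Γ A).det = S₀.det * Γ.det := by
  rw [postCov, ← det_fromBlocks_eq_mul_det_condCov (posDef_dataCov A hS₀ hΓ),
    ← det_jointCov A hS₀, jointCov]

lemma inv_postCov (hS₀ : S₀.PosDef) (hΓ : Γ.PosDef) :
    (postCov S₀ Γ A)⁻¹ = S₀⁻¹ + Aᵀ * Γ⁻¹ * A := by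
  have hS₀_inv := Matrix.nonsing_inv_nonsing_inv _ hS₀.det_pos.ne'.isUnit
  have hΓ_inv := Matrix.nonsing_inv_nonsing_inv _ hΓ.det_pos.ne'.isUnit
  have h_dataCov : Γ⁻¹⁻¹ + A * S₀⁻¹⁻¹ * Aᵀ = dataCov S₀ Γ A := by
    rw [hΓ_inv, hS₀_inv, dataCov, add_comm]
  have h_precision : (S₀⁻¹ + Aᵀ * Γ⁻¹ * A).PosDef :=
    hS₀.inv.add_posSemidef (hΓ.inv.posSemidef.conjTranspose_mul_mul_same A)
  have h_woodbury := Matrix.add_mul_mul_inv_eq_sub S₀⁻¹ Aᵀ Γ⁻¹ A hS₀.inv.isUnit hΓ.inv.isUnit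
    (h_dataCov ▸ (posDef_dataCov A hS₀ hΓ).isUnit)
  rw [h_dataCov, hS₀_inv, Matrix.mul_assoc _ A, ← gain, ← postCov_eq_sub_gain A hS₀] at h_woodbury
  rw [← h_woodbury, Matrix.nonsing_inv_nonsing_inv _ h_precision.det_pos.ne'.isUnit]

lemma inv_postCov_mul_gain (hS₀ : S₀.PosDef) (hΓ : Γ.PosDef) :
    (postCov S₀ Γ A)⁻¹ * gain S₀ Γ A = Aᵀ * Γ⁻¹ := by
  have h_mul : (postCov S₀ Γ A)⁻¹ * (S₀ * Aᵀ) = Aᵀ * Γ⁻¹ * dataCov S₀ Γ A := by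
    rw [inv_postCov A hS₀ hΓ, dataCov, Matrix.mul_add, Matrix.add_mul, ← Matrix.mul_assoc S₀⁻¹,
      Matrix.nonsing_inv_mul _ hS₀.det_pos.ne'.isUnit, Matrix.one_mul, Matrix.mul_assoc Aᵀ Γ⁻¹ Γ,
      Matrix.nonsing_inv_mul _ hΓ.det_pos.ne'.isUnit, Matrix.mul_one, add_comm]
    simp only [Matrix.mul_assoc]
  rw [gain, ← Matrix.mul_assoc, h_mul, Matrix.mul_assoc,
    Matrix.mul_nonsing_inv _ (posDef_dataCov A hS₀ hΓ).det_pos.ne'.isUnit, Matrix.mul_one]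

lemma quadForm_inv_postCov_sub (hS₀ : S₀.PosDef) (hΓ : Γ.PosDef) (x : EuclideanSpace ℝ ι)
    (r : EuclideanSpace ℝ κ) :
    quadForm (postCov S₀ Γ A)⁻¹ (x - matrixCLM (gain S₀ Γ A) r) =
      quadForm S₀⁻¹ x + quadForm Γ⁻¹ (r - matrixCLM A x) +
        (quadForm (postCov S₀ Γ A)⁻¹ (matrixCLM (gain S₀ Γ A) r) - quadForm Γ⁻¹ r) := by
  have h_cross : x.ofLp ⬝ᵥ (Aᵀ * Γ⁻¹) *ᵥ r.ofLp = r.ofLp ⬝ᵥ Γ⁻¹ *ᵥ (A *ᵥ x.ofLp) := by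
    rw [← Matrix.mulVec_mulVec, Matrix.dotProduct_mulVec, Matrix.vecMul_transpose,
      Matrix.dotProduct_mulVec, dotProduct_comm, ← Matrix.mulVec_transpose,
      transpose_eq_of_posDef hΓ.inv]
  rw [quadForm_sub (posDef_postCov A hS₀ hΓ).inv, quadForm_sub hΓ.inv, quadForm_matrixCLM A,
    ofLp_matrixCLM, ofLp_matrixCLM, Matrix.mulVec_mulVec, inv_postCov_mul_gain A hS₀ hΓ, h_cross,
    inv_postCov A hS₀ hΓ, quadForm_add_left _ _ x]
  ring

/-- The error covariance of the linear estimator of `u` with an arbitrary gain `L`, in the Joseph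
form; the Kalman gain minimizes it. -/
lemma joseph_form_eq_postCov_add (hS₀ : S₀.PosDef) (hΓ : Γ.PosDef) (L : Matrix ι κ ℝ) :
    (1 - L * A) * S₀ * (1 - L * A)ᵀ + L * Γ * Lᵀ =
      postCov S₀ Γ A + (gain S₀ Γ A - L) * dataCov S₀ Γ A * (gain S₀ Γ A - L)ᵀ := by
  have h_gain := gain_mul_dataCov A hS₀ hΓ
  have h_gain_transpose : dataCov S₀ Γ A * (gain S₀ Γ A)ᵀ = A * S₀ := by
    rw [← transpose_eq_of_posDef (posDef_dataCov A hS₀ hΓ), ← Matrix.transpose_mul, h_gain,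
      transpose_mul_transpose_of_posDef A hS₀]
  have h_expand : (gain S₀ Γ A - L) * dataCov S₀ Γ A * (gain S₀ Γ A - L)ᵀ =
      gain S₀ Γ A * (A * S₀) - L * (A * S₀) - (S₀ * Aᵀ * Lᵀ - L * dataCov S₀ Γ A * Lᵀ) := by
    rw [Matrix.transpose_sub, Matrix.mul_sub, Matrix.sub_mul, Matrix.sub_mul, h_gain,
      Matrix.sub_mul, ← h_gain, Matrix.mul_assoc, Matrix.mul_assoc L, h_gain_transpose]
  rw [h_expand, postCov_eq_sub_gain A hS₀, dataCov]
  simp only [Matrix.transpose_sub, Matrix.transpose_one, Matrix.transpose_mul, Matrix.sub_mul,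
    Matrix.mul_sub, Matrix.one_mul, Matrix.mul_one, Matrix.mul_add, Matrix.add_mul,
    Matrix.mul_assoc]
  abel

omit [DecidableEq ι] in
lemma postCov_add_gain_mul_dataCov (hS₀ : S₀.PosDef) (hΓ : Γ.PosDef) :
    postCov S₀ Γ A + gain S₀ Γ A * dataCov S₀ Γ A * (gain S₀ Γ A)ᵀ = S₀ := by
  classical
  simpa only [Matrix.zero_mul, sub_zero, Matrix.one_mul, Matrix.transpose_one, Matrix.mul_one,
    add_zero] using (joseph_form_eq_postCov_add A hS₀ hΓ 0).symm

end LinearGaussianAlgebra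

section Model

variable {d k : ℕ} {m₀ : EuclideanSpace ℝ (Fin d)} {S₀ : Matrix (Fin d) (Fin d) ℝ}
  {Γ : Matrix (Fin k) (Fin k) ℝ} (A : Matrix (Fin k) (Fin d) ℝ)

lemma hasLaw_jointLaw {ι : Type*} [Fintype ι] [DecidableEq ι] (hS₀ : S₀.PosSemidef)
    (hΓ : Γ.PosSemidef) (B : Matrix ι (Fin d) ℝ) (L : Matrix ι (Fin k) ℝ)
    (c : EuclideanSpace ℝ ι) :
    HasLaw (fun z ↦ matrixCLM B z.1 + matrixCLM L z.2 + c)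
      (multivariateGaussian (matrixCLM B m₀ + matrixCLM L (matrixCLM A m₀) + c)
        ((B + L * A) * S₀ * (B + L * A)ᵀ + L * Γ * Lᵀ))
      (jointLaw m₀ S₀ Γ (matrixCLM A)) := by
  have h_fst : HasLaw Prod.fst (multivariateGaussian m₀ S₀)
      ((multivariateGaussian m₀ S₀).prod (multivariateGaussian (0 : EuclideanSpace ℝ (Fin k)) Γ)) :=
    measurePreserving_fst.hasLaw
  have h_snd : HasLaw Prod.snd (multivariateGaussian (0 : EuclideanSpace ℝ (Fin k)) Γ)
      ((multivariateGaussian m₀ S₀).prod (multivariateGaussian (0 : EuclideanSpace ℝ (Fin k)) Γ)) :=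
    measurePreserving_snd.hasLaw
  have h_sum := hasLaw_add (hS₀.mul_mul_conjTranspose_same (B + L * A))
    (hΓ.mul_mul_conjTranspose_same L) (hasLaw_matrixCLM_add hS₀ h_fst (B + L * A) c)
    (hasLaw_matrixCLM_add hΓ h_snd L 0)
    (indepFun_prod (X := fun x ↦ matrixCLM (B + L * A) x + c) (Y := fun x ↦ matrixCLM L x + 0)
      (by fun_prop) (by fun_prop))
  have h_split (x : EuclideanSpace ℝ (Fin d)) :
      matrixCLM (B + L * A) x = matrixCLM B x + matrixCLM L (matrixCLM A x) := by
    rw [matrixCLM_add, add_apply, matrixCLM_mul]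
  have h_fun : (fun z ↦ matrixCLM B z.1 + matrixCLM L z.2 + c) ∘
      (fun z : EuclideanSpace ℝ (Fin d) × EuclideanSpace ℝ (Fin k) ↦
        (z.1, matrixCLM A z.1 + z.2)) =
        fun z ↦ matrixCLM (B + L * A) z.1 + c + (matrixCLM L z.2 + 0) := by
    ext1 z
    simp only [Function.comp_apply, h_split, map_add]
    abel
  refine ⟨by fun_prop, ?_⟩
  rw [jointLaw, Measure.map_map (by fun_prop) (by fun_prop), h_fun, h_sum.map_eq, h_split,
    map_zero, add_zero, add_zero, Matrix.conjTranspose_eq_transpose_of_trivial,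
    Matrix.conjTranspose_eq_transpose_of_trivial]

lemma hasLaw_snd_jointLaw (hS₀ : S₀.PosSemidef) (hΓ : Γ.PosSemidef) :
    HasLaw Prod.snd (multivariateGaussian (matrixCLM A m₀) (dataCov S₀ Γ A))
      (jointLaw m₀ S₀ Γ (matrixCLM A)) := by
  simpa only [matrixCLM_zero, matrixCLM_one, zero_apply,
    ContinuousLinearMap.id_apply, zero_add, add_zero, Matrix.one_mul, Matrix.transpose_one,
    Matrix.mul_one, dataCov] using
    hasLaw_jointLaw (m₀ := m₀) A hS₀ hΓ (0 : Matrix (Fin k) (Fin d) ℝ) 1 0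

lemma hasLaw_fst_jointLaw (hS₀ : S₀.PosSemidef) (hΓ : Γ.PosSemidef) :
    HasLaw Prod.fst (multivariateGaussian m₀ S₀) (jointLaw m₀ S₀ Γ (matrixCLM A)) := by
  simpa only [matrixCLM_zero, matrixCLM_one, zero_apply,
    ContinuousLinearMap.id_apply, Matrix.zero_mul, add_zero, Matrix.one_mul, Matrix.transpose_one,
    Matrix.mul_one] using
    hasLaw_jointLaw (m₀ := m₀) A hS₀ hΓ (1 : Matrix (Fin d) (Fin d) ℝ) 0 0

lemma hasLaw_noise_jointLaw (hS₀ : S₀.PosSemidef) (hΓ : Γ.PosSemidef) :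
    HasLaw (fun z ↦ z.2 - matrixCLM A z.1) (multivariateGaussian 0 Γ)
      (jointLaw m₀ S₀ Γ (matrixCLM A)) := by
  have h_sub (x : EuclideanSpace ℝ (Fin d)) (y : EuclideanSpace ℝ (Fin k)) :
      matrixCLM (-A) x + matrixCLM 1 y + 0 = y - matrixCLM A x := by
    rw [matrixCLM_neg, matrixCLM_one, neg_apply, ContinuousLinearMap.id_apply]
    abel
  simpa only [h_sub, sub_self, Matrix.one_mul, neg_add_cancel, Matrix.zero_mul, zero_add,
    Matrix.transpose_one, Matrix.mul_one] using
    hasLaw_jointLaw (m₀ := m₀) A hS₀ hΓ (-A) 1 0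

lemma hasLaw_residual_jointLaw (hS₀ : S₀.PosDef) (hΓ : Γ.PosDef)
    (L : Matrix (Fin d) (Fin k) ℝ) (a : EuclideanSpace ℝ (Fin d)) (b : EuclideanSpace ℝ (Fin k)) :
    HasLaw (fun z ↦ z.1 - (a + matrixCLM L (z.2 - b)))
      (multivariateGaussian (m₀ - (a + matrixCLM L (matrixCLM A m₀ - b)))
        (postCov S₀ Γ A + (gain S₀ Γ A - L) * dataCov S₀ Γ A * (gain S₀ Γ A - L)ᵀ))
      (jointLaw m₀ S₀ Γ (matrixCLM A)) := by
  have h_sub (x : EuclideanSpace ℝ (Fin d)) (y : EuclideanSpace ℝ (Fin k)) :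
      matrixCLM 1 x + matrixCLM (-L) y + (matrixCLM L b - a) = x - (a + matrixCLM L (y - b)) := by
    rw [matrixCLM_neg, matrixCLM_one, neg_apply, ContinuousLinearMap.id_apply,
      map_sub]
    abel
  have h_law := hasLaw_jointLaw (m₀ := m₀) A hS₀.posSemidef hΓ.posSemidef 1 (-L)
    (matrixCLM L b - a)
  simpa only [h_sub, Matrix.neg_mul, ← sub_eq_add_neg, Matrix.transpose_neg, Matrix.mul_neg,
    neg_neg, joseph_form_eq_postCov_add A hS₀ hΓ] using h_law

lemma marginalLaw_eq (hS₀ : S₀.PosSemidef) (hΓ : Γ.PosSemidef) :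
    marginalLaw m₀ S₀ Γ (matrixCLM A) =
      multivariateGaussian (matrixCLM A m₀) (dataCov S₀ Γ A) :=
  (hasLaw_snd_jointLaw A hS₀ hΓ).map_eq

lemma tilted_eq_of_eq_withDensity_exp_add_const {α : Type*} [MeasurableSpace α] {μ ν : Measure α}
    [IsProbabilityMeasure μ] {f : α → ℝ} (hf : Measurable f) (c : ℝ)
    (h : μ = ν.withDensity fun x ↦ ENNReal.ofReal (Real.exp (f x + c))) : ν.tilted f = μ := by
  have h_split (x : α) : ENNReal.ofReal (Real.exp (f x + c)) =
      ENNReal.ofReal (Real.exp (f x)) * ENNReal.ofReal (Real.exp c) := by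
    rw [Real.exp_add, ENNReal.ofReal_mul (Real.exp_pos _).le]
  have h_mass : (∫⁻ x, ENNReal.ofReal (Real.exp (f x)) ∂ν) * ENNReal.ofReal (Real.exp c) = 1 := by
    rw [← lintegral_mul_const' _ _ ENNReal.ofReal_ne_top, ← measure_univ (μ := μ), h,
      withDensity_apply _ .univ, setLIntegral_univ]
    exact (lintegral_congr h_split).symm
  have h_integral : (∫ x, Real.exp (f x) ∂ν) * Real.exp c = 1 := by
    rw [integral_eq_lintegral_of_nonneg_ae (.of_forall fun x ↦ (Real.exp_pos _).le)
      hf.exp.aestronglyMeasurable, ← ENNReal.toReal_ofReal (Real.exp_pos c).le,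
      ← ENNReal.toReal_mul, h_mass, ENNReal.toReal_one]
  rw [Measure.tilted, h]
  congr with x
  rw [div_eq_mul_inv, ← eq_inv_of_mul_eq_one_right h_integral, Real.exp_add]

variable (m₀ S₀ Γ) in
/-- The mean of the posterior of `u` given the value `y` of `A u + η`. -/
noncomputable def postMean (y : EuclideanSpace ℝ (Fin k)) : EuclideanSpace ℝ (Fin d) :=
  m₀ + matrixCLM (gain S₀ Γ A) (y - matrixCLM A m₀)

/-- Completing the square in the prior density times the likelihood. -/
lemma log_gaussianDensity_post (hS₀ : S₀.PosDef) (hΓ : Γ.PosDef) (y : EuclideanSpace ℝ (Fin k)) :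
    ∃ c : ℝ, ∀ x, Real.log (gaussianDensity (postMean m₀ S₀ Γ A y) (postCov S₀ Γ A) x) =
      Real.log (gaussianDensity m₀ S₀ x) + (-((1 / 2) * quadInv Γ (y - matrixCLM A x)) + c) := by
  set r := y - matrixCLM A m₀ with hr
  refine ⟨-(1 / 2) * (Real.log (postCov S₀ Γ A).det - Real.log S₀.det +
    (quadForm (postCov S₀ Γ A)⁻¹ (matrixCLM (gain S₀ Γ A) r) - quadForm Γ⁻¹ r)), fun x ↦ ?_⟩
  have h_square := quadForm_inv_postCov_sub A hS₀ hΓ (x - m₀) r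
  have h_residual : r - matrixCLM A (x - m₀) = y - matrixCLM A x := by
    rw [hr, map_sub]
    abel
  rw [h_residual] at h_square
  rw [log_gaussianDensity _ (posDef_postCov A hS₀ hΓ), log_gaussianDensity _ hS₀, postMean,
    ← sub_sub, h_square, quadInv, ← quadForm]
  ring

lemma posteriorLaw_eq (hS₀ : S₀.PosDef) (hΓ : Γ.PosDef) (y : EuclideanSpace ℝ (Fin k)) :
    posteriorLaw m₀ S₀ Γ (matrixCLM A) y =
      multivariateGaussian (postMean m₀ S₀ Γ A y) (postCov S₀ Γ A) := by
  obtain ⟨c, hc⟩ := log_gaussianDensity_post (m₀ := m₀) A hS₀ hΓ y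
  have h_meas : Measurable fun x ↦ -((1 / 2) * quadInv Γ (y - matrixCLM A x)) :=
    (((continuous_quadForm Γ⁻¹).comp (by fun_prop)).measurable.const_mul _).neg
  refine tilted_eq_of_eq_withDensity_exp_add_const h_meas c ?_
  rw [multivariateGaussian_eq_withDensity_gaussianDensity m₀ hS₀,
    multivariateGaussian_eq_withDensity_gaussianDensity _ (posDef_postCov A hS₀ hΓ),
    ← withDensity_mul _ (measurable_gaussianDensity m₀ S₀).ennreal_ofReal
      (h_meas.add_const c).exp.ennreal_ofReal]
  congr with x
  rw [Pi.mul_apply, ← ENNReal.ofReal_mul (gaussianDensity_pos m₀ hS₀ x).le,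
    ← Real.exp_log (gaussianDensity_pos _ (posDef_postCov A hS₀ hΓ) x), hc, Real.exp_add,
    Real.exp_log (gaussianDensity_pos m₀ hS₀ x)]

end Model

section InformationGain

section CrossEntropyMean

variable {n : ℕ} {C Q S : Matrix (Fin n) (Fin n) ℝ}

lemma gaussianEntropy_eq (hS : S.PosDef) :
    gaussianEntropy S = (1 / 2) * (n * Real.log (2 * Real.pi) + Real.log S.det + n) := by
  rw [gaussianEntropy, gaussianCrossEntropy, Matrix.nonsing_inv_mul _ hS.det_pos.ne'.isUnit,
    Matrix.trace_one, Fintype.card_fin]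
  simp only [quadForm, WithLp.ofLp_zero, zero_dotProduct, add_zero]

lemma gaussianCrossEntropy_add_left (C Q S : Matrix (Fin n) (Fin n) ℝ)
    (v : EuclideanSpace ℝ (Fin n)) :
    gaussianCrossEntropy (C + Q) S v =
      gaussianCrossEntropy C S v + (1 / 2) * (S⁻¹ * Q).trace := by
  rw [gaussianCrossEntropy, gaussianCrossEntropy, Matrix.mul_add, Matrix.trace_add]
  ring

lemma trace_mul_nonneg_of_posSemidef {ι : Type*} [Fintype ι] {S Q : Matrix ι ι ℝ}
    (hS : S.PosSemidef) (hQ : Q.PosSemidef) : 0 ≤ (S * Q).trace := by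
  classical
  have h_integral := integral_quadForm hQ (HasLaw.id (μ := multivariateGaussian 0 Q)) S
  simp only [quadForm, WithLp.ofLp_zero, zero_dotProduct, add_zero] at h_integral
  rw [← h_integral]
  exact integral_nonneg fun x ↦ quadForm_nonneg hS x

variable {Ω : Type*} [MeasurableSpace Ω] {P : Measure Ω} {V : Ω → EuclideanSpace ℝ (Fin n)}
  {w : EuclideanSpace ℝ (Fin n)}

lemma integrable_gaussianKL (hV : HasLaw V (multivariateGaussian w Q) P)
    (C S : Matrix (Fin n) (Fin n) ℝ) : Integrable (fun ω ↦ gaussianKL C S (V ω)) P := by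
  have := hV.hasGaussianLaw.isProbabilityMeasure
  unfold gaussianKL gaussianCrossEntropy
  exact (((integrable_const _).add ((integrable_const _).add
    (integrable_quadForm hV S⁻¹))).const_mul _).sub (integrable_const _)

/-- Integrating out the mean of `N(V, C)` gives the Gaussian mixture `N(w, C + Q)`, and the cross
entropy is linear in its first argument. -/
lemma integral_gaussianKL (hQ : Q.PosSemidef) (hV : HasLaw V (multivariateGaussian w Q) P)
    (C S : Matrix (Fin n) (Fin n) ℝ) :
    ∫ ω, gaussianKL C S (V ω) ∂P = gaussianCrossEntropy (C + Q) S w - gaussianEntropy C := by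
  have := hV.hasGaussianLaw.isProbabilityMeasure
  have h_quad := integrable_quadForm hV S⁻¹
  unfold gaussianKL gaussianCrossEntropy
  rw [integral_sub (by fun_prop) (integrable_const _), integral_const_mul,
    integral_add (integrable_const _) (by fun_prop), integral_add (integrable_const _) h_quad,
    integral_quadForm hQ hV, Matrix.mul_add, Matrix.trace_add]
  simp only [integral_const, probReal_univ, one_smul]
  ring

end CrossEntropyMean

variable {d k : ℕ} {m₀ : EuclideanSpace ℝ (Fin d)} {S₀ : Matrix (Fin d) (Fin d) ℝ}
  {Γ : Matrix (Fin k) (Fin k) ℝ} (A : Matrix (Fin k) (Fin d) ℝ)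

lemma EIG_eq (hS₀ : S₀.PosDef) (hΓ : Γ.PosDef) :
    EIG m₀ S₀ Γ (matrixCLM A) =
      ENNReal.ofReal (gaussianEntropy S₀ - gaussianEntropy (postCov S₀ Γ A)) := by
  have hD := (posDef_dataCov A hS₀ hΓ).posSemidef
  have h_shift : HasLaw (fun y ↦ postMean m₀ S₀ Γ A y - m₀) (multivariateGaussian 0
      (gain S₀ Γ A * dataCov S₀ Γ A * (gain S₀ Γ A)ᵀ)) (marginalLaw m₀ S₀ Γ (matrixCLM A)) := by
    rw [marginalLaw_eq A hS₀.posSemidef hΓ.posSemidef]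
    have h_residual := hasLaw_sub_const (m := matrixCLM A m₀) hD HasLaw.id (matrixCLM A m₀)
    simpa only [postMean, id_eq, add_sub_cancel_left, sub_self, map_zero, add_zero] using
      hasLaw_matrixCLM_add hD h_residual (gain S₀ Γ A) 0
  have h_klDiv (y) : klDiv (posteriorLaw m₀ S₀ Γ (matrixCLM A) y) (multivariateGaussian m₀ S₀) =
      ENNReal.ofReal (gaussianKL (postCov S₀ Γ A) S₀ (postMean m₀ S₀ Γ A y - m₀)) := by
    rw [posteriorLaw_eq A hS₀ hΓ, klDiv_multivariateGaussian (posDef_postCov A hS₀ hΓ) hS₀]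
  rw [EIG, lintegral_congr h_klDiv, ← ofReal_integral_eq_lintegral_ofReal
    (integrable_gaussianKL h_shift _ _)
    (.of_forall fun y ↦ gaussianKL_nonneg (posDef_postCov A hS₀ hΓ) hS₀ _),
    integral_gaussianKL (hD.mul_mul_conjTranspose_same (gain S₀ Γ A)) h_shift,
    Matrix.conjTranspose_eq_transpose_of_trivial, postCov_add_gain_mul_dataCov A hS₀ hΓ,
    ← gaussianEntropy]

lemma gaussianEntropy_sub_postCov (hS₀ : S₀.PosDef) (hΓ : Γ.PosDef) :
    gaussianEntropy S₀ - gaussianEntropy (postCov S₀ Γ A) =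
      gaussianEntropy (dataCov S₀ Γ A) - gaussianEntropy Γ := by
  have hD := posDef_dataCov A hS₀ hΓ
  have hP := posDef_postCov A hS₀ hΓ
  have h_det := congrArg Real.log (det_dataCov_mul_det_postCov A hS₀ hΓ)
  rw [Real.log_mul hD.det_pos.ne' hP.det_pos.ne',
    Real.log_mul hS₀.det_pos.ne' hΓ.det_pos.ne'] at h_det
  rw [gaussianEntropy_eq hS₀, gaussianEntropy_eq hP, gaussianEntropy_eq hD, gaussianEntropy_eq hΓ]
  linarith

lemma gaussianEntropy_postCov_le (hS₀ : S₀.PosDef) (hΓ : Γ.PosDef) :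
    gaussianEntropy (postCov S₀ Γ A) ≤ gaussianEntropy S₀ := by
  have h_nonneg := gaussianKL_nonneg (posDef_postCov A hS₀ hΓ) hS₀ 0
  have h_trace := trace_mul_nonneg_of_posSemidef hS₀.inv.posSemidef
    ((posDef_dataCov A hS₀ hΓ).posSemidef.mul_mul_conjTranspose_same (gain S₀ Γ A))
  have h_mean := gaussianCrossEntropy_add_left (postCov S₀ Γ A)
    (gain S₀ Γ A * dataCov S₀ Γ A * (gain S₀ Γ A)ᵀ) S₀ 0
  rw [postCov_add_gain_mul_dataCov A hS₀ hΓ, ← gaussianEntropy] at h_mean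
  rw [gaussianKL] at h_nonneg
  rw [Matrix.conjTranspose_eq_transpose_of_trivial] at h_trace
  linarith

lemma toReal_EIG (hS₀ : S₀.PosDef) (hΓ : Γ.PosDef) :
    (EIG m₀ S₀ Γ (matrixCLM A)).toReal =
      gaussianEntropy S₀ - gaussianEntropy (postCov S₀ Γ A) := by
  rw [EIG_eq A hS₀ hΓ,
    ENNReal.toReal_ofReal (sub_nonneg.2 (gaussianEntropy_postCov_le A hS₀ hΓ))]

variable {u : ℕ → EuclideanSpace ℝ (Fin d)} {y : ℕ → EuclideanSpace ℝ (Fin k)} {J : ℕ}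

lemma upperIntegrand_eq (hΓ : Γ.PosDef) (hy : (empCov y y J).PosDef)
    (g : EuclideanSpace ℝ (Fin d) → EuclideanSpace ℝ (Fin k)) :
    upperIntegrand y J Γ g = fun z ↦ Real.log (gaussianDensity (g z.1) Γ z.2) -
      Real.log (gaussianDensity (empMean y J) (empCov y y J) z.2) :=
  funext fun _ ↦ Real.log_div (gaussianDensity_pos _ hΓ _).ne' (gaussianDensity_pos _ hy _).ne'

lemma lowerIntegrand_eq (hS₀ : S₀.PosDef) (hP : (approxPostCov u y J).PosDef) :
    lowerIntegrand u y J m₀ S₀ = fun z ↦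
      Real.log (gaussianDensity (approxPostMean u y J z.2) (approxPostCov u y J) z.1) -
        Real.log (gaussianDensity m₀ S₀ z.1) :=
  funext fun _ ↦ Real.log_div (gaussianDensity_pos _ hP _).ne' (gaussianDensity_pos _ hS₀ _).ne'

lemma integrable_upperIntegrand (hS₀ : S₀.PosDef) (hΓ : Γ.PosDef) (hy : (empCov y y J).PosDef) :
    Integrable (upperIntegrand y J Γ (matrixCLM A)) (jointLaw m₀ S₀ Γ (matrixCLM A)) := by
  rw [upperIntegrand_eq hΓ hy]
  exact (integrable_log_gaussianDensity hΓ
      (hasLaw_noise_jointLaw A hS₀.posSemidef hΓ.posSemidef)).sub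
    (integrable_log_gaussianDensity hy (hasLaw_sub_const (posDef_dataCov A hS₀ hΓ).posSemidef
      (hasLaw_snd_jointLaw A hS₀.posSemidef hΓ.posSemidef) _))

lemma eigUpper_sub_EIG (hS₀ : S₀.PosDef) (hΓ : Γ.PosDef) (hy : (empCov y y J).PosDef) :
    eigUpper y J m₀ S₀ Γ (matrixCLM A) - (EIG m₀ S₀ Γ (matrixCLM A)).toReal =
      gaussianKL (dataCov S₀ Γ A) (empCov y y J) (matrixCLM A m₀ - empMean y J) := by
  have hD := (posDef_dataCov A hS₀ hΓ).posSemidef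
  have h_noise := hasLaw_noise_jointLaw (m₀ := m₀) A hS₀.posSemidef hΓ.posSemidef
  have h_data := hasLaw_sub_const hD
    (hasLaw_snd_jointLaw (m₀ := m₀) A hS₀.posSemidef hΓ.posSemidef) (empMean y J)
  rw [eigUpper, upperIntegrand_eq hΓ hy, integral_sub (integrable_log_gaussianDensity hΓ h_noise)
    (integrable_log_gaussianDensity hy h_data),
    integral_log_gaussianDensity hΓ hΓ.posSemidef h_noise,
    integral_log_gaussianDensity hy hD h_data, toReal_EIG A hS₀ hΓ,
    gaussianEntropy_sub_postCov A hS₀ hΓ, gaussianKL, ← gaussianEntropy]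
  ring

lemma hasLaw_sub_approxPostMean_jointLaw (hS₀ : S₀.PosDef) (hΓ : Γ.PosDef)
    (u : ℕ → EuclideanSpace ℝ (Fin d)) (y : ℕ → EuclideanSpace ℝ (Fin k)) (J : ℕ) :
    HasLaw (fun z ↦ z.1 - approxPostMean u y J z.2)
      (multivariateGaussian (m₀ - approxPostMean u y J (matrixCLM A m₀))
        (postCov S₀ Γ A + (gain S₀ Γ A - empCov u y J * (empCov y y J)⁻¹) * dataCov S₀ Γ A *
          (gain S₀ Γ A - empCov u y J * (empCov y y J)⁻¹)ᵀ))
      (jointLaw m₀ S₀ Γ (matrixCLM A)) :=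
  hasLaw_residual_jointLaw A hS₀ hΓ (empCov u y J * (empCov y y J)⁻¹) (empMean u J) (empMean y J)

lemma integrable_lowerIntegrand (hS₀ : S₀.PosDef) (hΓ : Γ.PosDef)
    (hP : (approxPostCov u y J).PosDef) :
    Integrable (lowerIntegrand u y J m₀ S₀) (jointLaw m₀ S₀ Γ (matrixCLM A)) := by
  rw [lowerIntegrand_eq hS₀ hP]
  exact (integrable_log_gaussianDensity hP
      (hasLaw_sub_approxPostMean_jointLaw A hS₀ hΓ u y J)).sub
    (integrable_log_gaussianDensity hS₀ (hasLaw_sub_const hS₀.posSemidef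
      (hasLaw_fst_jointLaw A hS₀.posSemidef hΓ.posSemidef) m₀))

/-- The error of the empirical gain enters the gap of the lower bound through the covariance of
the residual `u - approxPostMean`. -/
lemma EIG_sub_eigLower (hS₀ : S₀.PosDef) (hΓ : Γ.PosDef) (hP : (approxPostCov u y J).PosDef) :
    (EIG m₀ S₀ Γ (matrixCLM A)).toReal - eigLower u y J m₀ S₀ Γ (matrixCLM A) =
      gaussianKL (postCov S₀ Γ A) (approxPostCov u y J)
          (m₀ - approxPostMean u y J (matrixCLM A m₀)) +
        (1 / 2) * ((approxPostCov u y J)⁻¹ * ((gain S₀ Γ A - empCov u y J * (empCov y y J)⁻¹) *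
          dataCov S₀ Γ A * (gain S₀ Γ A - empCov u y J * (empCov y y J)⁻¹)ᵀ)).trace := by
  have h_residual := hasLaw_sub_approxPostMean_jointLaw (m₀ := m₀) A hS₀ hΓ u y J
  have h_prior := hasLaw_sub_const hS₀.posSemidef
    (hasLaw_fst_jointLaw (m₀ := m₀) A hS₀.posSemidef hΓ.posSemidef) m₀
  have h_residualCov := (posDef_postCov A hS₀ hΓ).posSemidef.add
    ((posDef_dataCov A hS₀ hΓ).posSemidef.mul_mul_conjTranspose_same
      (gain S₀ Γ A - empCov u y J * (empCov y y J)⁻¹))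
  rw [sub_self] at h_prior
  rw [Matrix.conjTranspose_eq_transpose_of_trivial] at h_residualCov
  rw [eigLower, lowerIntegrand_eq hS₀ hP, integral_sub
    (integrable_log_gaussianDensity hP h_residual) (integrable_log_gaussianDensity hS₀ h_prior),
    integral_log_gaussianDensity hP h_residualCov h_residual,
    integral_log_gaussianDensity hS₀ hS₀.posSemidef h_prior, toReal_EIG A hS₀ hΓ,
    gaussianCrossEntropy_add_left, gaussianKL, ← gaussianEntropy]
  ring

lemma EIG_le_eigUpper (hS₀ : S₀.PosDef) (hΓ : Γ.PosDef) (hy : (empCov y y J).PosDef) :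
    (EIG m₀ S₀ Γ (matrixCLM A)).toReal ≤ eigUpper y J m₀ S₀ Γ (matrixCLM A) := by
  rw [← sub_nonneg, eigUpper_sub_EIG A hS₀ hΓ hy]
  exact gaussianKL_nonneg (posDef_dataCov A hS₀ hΓ) hy _

lemma eigLower_le_EIG (hS₀ : S₀.PosDef) (hΓ : Γ.PosDef) (hP : (approxPostCov u y J).PosDef) :
    eigLower u y J m₀ S₀ Γ (matrixCLM A) ≤ (EIG m₀ S₀ Γ (matrixCLM A)).toReal := by
  rw [← sub_nonneg, EIG_sub_eigLower A hS₀ hΓ hP]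
  have h_trace := trace_mul_nonneg_of_posSemidef hP.inv.posSemidef
    ((posDef_dataCov A hS₀ hΓ).posSemidef.mul_mul_conjTranspose_same
      (gain S₀ Γ A - empCov u y J * (empCov y y J)⁻¹))
  rw [Matrix.conjTranspose_eq_transpose_of_trivial] at h_trace
  have h_kl := gaussianKL_nonneg (posDef_postCov A hS₀ hΓ) hP
    (m₀ - approxPostMean u y J (matrixCLM A m₀))
  positivity

end InformationGain

section EmpiricalVariance

open scoped NNReal

variable {Ω : Type*} [MeasurableSpace Ω] {P : Measure Ω}

lemma sum_sq_pair_sub_le_sum_sq_sub (a : ℕ → ℝ) (c : ℝ) (J : ℕ) :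
    (1 / 2) * ∑ i ∈ Finset.range (J / 2), (a (2 * i + 1) - a (2 * i)) ^ 2 ≤
      ∑ j ∈ Finset.range J, (a j - c) ^ 2 := by
  have even_case (n : ℕ) : (1 / 2) * ∑ i ∈ Finset.range n, (a (2 * i + 1) - a (2 * i)) ^ 2 ≤
      ∑ j ∈ Finset.range (2 * n), (a j - c) ^ 2 := by
    induction n with
    | zero => simp
    | succ n ih =>
      rw [Finset.sum_range_succ, show 2 * (n + 1) = 2 * n + 1 + 1 by ring, Finset.sum_range_succ,
        Finset.sum_range_succ]
      nlinarith [sq_nonneg (a (2 * n + 1) - c + (a (2 * n) - c))]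
  refine (even_case _).trans
    (Finset.sum_le_sum_of_subset_of_nonneg ?_ fun _ _ _ ↦ sq_nonneg _)
  exact Finset.range_subset_range.2 (Nat.mul_div_le J 2)

lemma integral_exp_neg_sq_gaussianReal (V : ℝ≥0) {s : ℝ} (hs : 0 ≤ s) :
    ∫ x, Real.exp (-s * x ^ 2) ∂(gaussianReal 0 V) = (√(1 + 2 * s * V))⁻¹ := by
  rcases eq_or_ne V 0 with rfl | hV
  · simp
  have : (0 : ℝ) < V := NNReal.coe_pos.2 (pos_iff_ne_zero.2 hV)
  have hpdf (x : ℝ) : gaussianPDFReal 0 V x • Real.exp (-s * x ^ 2) =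
      (√(2 * Real.pi * V))⁻¹ * Real.exp (-(s + 1 / (2 * V)) * x ^ 2) := by
    rw [gaussianPDFReal, smul_eq_mul, mul_assoc, ← Real.exp_add]
    congr 2
    field_simp
    ring
  simp_rw [integral_gaussianReal_eq_integral_smul hV, hpdf]
  rw [integral_const_mul, integral_gaussian, ← Real.sqrt_inv, ← Real.sqrt_inv,
    ← Real.sqrt_mul (by positivity)]
  congr 1
  field_simp
  ring

lemma hasLaw_sub_gaussianReal {X Y : Ω → ℝ} {μ : ℝ} {V : ℝ≥0} (h : IndepFun X Y P)
    (hX : HasLaw X (gaussianReal μ V) P) (hY : HasLaw Y (gaussianReal μ V) P) :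
    HasLaw (fun ω ↦ Y ω - X ω) (gaussianReal 0 (2 * V)) P := by
  have hsum := gaussianReal_add_gaussianReal_of_indepFun
    (h.symm.comp measurable_id measurable_neg) hY.map_eq (gaussianReal_neg hX).map_eq
  rw [add_neg_cancel, ← two_mul] at hsum
  exact ⟨hY.aemeasurable.sub hX.aemeasurable, hsum⟩

lemma indepFun_pair_sub {a : ℕ → Ω → ℝ} (hindep : iIndepFun a P)
    (ha : ∀ j, AEMeasurable (a j) P) (n : ℕ) :
    IndepFun (fun ω (i : Fin n) ↦ a (2 * i + 1) ω - a (2 * i) ω)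
      (fun ω ↦ a (2 * n + 1) ω - a (2 * n) ω) P := by
  have hdisj : Disjoint (Finset.range (2 * n)) {2 * n, 2 * n + 1} := by
    rw [Finset.disjoint_left]
    intro i hi
    simp only [Finset.mem_range, Finset.mem_insert, Finset.mem_singleton] at hi ⊢
    omega
  have hcomp := (hindep.indepFun_finset₀ _ _ hdisj ha).comp
    (φ := fun (f : Finset.range (2 * n) → ℝ) (i : Fin n) ↦
      f ⟨2 * i + 1, Finset.mem_range.2 (by omega)⟩ - f ⟨2 * i, Finset.mem_range.2 (by omega)⟩)
    (ψ := fun f : ({2 * n, 2 * n + 1} : Finset ℕ) → ℝ ↦ f ⟨2 * n + 1, by simp⟩ - f ⟨2 * n, by simp⟩)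
    (by fun_prop) (by fun_prop)
  exact hcomp

variable [IsProbabilityMeasure P]

lemma integral_exp_neg_sum_sq_pair_sub {a : ℕ → Ω → ℝ} (hindep : iIndepFun a P) {μ : ℝ} {V : ℝ≥0}
    (hlaw : ∀ j, HasLaw (a j) (gaussianReal μ V) P) {s : ℝ} (hs : 0 ≤ s) (n : ℕ) :
    ∫ ω, Real.exp (-s * ∑ i ∈ Finset.range n, (a (2 * i + 1) ω - a (2 * i) ω) ^ 2) ∂P =
      ((√(1 + 4 * s * V))⁻¹) ^ n := by
  have ha := fun j ↦ (hlaw j).aemeasurable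
  induction n with
  | zero => simp
  | succ n ih =>
    have last : ∫ ω, Real.exp (-s * (a (2 * n + 1) ω - a (2 * n) ω) ^ 2) ∂P =
        (√(1 + 4 * s * V))⁻¹ := by
      have hsub := hasLaw_sub_gaussianReal
        (hindep.indepFun (i := 2 * n) (j := 2 * n + 1) (by omega)) (hlaw _) (hlaw _)
      refine (hsub.integral_comp (f := fun x ↦ Real.exp (-s * x ^ 2)) (by fun_prop)).trans ?_
      rw [integral_exp_neg_sq_gaussianReal _ hs, NNReal.coe_mul, NNReal.coe_ofNat]
      ring_nf
    have indep : IndepFun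
        (fun ω ↦ Real.exp (-s * ∑ i ∈ Finset.range n, (a (2 * i + 1) ω - a (2 * i) ω) ^ 2))
        (fun ω ↦ Real.exp (-s * (a (2 * n + 1) ω - a (2 * n) ω) ^ 2)) P := by
      simpa only [Function.comp_def, Finset.sum_range] using (indepFun_pair_sub hindep ha n).comp
        (φ := fun f ↦ Real.exp (-s * ∑ i, f i ^ 2)) (ψ := fun x ↦ Real.exp (-s * x ^ 2))
        (by fun_prop) (by fun_prop)
    simp_rw [Finset.sum_range_succ, mul_add, Real.exp_add]
    rw [indep.integral_fun_mul_eq_mul_integral (by fun_prop) (by fun_prop), ih, last, pow_succ]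

lemma one_add_div_pow_le_one_add_div_pow_half {t : ℝ} (ht : 0 ≤ t) {M J : ℕ} (hM : 0 < M)
    (hJ : 2 * M ≤ J) : (1 + t / (6 * M)) ^ M ≤ (1 + t / J) ^ (J / 2) := by
  have hJ₀ : (0 : ℝ) < J := Nat.cast_pos.2 (by omega)
  have : (0 : ℝ) < M := Nat.cast_pos.2 hM
  have htJ : 0 ≤ t / J := div_nonneg ht hJ₀.le
  set l := J / 2 / M with hl
  have hlJ : (J : ℝ) ≤ 6 * (M * l) := by
    have hdiv := Nat.div_add_mod (J / 2) M
    have hmod := Nat.mod_lt (J / 2) hM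
    have hMl : M ≤ M * l := Nat.le_mul_of_pos_right _ ((Nat.one_le_div_iff hM).2 (by omega))
    rw [← hl] at hdiv
    exact_mod_cast (by omega : J ≤ 6 * (M * l))
  have bernoulli : 1 + t / (6 * M) ≤ (1 + t / J) ^ l := by
    refine le_trans ?_ (one_add_mul_le_pow (by linarith) l)
    gcongr
    rw [div_le_iff₀ (by positivity), show l * (t / J) * (6 * M) = t * (6 * (M * l) / J) by ring]
    exact le_mul_of_one_le_right ht ((one_le_div hJ₀).2 hlJ)
  calc (1 + t / (6 * M)) ^ M ≤ ((1 + t / J) ^ l) ^ M := by gcongr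
    _ = (1 + t / J) ^ (l * M) := (pow_mul _ _ _).symm
    _ ≤ (1 + t / J) ^ (J / 2) :=
        pow_le_pow_right₀ (le_add_of_nonneg_right htJ) (Nat.div_mul_le_self _ M)

lemma inv_sqrt_pow_half_le {t : ℝ} (ht : 0 ≤ t) {R J : ℕ} (hR : 0 < R) (hJ : 4 * R ≤ J) :
    ((√(1 + 2 * t / J))⁻¹) ^ (J / 2) ≤ ((1 + t / (6 * R)) ^ R)⁻¹ := by
  have hpow := one_add_div_pow_le_one_add_div_pow_half (t := 2 * t) (by positivity)
    (M := 2 * R) (J := J) (by omega) (by omega)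
  have hR₀ : (R : ℝ) ≠ 0 := Nat.cast_ne_zero.2 hR.ne'
  rw [Nat.cast_mul, Nat.cast_ofNat, mul_left_comm 6 2 (R : ℝ), mul_div_mul_left _ _ two_ne_zero,
    mul_comm 2 R, pow_mul] at hpow
  rw [inv_pow]
  refine inv_anti₀ (by positivity) (le_of_sq_le_sq ?_ (by positivity))
  rwa [← pow_mul _ (J / 2), mul_comm (J / 2), pow_mul, Real.sq_sqrt (by positivity)]

lemma integrable_exp_neg_mul {s : ℝ} (hs : 0 ≤ s) {f : Ω → ℝ} (hf : AEMeasurable f P)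
    (hf₀ : 0 ≤ f) : Integrable (fun ω ↦ Real.exp (-s * f ω)) P := by
  refine .of_bound (by fun_prop) 1 (Eventually.of_forall fun ω ↦ ?_)
  rw [Real.norm_eq_abs, Real.abs_exp, Real.exp_le_one_iff, neg_mul, neg_nonpos]
  exact mul_nonneg hs (hf₀ ω)

/- Restricting to increments over disjoint pairs replaces the empirical mean, which depends on all
the samples, by independent terms. -/
lemma integral_exp_neg_average_sq_sub_le {a : ℕ → Ω → ℝ} (hindep : iIndepFun a P) {μ : ℝ}
    {V : ℝ≥0} (hlaw : ∀ j, HasLaw (a j) (gaussianReal μ V) P) {s : ℝ} (hs : 0 ≤ s) {R J : ℕ}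
    (hR : 0 < R) (hJ : 4 * R ≤ J) {c : Ω → ℝ} (hc : AEMeasurable c P) :
    ∫ ω, Real.exp (-s * ((J : ℝ)⁻¹ * ∑ j ∈ Finset.range J, (a j ω - c ω) ^ 2)) ∂P ≤
      ((1 + s * V / (6 * R)) ^ R)⁻¹ := by
  have ha := fun j ↦ (hlaw j).aemeasurable
  have hJ₀ : (0 : ℝ) < J := Nat.cast_pos.2 (by omega)
  calc _ ≤ ∫ ω, Real.exp (-(s / (2 * J)) *
        ∑ i ∈ Finset.range (J / 2), (a (2 * i + 1) ω - a (2 * i) ω) ^ 2) ∂P := by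
        refine integral_mono (integrable_exp_neg_mul hs (by fun_prop) fun ω ↦ by positivity)
          (integrable_exp_neg_mul (by positivity) (by fun_prop) fun ω ↦ by positivity)
          fun ω ↦ Real.exp_le_exp.2 ?_
        have hle := mul_le_mul_of_nonneg_left
          (sum_sq_pair_sub_le_sum_sq_sub (fun j ↦ a j ω) (c ω) J) (div_nonneg hs hJ₀.le)
        linear_combination hle
    _ = ((√(1 + 4 * (s / (2 * J)) * V))⁻¹) ^ (J / 2) :=
        integral_exp_neg_sum_sq_pair_sub hindep hlaw (by positivity) _
    _ = ((√(1 + 2 * (s * V) / J))⁻¹) ^ (J / 2) := by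
        rw [show 4 * (s / (2 * J)) * V = 2 * (s * V) / J by ring]
    _ ≤ ((1 + s * V / (6 * R)) ^ R)⁻¹ := inv_sqrt_pow_half_le (by positivity) hR hJ

end EmpiricalVariance

section SampleCovariance

open scoped RealInnerProductSpace

variable {ι κ : Type*}

/-- The empirical mean of the first `J` points, extending `empMean` to an arbitrary index type. -/
noncomputable def sampleMean (x : ℕ → EuclideanSpace ℝ ι) (J : ℕ) : EuclideanSpace ℝ ι :=
  (J : ℝ)⁻¹ • ∑ j ∈ Finset.range J, x j

/-- The empirical cross covariance of the first `J` points, extending `empCov` to arbitrary index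
types. -/
noncomputable def sampleCov (x : ℕ → EuclideanSpace ℝ ι) (z : ℕ → EuclideanSpace ℝ κ) (J : ℕ) :
    Matrix ι κ ℝ :=
  (J : ℝ)⁻¹ • ∑ j ∈ Finset.range J,
    Matrix.vecMulVec (x j - sampleMean x J).ofLp (z j - sampleMean z J).ofLp

lemma sampleMean_apply (x : ℕ → EuclideanSpace ℝ ι) (J : ℕ) (a : ι) :
    sampleMean x J a = (J : ℝ)⁻¹ * ∑ j ∈ Finset.range J, x j a := by
  simp only [sampleMean, PiLp.smul_apply, smul_eq_mul, WithLp.ofLp_sum, Finset.sum_apply]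

lemma sampleCov_apply (x : ℕ → EuclideanSpace ℝ ι) (z : ℕ → EuclideanSpace ℝ κ) (J : ℕ) (a : ι)
    (b : κ) : sampleCov x z J a b = (J : ℝ)⁻¹ *
      ∑ j ∈ Finset.range J, (x j a - sampleMean x J a) * (z j b - sampleMean z J b) := by
  simp only [sampleCov, Matrix.smul_apply, Matrix.sum_apply, Matrix.vecMulVec_apply,
    smul_eq_mul, PiLp.sub_apply]

lemma sum_apply_sub {J : ℕ} (hJ : J ≠ 0) (x : ℕ → EuclideanSpace ℝ ι) (m : EuclideanSpace ℝ ι)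
    (a : ι) : ∑ j ∈ Finset.range J, (x j a - m a) = J * (sampleMean x J - m) a := by
  rw [Finset.sum_sub_distrib, Finset.sum_const, Finset.card_range, nsmul_eq_mul, PiLp.sub_apply,
    sampleMean_apply]
  field_simp

lemma sampleCov_apply_eq_sub {J : ℕ} (hJ : J ≠ 0) (x : ℕ → EuclideanSpace ℝ ι)
    (z : ℕ → EuclideanSpace ℝ κ) (m : EuclideanSpace ℝ ι) (m' : EuclideanSpace ℝ κ) (a : ι)
    (b : κ) : sampleCov x z J a b =
      (J : ℝ)⁻¹ * ∑ j ∈ Finset.range J, (x j a - m a) * (z j b - m' b) -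
        (sampleMean x J - m) a * (sampleMean z J - m') b := by
  have hsplit (j : ℕ) : (x j a - sampleMean x J a) * (z j b - sampleMean z J b) =
      (x j a - m a) * (z j b - m' b) - (x j a - m a) * (sampleMean z J - m') b -
        (sampleMean x J - m) a * (z j b - m' b) +
          (sampleMean x J - m) a * (sampleMean z J - m') b := by
    rw [PiLp.sub_apply, PiLp.sub_apply]
    ring
  rw [sampleCov_apply, Finset.sum_congr rfl fun j _ ↦ hsplit j, Finset.sum_add_distrib,
    Finset.sum_sub_distrib, Finset.sum_sub_distrib, ← Finset.sum_mul, ← Finset.mul_sum,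
    sum_apply_sub hJ, sum_apply_sub hJ, Finset.sum_const, Finset.card_range, nsmul_eq_mul]
  field_simp
  ring

lemma sampleCov_transpose (x : ℕ → EuclideanSpace ℝ ι) (z : ℕ → EuclideanSpace ℝ κ) (J : ℕ) :
    (sampleCov x z J)ᵀ = sampleCov z x J := by
  ext b a
  simp only [Matrix.transpose_apply, sampleCov_apply, mul_comm]

/-- The vector with blocks `v` and `w`, in which a pair `(u, y)` becomes a single Gaussian
vector. -/
def stack (v : EuclideanSpace ℝ ι) (w : EuclideanSpace ℝ κ) : EuclideanSpace ℝ (ι ⊕ κ) :=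
  WithLp.toLp 2 (Sum.elim v.ofLp w.ofLp)

lemma stack_eq_add [Fintype ι] [Fintype κ] [DecidableEq ι] [DecidableEq κ]
    (v : EuclideanSpace ℝ ι) (w : EuclideanSpace ℝ κ) :
    stack v w = matrixCLM (Matrix.fromRows 1 0) v + matrixCLM (Matrix.fromRows 0 1) w := by
  ext (a | a) <;> simp [stack, Matrix.fromRows_mulVec]

lemma sampleCov_stack (x : ℕ → EuclideanSpace ℝ ι) (z : ℕ → EuclideanSpace ℝ κ) (J : ℕ) :
    sampleCov (fun j ↦ stack (x j) (z j)) (fun j ↦ stack (x j) (z j)) J =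
      Matrix.fromBlocks (sampleCov x x J) (sampleCov x z J) (sampleCov x z J)ᵀ
        (sampleCov z z J) := by
  rw [sampleCov_transpose]
  ext (a | a) (b | b) <;>
    simp only [stack, sampleCov_apply, sampleMean_apply, Sum.elim_inl, Sum.elim_inr,
      Matrix.fromBlocks_apply₁₁, Matrix.fromBlocks_apply₁₂, Matrix.fromBlocks_apply₂₁,
      Matrix.fromBlocks_apply₂₂]

lemma quadForm_sampleCov [Fintype ι] (x : ℕ → EuclideanSpace ℝ ι) (J : ℕ)
    (v : EuclideanSpace ℝ ι) : quadForm (sampleCov x x J) v =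
      (J : ℝ)⁻¹ * ∑ j ∈ Finset.range J, (⟪v, x j⟫ - ⟪v, sampleMean x J⟫) ^ 2 := by
  simp only [quadForm, sampleCov, Matrix.smul_mulVec, Matrix.sum_mulVec, Matrix.vecMulVec_mulVec,
    dotProduct_smul, dotProduct_sum, smul_eq_mul, inner_eq_dotProduct, WithLp.ofLp_sub,
    dotProduct_sub, MulOpposite.smul_eq_mul_unop, MulOpposite.unop_op, sq,
    dotProduct_comm _ v.ofLp]

lemma posSemidef_sampleCov [Finite ι] (x : ℕ → EuclideanSpace ℝ ι) (J : ℕ) :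
    (sampleCov x x J).PosSemidef := by
  have := Fintype.ofFinite ι
  refine .of_dotProduct_mulVec_nonneg ?_ fun v ↦ ?_
  · exact sampleCov_transpose x x J
  · rw [star_trivial]
    refine le_of_le_of_eq ?_ (quadForm_sampleCov x J (WithLp.toLp 2 v)).symm
    positivity

variable [Finite ι] [Finite κ] {Ω : Type*} [MeasurableSpace Ω] {P : Measure Ω}
  {x : ℕ → Ω → EuclideanSpace ℝ ι} {z : ℕ → Ω → EuclideanSpace ℝ κ}

lemma aestronglyMeasurable_sampleMean (hx : ∀ j, AEMeasurable (x j) P) (J : ℕ) :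
    AEStronglyMeasurable (fun ω ↦ sampleMean (x · ω) J) P :=
  have := Fintype.ofFinite ι
  (Finset.aestronglyMeasurable_fun_sum (Finset.range J)
    fun j _ ↦ (hx j).aestronglyMeasurable).fun_const_smul (J : ℝ)⁻¹

lemma aestronglyMeasurable_sampleCov (hx : ∀ j, AEMeasurable (x j) P)
    (hz : ∀ j, AEMeasurable (z j) P) (J : ℕ) :
    AEStronglyMeasurable (fun ω ↦ sampleCov (x · ω) (z · ω) J) P := by
  have := Fintype.ofFinite ι
  have := Fintype.ofFinite κ
  have h_outer : Continuous fun p : EuclideanSpace ℝ ι × EuclideanSpace ℝ κ ↦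
      Matrix.vecMulVec p.1.ofLp p.2.ofLp := by fun_prop
  have h_term (j : ℕ) : AEStronglyMeasurable (fun ω ↦ Matrix.vecMulVec
      (x j ω - sampleMean (x · ω) J).ofLp (z j ω - sampleMean (z · ω) J).ofLp) P :=
    h_outer.comp_aestronglyMeasurable
      (((hx j).aestronglyMeasurable.sub (aestronglyMeasurable_sampleMean hx J)).prodMk
        ((hz j).aestronglyMeasurable.sub (aestronglyMeasurable_sampleMean hz J)))
  exact (Finset.aestronglyMeasurable_fun_sum (Finset.range J)
    fun j _ ↦ h_term j).fun_const_smul (J : ℝ)⁻¹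

end SampleCovariance

section GaussianMass

variable {ι : Type*} [Fintype ι]

/-- The total mass of the unnormalized Gaussian density with precision matrix `S`. Finiteness
detects positive definiteness, and moments of it control moments of `S.det⁻¹`. -/
noncomputable def gaussianMass (S : Matrix ι ι ℝ) : ℝ≥0∞ :=
  ∫⁻ v : EuclideanSpace ℝ ι, ENNReal.ofReal (Real.exp (-(1 / 2) * quadForm S v))

lemma gaussianMass_add_le (S : Matrix ι ι ℝ) {Q : Matrix ι ι ℝ} (hQ : Q.PosSemidef) :
    gaussianMass (S + Q) ≤ gaussianMass S := by
  refine lintegral_mono fun v ↦ ENNReal.ofReal_le_ofReal (Real.exp_le_exp.2 ?_)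
  have hadd : quadForm (S + Q) v = quadForm S v + quadForm Q v := by
    simp only [quadForm, Matrix.add_mulVec, dotProduct_add]
  linarith [quadForm_nonneg hQ v]

variable [DecidableEq ι]

lemma toReal_gaussianMass_sq_mul_det {S : Matrix ι ι ℝ} (hS : S.PosDef) :
    (gaussianMass S).toReal ^ 2 * S.det = (2 * Real.pi) ^ Fintype.card ι := by
  have hdet := hS.det_pos
  rw [gaussianMass, lintegral_exp_neg_quadForm hS, ENNReal.toReal_ofReal (Real.sqrt_nonneg _),
    Real.sq_sqrt (by positivity), div_mul_cancel₀ _ hdet.ne']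

lemma two_pi_pow_le_toReal_gaussianMass_sq_mul_det {S : Matrix ι ι ℝ} (hS : S.PosSemidef)
    (h : gaussianMass S ≠ ∞) :
    (2 * Real.pi) ^ Fintype.card ι ≤ (gaussianMass S).toReal ^ 2 * S.det := by
  have regularized (ε : ℝ) (hε : 0 < ε) :
      (2 * Real.pi) ^ Fintype.card ι ≤ (gaussianMass S).toReal ^ 2 * (S + ε • 1).det := by
    have hε_one : (ε • (1 : Matrix ι ι ℝ)).PosDef := Matrix.PosDef.one.smul hε
    have hSε : (S + ε • (1 : Matrix ι ι ℝ)).PosDef := .posSemidef_add hS hε_one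
    rw [← toReal_gaussianMass_sq_mul_det hSε]
    have hdet := hSε.det_pos
    gcongr
    exact gaussianMass_add_le S hε_one.posSemidef
  have hcont : Continuous fun ε : ℝ ↦
      (gaussianMass S).toReal ^ 2 * (S + ε • (1 : Matrix ι ι ℝ)).det :=
    continuous_const.mul (Continuous.matrix_det (by fun_prop))
  have hlim := (hcont.tendsto 0).mono_left (nhdsWithin_le_nhds (s := Set.Ioi 0))
  rw [zero_smul, add_zero] at hlim
  exact ge_of_tendsto hlim (eventually_nhdsWithin_of_forall regularized)

omit [DecidableEq ι] in
lemma posDef_of_gaussianMass_ne_top {S : Matrix ι ι ℝ} (hS : S.PosSemidef)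
    (h : gaussianMass S ≠ ∞) : S.PosDef := by
  classical
  refine hS.posDef_iff_det_ne_zero.2 fun hdet ↦ ?_
  have hle := two_pi_pow_le_toReal_gaussianMass_sq_mul_det hS h
  rw [hdet, mul_zero] at hle
  exact hle.not_gt (by positivity)

lemma enorm_inv_det_le_gaussianMass_sq {S : Matrix ι ι ℝ} (hS : S.PosSemidef)
    (h : gaussianMass S ≠ ∞) : ‖S.det⁻¹‖ₑ ≤ gaussianMass S ^ 2 := by
  have hdet := (posDef_of_gaussianMass_ne_top hS h).det_pos
  rw [Real.enorm_eq_ofReal (inv_nonneg.2 hdet.le), ← ENNReal.ofReal_toReal h,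
    ← ENNReal.ofReal_pow ENNReal.toReal_nonneg]
  refine ENNReal.ofReal_le_ofReal ((inv_le_iff_one_le_mul₀ hdet).2 ?_)
  exact (one_le_pow₀ (by linarith [Real.two_le_pi])).trans
    (two_pi_pow_le_toReal_gaussianMass_sq_mul_det hS h)

omit [DecidableEq ι] in
open scoped MatrixOrder in
lemma exists_sq_norm_le_mul_quadForm {C : Matrix ι ι ℝ} (hC : C.PosDef) :
    ∃ K : ℝ, 0 < K ∧ ∀ v : EuclideanSpace ℝ ι, ‖v‖ ^ 2 ≤ K * quadForm C v := by
  classical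
  set L := CFC.sqrt C⁻¹
  set T := Matrix.toEuclideanCLM (𝕜 := ℝ) L
  have hT (v : EuclideanSpace ℝ ι) : T (Matrix.toEuclideanCLM (𝕜 := ℝ) L⁻¹ v) = v := by
    rw [← mul_apply_eq_comp, ← map_mul, Matrix.mul_nonsing_inv _
      ((Matrix.isUnit_iff_isUnit_det _).1 (isUnit_cfcSqrt hC.inv)), map_one,
      one_apply_eq_self]
  refine ⟨(‖T‖ + 1) ^ 2, by positivity, fun v ↦ ?_⟩
  set x := Matrix.toEuclideanCLM (𝕜 := ℝ) L⁻¹ v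
  have hx := quadForm_inv_toEuclideanCLM_cfcSqrt hC.inv x
  rw [Matrix.nonsing_inv_nonsing_inv _ hC.det_pos.ne'.isUnit] at hx
  rw [← hT v, hx, ← mul_pow]
  refine pow_le_pow_left₀ (norm_nonneg _) ((T.le_opNorm x).trans ?_) 2
  gcongr
  exact le_add_of_nonneg_right zero_le_one

end GaussianMass

section WeightedHolder

variable {α β : Type*} [MeasurableSpace α] [MeasurableSpace β]

lemma lintegral_pow_succ_le {μ : Measure α} {f : α → ℝ≥0∞} (hf : AEMeasurable f μ) (m : ℕ) :
    (∫⁻ a, f a ∂μ) ^ (m + 1) ≤ μ Set.univ ^ m * ∫⁻ a, f a ^ (m + 1) ∂μ := by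
  have hm : ((m + 1 : ℕ) : ℝ) ≠ 0 := Nat.cast_ne_zero.2 m.succ_ne_zero
  have holder := eLpNorm'_le_eLpNorm'_mul_rpow_measure_univ (p := 1) (q := (m + 1 : ℕ)) one_pos
    (Nat.one_le_cast.2 (Nat.le_add_left 1 m)) hf.aestronglyMeasurable
  simp only [eLpNorm', enorm_eq_self, ENNReal.rpow_one, div_one, ENNReal.rpow_natCast] at holder
  refine (pow_le_pow_left₀ zero_le holder (m + 1)).trans_eq ?_
  rw [mul_pow, ← ENNReal.rpow_natCast, ← ENNReal.rpow_mul, ← ENNReal.rpow_natCast (_ ^ (1 - _)),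
    ← ENNReal.rpow_mul, one_div, inv_mul_cancel₀ hm, ENNReal.rpow_one, sub_mul,
    inv_mul_cancel₀ hm, one_mul, Nat.cast_succ, add_sub_cancel_right, ENNReal.rpow_natCast,
    mul_comm]

lemma lintegral_pow_succ_le_weighted {μ : Measure α} {f w : α → ℝ≥0∞} (hf : Measurable f)
    (hw : Measurable w) (hw₀ : ∀ a, w a ≠ 0) (hw_top : ∀ a, w a ≠ ∞) (m : ℕ) :
    (∫⁻ a, f a ∂μ) ^ (m + 1) ≤
      (∫⁻ a, w a ∂μ) ^ m * ∫⁻ a, f a ^ (m + 1) * (w a)⁻¹ ^ m ∂μ := by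
  have hg : Measurable fun a ↦ f a * (w a)⁻¹ := hf.mul hw.inv
  convert lintegral_pow_succ_le (μ := μ.withDensity w) hg.aemeasurable m using 2
  · rw [lintegral_withDensity_eq_lintegral_mul _ hw hg]
    refine lintegral_congr fun a ↦ ?_
    rw [Pi.mul_apply, mul_left_comm, ENNReal.mul_inv_cancel (hw₀ a) (hw_top a), mul_one]
  · rw [withDensity_apply _ .univ, Measure.restrict_univ]
  · rw [lintegral_withDensity_eq_lintegral_mul _ hw (hg.pow_const _)]
    refine lintegral_congr fun a ↦ ?_
    rw [Pi.mul_apply, mul_pow, mul_left_comm, pow_succ (w a)⁻¹, mul_left_comm (w a),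
      ENNReal.mul_inv_cancel (hw₀ a) (hw_top a), mul_one]

lemma lintegral_lintegral_pow_succ_le {μ : Measure α} {ν : Measure β} [SFinite μ] [SFinite ν]
    {f : α → β → ℝ≥0∞} {w : β → ℝ≥0∞} (hf : ∀ a, Measurable (f a))
    (hf_prod : AEMeasurable (Function.uncurry f) (μ.prod ν)) (hw : Measurable w)
    (hw₀ : ∀ b, w b ≠ 0) (hw_top : ∀ b, w b ≠ ∞) (hw_int : ∫⁻ b, w b ∂ν ≠ ∞) {K : ℝ≥0∞} {m : ℕ}
    (h : ∀ b, ∫⁻ a, f a b ^ (m + 1) ∂μ ≤ K * w b ^ (m + 1)) :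
    ∫⁻ a, (∫⁻ b, f a b ∂ν) ^ (m + 1) ∂μ ≤ K * (∫⁻ b, w b ∂ν) ^ (m + 1) := by
  calc _ ≤ ∫⁻ a, (∫⁻ b, w b ∂ν) ^ m * ∫⁻ b, f a b ^ (m + 1) * (w b)⁻¹ ^ m ∂ν ∂μ :=
        lintegral_mono fun a ↦ lintegral_pow_succ_le_weighted (hf a) hw hw₀ hw_top m
    _ = (∫⁻ b, w b ∂ν) ^ m * ∫⁻ b, ∫⁻ a, f a b ^ (m + 1) * (w b)⁻¹ ^ m ∂μ ∂ν := by
        rw [lintegral_const_mul' _ _ (by finiteness), lintegral_lintegral_swap]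
        exact (hf_prod.pow_const _).mul
          ((hw.inv.pow_const m).comp measurable_snd).aemeasurable
    _ ≤ (∫⁻ b, w b ∂ν) ^ m * ∫⁻ b, K * w b ∂ν := by
        gcongr with b
        rw [lintegral_mul_const' _ _ (ENNReal.pow_ne_top (ENNReal.inv_ne_top.2 (hw₀ b)))]
        refine (mul_le_mul_left (h b) _).trans_eq ?_
        rw [pow_succ', mul_assoc, mul_assoc, ← mul_pow,
          ENNReal.mul_inv_cancel (hw₀ b) (hw_top b), one_pow, mul_one]
    _ = K * (∫⁻ b, w b ∂ν) ^ (m + 1) := by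
        rw [lintegral_const_mul _ hw, pow_succ, mul_left_comm]

end WeightedHolder

section InverseMoments

open scoped RealInnerProductSpace NNReal

variable {ι : Type*} [Fintype ι] {Ω : Type*} [MeasurableSpace Ω] {P : Measure Ω}

lemma lintegral_inv_one_add_sq_norm_pow_ne_top {E : Type*} [NormedAddCommGroup E]
    [NormedSpace ℝ E] [FiniteDimensional ℝ E] [MeasurableSpace E] [BorelSpace E] (μ : Measure E)
    [μ.IsAddHaarMeasure] {r : ℕ} (hr : Module.finrank ℝ E < 2 * r) :
    ∫⁻ v : E, ENNReal.ofReal ((1 + ‖v‖ ^ 2) ^ r)⁻¹ ∂μ ≠ ∞ := by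
  have hint := integrable_rpow_neg_one_add_norm_sq (μ := μ) (r := 2 * r) (by exact_mod_cast hr)
  convert hint.lintegral_lt_top.ne using 5 with v
  rw [neg_div, mul_div_cancel_left₀ _ two_ne_zero, Real.rpow_neg (by positivity),
    Real.rpow_natCast]

lemma exists_mul_one_add_sq_norm_le {C : Matrix ι ι ℝ} (hC : C.PosDef) {c : ℝ} (hc : 0 < c) :
    ∃ t : ℝ, 0 < t ∧ ∀ v : EuclideanSpace ℝ ι,
      t * (1 + ‖v‖ ^ 2) ≤ 1 + c * quadForm C v := by
  obtain ⟨K, hK, h⟩ := exists_sq_norm_le_mul_quadForm hC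
  refine ⟨min 1 (c / K), lt_min one_pos (by positivity), fun v ↦ ?_⟩
  rw [mul_add, mul_one]
  refine add_le_add (min_le_left _ _) ?_
  calc min 1 (c / K) * ‖v‖ ^ 2 ≤ c / K * (K * quadForm C v) :=
        mul_le_mul (min_le_right _ _) (h v) (by positivity) (by positivity)
    _ = c * quadForm C v := by field_simp

lemma aemeasurable_exp_quadForm_prod {S : Ω → Matrix ι ι ℝ} (hS : AEStronglyMeasurable S P) :
    AEMeasurable (fun z : Ω × EuclideanSpace ℝ ι ↦
      ENNReal.ofReal (Real.exp (-(1 / 2) * quadForm (S z.1) z.2))) (P.prod volume) := by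
  have hcont : Continuous fun p : Matrix ι ι ℝ × EuclideanSpace ℝ ι ↦
      Real.exp (-(1 / 2) * quadForm p.1 p.2) := by
    unfold quadForm
    fun_prop
  exact (hcont.comp_aestronglyMeasurable
    (hS.comp_fst.prodMk measurable_snd.aestronglyMeasurable)).aemeasurable.ennreal_ofReal

lemma aemeasurable_gaussianMass {S : Ω → Matrix ι ι ℝ} (hS : AEStronglyMeasurable S P) :
    AEMeasurable (fun ω ↦ gaussianMass (S ω)) P :=
  (aemeasurable_exp_quadForm_prod hS).lintegral_prod_right'

variable [DecidableEq ι] [IsProbabilityMeasure P] {x : ℕ → Ω → EuclideanSpace ℝ ι}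
  {m : EuclideanSpace ℝ ι} {C : Matrix ι ι ℝ}

lemma lintegral_exp_quadForm_sampleCov_pow_le (hindep : iIndepFun x P) (hC : C.PosSemidef)
    (hx : ∀ j, HasLaw (x j) (multivariateGaussian m C) P) (v : EuclideanSpace ℝ ι) (q : ℕ)
    {R J : ℕ} (hR : 0 < R) (hJ : 4 * R ≤ J) :
    ∫⁻ ω, ENNReal.ofReal (Real.exp (-(1 / 2) *
        quadForm (sampleCov (x · ω) (x · ω) J) v)) ^ q ∂P ≤
      ENNReal.ofReal ((1 + q / 2 / (6 * R) * quadForm C v) ^ R)⁻¹ := by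
  have hx_meas := fun j ↦ (hx j).aemeasurable
  have hmean : AEMeasurable (fun ω ↦ ⟪v, sampleMean (x · ω) J⟫) P := by
    have := (aestronglyMeasurable_sampleMean hx_meas J).aemeasurable
    fun_prop
  set f : Ω → ℝ := fun ω ↦ quadForm (sampleCov (x · ω) (x · ω) J) v
  have hf : AEMeasurable f P := by
    have hcont : Continuous fun S : Matrix ι ι ℝ ↦ quadForm S v := by
      unfold quadForm
      fun_prop
    exact (hcont.comp_aestronglyMeasurable
      (aestronglyMeasurable_sampleCov hx_meas hx_meas J)).aemeasurable
  have hf₀ : 0 ≤ f := fun ω ↦ quadForm_nonneg (posSemidef_sampleCov _ J) v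
  have hlaw : ∫ ω, Real.exp (-(q / 2) * f ω) ∂P ≤
      ((1 + q / 2 * ((quadForm C v).toNNReal : ℝ) / (6 * R)) ^ R)⁻¹ := by
    simp only [f, quadForm_sampleCov]
    exact integral_exp_neg_average_sq_sub_le
      (hindep.comp (fun _ y ↦ ⟪v, y⟫) fun _ ↦ by fun_prop)
      (fun j ↦ hasLaw_inner hC (hx j) v) (by positivity) hR hJ hmean
  rw [Real.coe_toNNReal _ (quadForm_nonneg hC v), mul_div_right_comm] at hlaw
  have hpow (ω : Ω) : ENNReal.ofReal (Real.exp (-(1 / 2) * f ω)) ^ q =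
      ENNReal.ofReal (Real.exp (-(q / 2) * f ω)) := by
    rw [← ENNReal.ofReal_pow (Real.exp_nonneg _), ← Real.exp_nat_mul]
    ring_nf
  rw [lintegral_congr hpow, ← ofReal_integral_eq_lintegral_ofReal
    (integrable_exp_neg_mul (by positivity) hf hf₀) (.of_forall fun ω ↦ Real.exp_nonneg _)]
  exact ENNReal.ofReal_le_ofReal hlaw

lemma exists_lintegral_gaussianMass_sampleCov_pow_le (hindep : iIndepFun x P) (hC : C.PosDef)
    (hx : ∀ j, HasLaw (x j) (multivariateGaussian m C) P) (q : ℕ) :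
    ∃ M : ℝ≥0∞, M ≠ ∞ ∧ ∀ᶠ J in atTop,
      ∫⁻ ω, gaussianMass (sampleCov (x · ω) (x · ω) J) ^ (q + 1) ∂P ≤ M := by
  set r := Fintype.card ι + 1
  set R := r * (q + 1)
  have hR : 0 < R := by positivity
  set w : EuclideanSpace ℝ ι → ℝ≥0∞ := fun v ↦ ENNReal.ofReal ((1 + ‖v‖ ^ 2) ^ r)⁻¹
  have hw_int : ∫⁻ v, w v ≠ ∞ := lintegral_inv_one_add_sq_norm_pow_ne_top volume (by
    rw [finrank_euclideanSpace]
    omega)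
  obtain ⟨t, ht, htC⟩ := exists_mul_one_add_sq_norm_le hC
    (c := (q + 1 : ℕ) / 2 / (6 * R)) (by positivity)
  refine ⟨ENNReal.ofReal (t ^ R)⁻¹ * (∫⁻ v, w v) ^ (q + 1), by finiteness, ?_⟩
  filter_upwards [eventually_ge_atTop (4 * R)] with J hJ
  have hmeas := aestronglyMeasurable_sampleCov (fun j ↦ (hx j).aemeasurable)
    (fun j ↦ (hx j).aemeasurable) J
  refine lintegral_lintegral_pow_succ_le (fun ω ↦ by fun_prop)
    (aemeasurable_exp_quadForm_prod hmeas) (by fun_prop)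
    (fun v ↦ (ENNReal.ofReal_pos.2 (by positivity)).ne') (fun v ↦ ENNReal.ofReal_ne_top) hw_int
    fun v ↦ ?_
  refine (lintegral_exp_quadForm_sampleCov_pow_le hindep hC.posSemidef hx v (q + 1) hR hJ).trans ?_
  rw [← ENNReal.ofReal_pow (by positivity), ← ENNReal.ofReal_mul (by positivity), inv_pow,
    ← pow_mul, ← mul_inv, ← mul_pow]
  gcongr
  exact htC v

lemma eventually_ae_gaussianMass_sampleCov_ne_top (hindep : iIndepFun x P) (hC : C.PosDef)
    (hx : ∀ j, HasLaw (x j) (multivariateGaussian m C) P) :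
    ∀ᶠ J in atTop, ∀ᵐ ω ∂P, gaussianMass (sampleCov (x · ω) (x · ω) J) ≠ ∞ := by
  obtain ⟨M, hM, h⟩ := exists_lintegral_gaussianMass_sampleCov_pow_le hindep hC hx 0
  filter_upwards [h] with J hJ
  simp only [zero_add, pow_one] at hJ
  have hmeas := aemeasurable_gaussianMass (aestronglyMeasurable_sampleCov
    (fun j ↦ (hx j).aemeasurable) (fun j ↦ (hx j).aemeasurable) J)
  exact (ae_lt_top' hmeas (ne_top_of_le_ne_top hM hJ)).mono fun ω h ↦ h.ne

lemma eventually_ae_posDef_sampleCov (hindep : iIndepFun x P) (hC : C.PosDef)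
    (hx : ∀ j, HasLaw (x j) (multivariateGaussian m C) P) :
    ∀ᶠ J in atTop, ∀ᵐ ω ∂P, (sampleCov (x · ω) (x · ω) J).PosDef :=
  (eventually_ae_gaussianMass_sampleCov_ne_top hindep hC hx).mono fun _ h ↦
    h.mono fun _ hω ↦ posDef_of_gaussianMass_ne_top (posSemidef_sampleCov _ _) hω

lemma hasLpRate_inv_det_sampleCov (hindep : iIndepFun x P) (hC : C.PosDef)
    (hx : ∀ j, HasLaw (x j) (multivariateGaussian m C) P) :
    HasLpRate P 0 fun J ω ↦ (sampleCov (x · ω) (x · ω) J).det⁻¹ := fun q hq ↦ by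
  obtain ⟨M, hM, h⟩ := exists_lintegral_gaussianMass_sampleCov_pow_le hindep hC hx (2 * q - 1)
  rw [Nat.sub_add_cancel (by omega)] at h
  refine ⟨(M ^ (q : ℝ)⁻¹).toNNReal, ?_⟩
  filter_upwards [h, eventually_ae_gaussianMass_sampleCov_ne_top hindep hC hx] with J hJ hfin
  have hmeas := aestronglyMeasurable_sampleCov (fun j ↦ (hx j).aemeasurable)
    (fun j ↦ (hx j).aemeasurable) J
  have hdet : AEMeasurable (fun ω ↦ (sampleCov (x · ω) (x · ω) J).det) P :=
    (Continuous.matrix_det continuous_id).comp_aestronglyMeasurable hmeas |>.aemeasurable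
  refine ⟨hdet.inv.aestronglyMeasurable, ?_⟩
  rw [pow_zero, mul_one, ENNReal.coe_toNNReal (by finiteness)]
  refine eLpNorm_le_of_lintegral_enorm_pow_le hq ?_
  rw [ENNReal.rpow_inv_natCast_pow hq]
  refine (lintegral_mono_ae (hfin.mono fun ω hω ↦ ?_)).trans hJ
  rw [pow_mul]
  gcongr
  exact enorm_inv_det_le_gaussianMass_sq (posSemidef_sampleCov _ _) hω

end InverseMoments

section SampleMoments

variable {ι : Type*} [Fintype ι] {Ω : Type*} [MeasurableSpace Ω] {P : Measure Ω}
  [IsProbabilityMeasure P]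

lemma hasLpRate_average_sub_integral {E : Type*} [MeasurableSpace E] {x : ℕ → Ω → E}
    {μ : Measure E} (hindep : iIndepFun x P) (hx : ∀ j, HasLaw (x j) μ P) {f : E → ℝ}
    (hf : Measurable f) (hmem : ∀ q : ℕ, MemLp (fun ω ↦ f (x 0 ω)) q P) :
    HasLpRate P 1 fun J ω ↦
      (J : ℝ)⁻¹ * ∑ j ∈ Finset.range J, f (x j ω) - ∫ ω, f (x 0 ω) ∂P := by
  set c := ∫ ω, f (x 0 ω) ∂P with hc
  have hcenter : Measurable fun a ↦ f a - c := hf.sub_const c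
  have hrate := hasLpRate_average (hindep.comp (fun _ a ↦ f a - c) fun _ ↦ hcenter)
    (fun j ↦ ((hx j).identDistrib (hx 0)).comp hcenter)
    (fun q ↦ (hmem q).sub (memLp_const c))
    (by simp only [Function.comp_def]
        rw [integral_sub ((hmem 1).integrable (by simp)) (integrable_const c), integral_const,
          probReal_univ, one_smul, ← hc, sub_self])
  refine hrate.congr ((eventually_ne_atTop 0).mono fun J hJ ↦ .of_forall fun ω ↦ ?_)
  simp only [Function.comp_apply, Finset.sum_sub_distrib, Finset.sum_const, Finset.card_range,
    nsmul_eq_mul, mul_sub, inv_mul_cancel_left₀ (Nat.cast_ne_zero (R := ℝ).2 hJ)]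

variable [DecidableEq ι] {x : ℕ → Ω → EuclideanSpace ℝ ι} {m : EuclideanSpace ℝ ι}
  {C : Matrix ι ι ℝ}

lemma hasLpRate_sampleMean_sub (hindep : iIndepFun x P)
    (hx : ∀ j, HasLaw (x j) (multivariateGaussian m C) P) :
    HasLpRate P 1 fun J ω ↦ sampleMean (x · ω) J - m :=
  hasLpRate_euclideanSpace_iff.2 fun a ↦ by
    have hrate := hasLpRate_average_sub_integral hindep hx (f := fun v ↦ v a) (by fun_prop)
      fun q ↦ memLp_apply (hx 0) a (ENNReal.natCast_ne_top q)
    simpa only [integral_apply (hx 0), ← sampleMean_apply, ← PiLp.sub_apply] using hrate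

lemma hasLpRate_average_mul_sub (hindep : iIndepFun x P) (hC : C.PosSemidef)
    (hx : ∀ j, HasLaw (x j) (multivariateGaussian m C) P) (a b : ι) :
    HasLpRate P 1 fun J ω ↦
      (J : ℝ)⁻¹ * ∑ j ∈ Finset.range J, (x j ω a - m a) * (x j ω b - m b) - C a b := by
  have hcenter := hasLaw_sub_const hC (hx 0) m
  rw [sub_self] at hcenter
  have hmem (c : ι) (q : ℕ) : MemLp (fun ω ↦ (x 0 ω - m) c) (2 * q : ℕ) P :=
    memLp_apply hcenter c (ENNReal.natCast_ne_top _)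
  have hcov := integral_apply_mul_apply hC hcenter a b
  simp only [PiLp.sub_apply, PiLp.zero_apply, mul_zero, add_zero] at hcov
  have hrate := hasLpRate_average_sub_integral hindep hx
    (f := fun v ↦ (v - m) a * (v - m) b) (by fun_prop) fun q ↦
      have := holderTriple_two_mul q
      (hmem b q).mul' (hmem a q)
  simpa only [hcov, PiLp.sub_apply] using hrate

open scoped Matrix.Norms.Elementwise in
lemma hasLpRate_sampleCov_sub (hindep : iIndepFun x P) (hC : C.PosSemidef)
    (hx : ∀ j, HasLaw (x j) (multivariateGaussian m C) P) :
    HasLpRate P 1 fun J ω ↦ sampleCov (x · ω) (x · ω) J - C :=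
  hasLpRate_matrix_iff.2 fun a b ↦ by
    have hmean := hasLpRate_euclideanSpace_iff.1 (hasLpRate_sampleMean_sub hindep hx)
    refine ((hasLpRate_average_mul_sub hindep hC hx a b).sub
      (((hmean a).mul (hmean b)).mono one_le_two)).congr ?_
    refine (eventually_ne_atTop 0).mono fun J hJ ↦ .of_forall fun ω ↦ ?_
    simp only [Matrix.sub_apply, sampleCov_apply_eq_sub hJ _ _ m m]
    ring

end SampleMoments

section PlugIn

open scoped Matrix.Norms.Elementwise

variable {ι κ : Type*} [Fintype ι] [Fintype κ] {Ω : Type*} [MeasurableSpace Ω] {P : Measure Ω}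
  {e e' : ℕ}

lemma HasLpRate.matrixCLM_apply [DecidableEq ι] {M : ℕ → Ω → Matrix κ ι ℝ}
    {v : ℕ → Ω → EuclideanSpace ℝ ι} (hM : HasLpRate P e M) (hv : HasLpRate P e' v) :
    HasLpRate P (e + e') fun J ω ↦ matrixCLM (M J ω) (v J ω) :=
  hasLpRate_euclideanSpace_iff.2 fun i ↦ by
    simpa only [ofLp_matrixCLM, Matrix.mulVec, dotProduct] using HasLpRate.sum _ fun j _ ↦
      (hasLpRate_matrix_iff.1 hM i j).mul (hasLpRate_euclideanSpace_iff.1 hv j)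

lemma HasLpRate.quadForm {Q : ℕ → Ω → Matrix ι ι ℝ} {v : ℕ → Ω → EuclideanSpace ℝ ι}
    (hQ : HasLpRate P e Q) (hv : HasLpRate P e' v) :
    HasLpRate P (e + (e' + e')) fun J ω ↦ quadForm (Q J ω) (v J ω) := by
  simp only [quadForm_eq_sum]
  exact HasLpRate.sum _ fun i _ ↦ HasLpRate.sum _ fun j _ ↦ (hasLpRate_matrix_iff.1 hQ i j).mul
    ((hasLpRate_euclideanSpace_iff.1 hv i).mul (hasLpRate_euclideanSpace_iff.1 hv j))

lemma HasLpRate.gaussianKL [IsFiniteMeasure P] {n : ℕ} {C : Matrix (Fin n) (Fin n) ℝ}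
    {S : ℕ → Ω → Matrix (Fin n) (Fin n) ℝ} {v : ℕ → Ω → EuclideanSpace ℝ (Fin n)}
    (hC : C.PosDef) (hS : HasLpRate P 1 fun J ω ↦ S J ω - C) (hv : HasLpRate P 1 v)
    (hinv : HasLpRate P 0 fun J ω ↦ (S J ω)⁻¹)
    (hpos : ∀ᶠ J in atTop, ∀ᵐ ω ∂P, (S J ω).PosDef) :
    HasLpRate P 2 fun J ω ↦ gaussianKL C (S J ω) (v J ω) := by
  have hbound := (((hinv.matrix_mul hS).matrix_mul ((const C⁻¹).matrix_mul hS)).trace.add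
    (hinv.quadForm hv)).const_mul (1 / 2)
  have hquad := hinv.quadForm hv
  refine hbound.of_norm_le ?_ ?_
  · filter_upwards [hS.of_sub_const.det.aestronglyMeasurable, hquad.aestronglyMeasurable,
      (hinv.matrix_mul (const C)).trace.aestronglyMeasurable] with J hdet hq htrace
    have hlog := hdet.aemeasurable.log.aestronglyMeasurable
    simp only [gaussianKL_eq hC]
    exact (((htrace.sub aestronglyMeasurable_const).add
      (hlog.sub aestronglyMeasurable_const)).add hq).const_mul _
  · filter_upwards [hpos] with J hJ
    filter_upwards [hJ] with ω hω
    rw [Real.norm_of_nonneg (gaussianKL_nonneg hC hω _)]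
    exact (gaussianKL_le hC hω _).trans (le_abs_self _)

end PlugIn

section Sample

variable {d k : ℕ} {m₀ : EuclideanSpace ℝ (Fin d)} {S₀ : Matrix (Fin d) (Fin d) ℝ}
  {Γ : Matrix (Fin k) (Fin k) ℝ} {A : Matrix (Fin k) (Fin d) ℝ} {Ω : Type*} [MeasurableSpace Ω]
  {P : Measure Ω} {u : ℕ → Ω → EuclideanSpace ℝ (Fin d)} {y : ℕ → Ω → EuclideanSpace ℝ (Fin k)}

/-- The pairs `(u j, y j)` are independent draws from the joint law of the parameter and the data
in the model `y = A u + η` with nondegenerate Gaussian prior and noise. -/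
structure LinearGaussianSample (m₀ : EuclideanSpace ℝ (Fin d)) (S₀ : Matrix (Fin d) (Fin d) ℝ)
    (Γ : Matrix (Fin k) (Fin k) ℝ) (A : Matrix (Fin k) (Fin d) ℝ) (P : Measure Ω)
    (u : ℕ → Ω → EuclideanSpace ℝ (Fin d)) (y : ℕ → Ω → EuclideanSpace ℝ (Fin k)) : Prop where
  posDef_prior : S₀.PosDef
  posDef_noise : Γ.PosDef
  hasLaw : ∀ j, HasLaw (fun ω ↦ (u j ω, y j ω)) (jointLaw m₀ S₀ Γ (matrixCLM A)) P
  iIndepFun : iIndepFun (fun j ω ↦ (u j ω, y j ω)) P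

namespace LinearGaussianSample

section Laws

variable (h : LinearGaussianSample m₀ S₀ Γ A P u y)
include h

lemma posDef_dataCov : (dataCov S₀ Γ A).PosDef :=
  BOED.posDef_dataCov A h.posDef_prior h.posDef_noise

lemma posDef_postCov : (postCov S₀ Γ A).PosDef :=
  BOED.posDef_postCov A h.posDef_prior h.posDef_noise

lemma hasLaw_parameter (j : ℕ) : HasLaw (u j) (multivariateGaussian m₀ S₀) P :=
  (hasLaw_fst_jointLaw A h.posDef_prior.posSemidef h.posDef_noise.posSemidef).comp (h.hasLaw j)

lemma hasLaw_data (j : ℕ) :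
    HasLaw (y j) (multivariateGaussian (matrixCLM A m₀) (dataCov S₀ Γ A)) P :=
  (hasLaw_snd_jointLaw A h.posDef_prior.posSemidef h.posDef_noise.posSemidef).comp (h.hasLaw j)

lemma hasLaw_stack (j : ℕ) : HasLaw (fun ω ↦ stack (u j ω) (y j ω))
    (multivariateGaussian (stack m₀ (matrixCLM A m₀)) (jointCov S₀ Γ A)) P := by
  have hjoint := (hasLaw_jointLaw (m₀ := m₀) A h.posDef_prior.posSemidef h.posDef_noise.posSemidef
    (Matrix.fromRows (1 : Matrix (Fin d) (Fin d) ℝ) (0 : Matrix (Fin k) (Fin d) ℝ))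
    (Matrix.fromRows (0 : Matrix (Fin d) (Fin k) ℝ) (1 : Matrix (Fin k) (Fin k) ℝ)) 0).comp
    (h.hasLaw j)
  simpa only [fromRows_mul_mul_transpose_add A h.posDef_prior, Function.comp_def, add_zero,
    ← stack_eq_add] using hjoint

lemma iIndepFun_parameter : ProbabilityTheory.iIndepFun u P :=
  h.iIndepFun.comp (fun _ ↦ Prod.fst) fun _ ↦ measurable_fst

lemma iIndepFun_data : ProbabilityTheory.iIndepFun y P :=
  h.iIndepFun.comp (fun _ ↦ Prod.snd) fun _ ↦ measurable_snd

lemma iIndepFun_stack : ProbabilityTheory.iIndepFun (fun j ω ↦ stack (u j ω) (y j ω)) P :=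
  h.iIndepFun.comp (fun _ z ↦ stack z.1 z.2) fun _ ↦ by
    simp only [stack_eq_add]
    fun_prop

end Laws

variable [IsProbabilityMeasure P]

section PosDef

variable (h : LinearGaussianSample m₀ S₀ Γ A P u y)
include h

lemma eventually_ae_posDef_jointEmpCov : ∀ᶠ J in atTop, ∀ᵐ ω ∂P,
    (Matrix.fromBlocks (empCov (u · ω) (u · ω) J) (empCov (u · ω) (y · ω) J)
      (empCov (u · ω) (y · ω) J)ᵀ (empCov (y · ω) (y · ω) J)).PosDef := by
  have hpos := eventually_ae_posDef_sampleCov h.iIndepFun_stack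
    (posDef_jointCov A h.posDef_prior h.posDef_noise) h.hasLaw_stack
  simp only [sampleCov_stack] at hpos
  exact hpos

lemma eventually_ae_posDef_empCov :
    ∀ᶠ J in atTop, ∀ᵐ ω ∂P, (empCov (y · ω) (y · ω) J).PosDef :=
  h.eventually_ae_posDef_jointEmpCov.mono fun _ hJ ↦ hJ.mono fun _ ↦ posDef_fromBlocks₂₂

lemma eventually_ae_posDef_approxPostCov :
    ∀ᶠ J in atTop, ∀ᵐ ω ∂P, (approxPostCov (u · ω) (y · ω) J).PosDef :=
  h.eventually_ae_posDef_jointEmpCov.mono fun _ hJ ↦ hJ.mono fun _ ↦ posDef_condCov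

end PosDef

open scoped Matrix.Norms.Elementwise

variable (h : LinearGaussianSample m₀ S₀ Γ A P u y)
include h

lemma hasLpRate_jointEmpCov_sub : HasLpRate P 1 fun J ω ↦
    Matrix.fromBlocks (empCov (u · ω) (u · ω) J) (empCov (u · ω) (y · ω) J)
      (empCov (u · ω) (y · ω) J)ᵀ (empCov (y · ω) (y · ω) J) - jointCov S₀ Γ A := by
  have hrate := hasLpRate_sampleCov_sub h.iIndepFun_stack
    (posDef_jointCov A h.posDef_prior h.posDef_noise).posSemidef h.hasLaw_stack
  simp only [sampleCov_stack] at hrate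
  exact hrate

lemma hasLpRate_empCov_parameter_sub :
    HasLpRate P 1 fun J ω ↦ empCov (u · ω) (u · ω) J - S₀ :=
  hasLpRate_matrix_iff.2 fun a b ↦
    hasLpRate_matrix_iff.1 h.hasLpRate_jointEmpCov_sub (.inl a) (.inl b)

lemma hasLpRate_empCov_cross_sub :
    HasLpRate P 1 fun J ω ↦ empCov (u · ω) (y · ω) J - S₀ * Aᵀ :=
  hasLpRate_matrix_iff.2 fun a b ↦
    hasLpRate_matrix_iff.1 h.hasLpRate_jointEmpCov_sub (.inl a) (.inr b)

lemma hasLpRate_empCov_data_sub :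
    HasLpRate P 1 fun J ω ↦ empCov (y · ω) (y · ω) J - dataCov S₀ Γ A :=
  hasLpRate_matrix_iff.2 fun a b ↦
    hasLpRate_matrix_iff.1 h.hasLpRate_jointEmpCov_sub (.inr a) (.inr b)

lemma hasLpRate_inv_empCov : HasLpRate P 0 fun J ω ↦ (empCov (y · ω) (y · ω) J)⁻¹ :=
  h.hasLpRate_empCov_data_sub.of_sub_const.matrix_inv
    (hasLpRate_inv_det_sampleCov h.iIndepFun_data h.posDef_dataCov h.hasLaw_data)

lemma hasLpRate_empGain_sub : HasLpRate P 1 fun J ω ↦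
    empCov (u · ω) (y · ω) J * (empCov (y · ω) (y · ω) J)⁻¹ - gain S₀ Γ A :=
  h.hasLpRate_empCov_cross_sub.matrix_mul_sub_mul <|
    h.hasLpRate_empCov_data_sub.matrix_inv_sub_inv h.posDef_dataCov.isUnit h.hasLpRate_inv_empCov
      (h.eventually_ae_posDef_empCov.mono fun _ hJ ↦ hJ.mono fun _ hω ↦ hω.isUnit)

lemma hasLpRate_approxPostCov_sub :
    HasLpRate P 1 fun J ω ↦ approxPostCov (u · ω) (y · ω) J - postCov S₀ Γ A := by
  have hcross : HasLpRate P 1 fun J ω ↦ (empCov (u · ω) (y · ω) J)ᵀ - (S₀ * Aᵀ)ᵀ := by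
    simpa only [← Matrix.transpose_sub] using h.hasLpRate_empCov_cross_sub.transpose
  have hrate := h.hasLpRate_empCov_parameter_sub.sub
    (h.hasLpRate_empGain_sub.matrix_mul_sub_mul hcross)
  simpa only [sub_sub_sub_comm, approxPostCov, postCov, condCov, gain] using hrate

/-- The inverse determinant is that of the data block divided by that of the joint covariance. -/
lemma hasLpRate_inv_det_approxPostCov :
    HasLpRate P 0 fun J ω ↦ (approxPostCov (u · ω) (y · ω) J).det⁻¹ := by
  have hjoint := hasLpRate_inv_det_sampleCov h.iIndepFun_stack
    (posDef_jointCov A h.posDef_prior h.posDef_noise) h.hasLaw_stack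
  simp only [sampleCov_stack] at hjoint
  refine (h.hasLpRate_empCov_data_sub.of_sub_const.det.mul hjoint).congr ?_
  filter_upwards [h.eventually_ae_posDef_empCov] with J hJ
  filter_upwards [hJ] with ω hω
  have hdet := det_fromBlocks_eq_mul_det_condCov hω
    (B := empCov (u · ω) (u · ω) J) (C := empCov (u · ω) (y · ω) J)
  exact (congrArg (_ * ·⁻¹) hdet).trans (by
    rw [mul_inv, mul_inv_cancel_left₀ hω.det_pos.ne']
    rfl)

lemma hasLpRate_inv_approxPostCov :
    HasLpRate P 0 fun J ω ↦ (approxPostCov (u · ω) (y · ω) J)⁻¹ :=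
  h.hasLpRate_approxPostCov_sub.of_sub_const.matrix_inv h.hasLpRate_inv_det_approxPostCov

lemma hasLpRate_empMean_data_sub : HasLpRate P 1 fun J ω ↦ matrixCLM A m₀ - empMean (y · ω) J := by
  have hrate := (hasLpRate_sampleMean_sub h.iIndepFun_data h.hasLaw_data).neg
  simp only [neg_sub] at hrate
  exact hrate

lemma hasLpRate_postMean_sub (y₀ : EuclideanSpace ℝ (Fin k)) :
    HasLpRate P 1 fun J ω ↦ postMean m₀ S₀ Γ A y₀ - approxPostMean (u · ω) (y · ω) J y₀ := by
  have hmean := hasLpRate_sampleMean_sub h.iIndepFun_parameter h.hasLaw_parameter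
  have hdata := h.hasLpRate_empMean_data_sub
  have hgain : HasLpRate P 1 fun J ω ↦
      matrixCLM (empCov (u · ω) (y · ω) J * (empCov (y · ω) (y · ω) J)⁻¹ - gain S₀ Γ A)
        ((y₀ - matrixCLM A m₀) + (matrixCLM A m₀ - empMean (y · ω) J)) :=
    h.hasLpRate_empGain_sub.matrixCLM_apply ((HasLpRate.const _).add (hdata.mono zero_le))
  have hshift := hdata.continuousLinearMap_comp (matrixCLM (gain S₀ Γ A))
  have hsplit (J : ℕ) (ω : Ω) : postMean m₀ S₀ Γ A y₀ - approxPostMean (u · ω) (y · ω) J y₀ =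
      -(empMean (u · ω) J - m₀) -
        matrixCLM (empCov (u · ω) (y · ω) J * (empCov (y · ω) (y · ω) J)⁻¹ - gain S₀ Γ A)
          ((y₀ - matrixCLM A m₀) + (matrixCLM A m₀ - empMean (y · ω) J)) -
        matrixCLM (gain S₀ Γ A) (matrixCLM A m₀ - empMean (y · ω) J) := by
    have happrox : approxPostMean (u · ω) (y · ω) J y₀ = empMean (u · ω) J +
        matrixCLM (empCov (u · ω) (y · ω) J * (empCov (y · ω) (y · ω) J)⁻¹)
          (y₀ - empMean (y · ω) J) := rfl
    rw [happrox, postMean, sub_add_sub_cancel]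
    simp only [sub_eq_add_neg, matrixCLM_add, matrixCLM_neg, add_apply, neg_apply, map_add,
      map_neg]
    abel
  simp only [hsplit]
  exact (hmean.neg.sub hgain).sub hshift

lemma hasLpRate_gaussianKL_data : HasLpRate P 2 fun J ω ↦
    gaussianKL (dataCov S₀ Γ A) (empCov (y · ω) (y · ω) J)
      (matrixCLM A m₀ - empMean (y · ω) J) :=
  .gaussianKL h.posDef_dataCov h.hasLpRate_empCov_data_sub h.hasLpRate_empMean_data_sub
    h.hasLpRate_inv_empCov h.eventually_ae_posDef_empCov

lemma hasLpRate_gaussianKL_post (y₀ : EuclideanSpace ℝ (Fin k)) : HasLpRate P 2 fun J ω ↦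
    gaussianKL (postCov S₀ Γ A) (approxPostCov (u · ω) (y · ω) J)
      (postMean m₀ S₀ Γ A y₀ - approxPostMean (u · ω) (y · ω) J y₀) :=
  .gaussianKL h.posDef_postCov h.hasLpRate_approxPostCov_sub (h.hasLpRate_postMean_sub y₀)
    h.hasLpRate_inv_approxPostCov h.eventually_ae_posDef_approxPostCov

lemma hasLpRate_trace_gainError : HasLpRate P 2 fun J ω ↦
    ((approxPostCov (u · ω) (y · ω) J)⁻¹ *
      ((gain S₀ Γ A - empCov (u · ω) (y · ω) J * (empCov (y · ω) (y · ω) J)⁻¹) *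
        dataCov S₀ Γ A *
        (gain S₀ Γ A - empCov (u · ω) (y · ω) J * (empCov (y · ω) (y · ω) J)⁻¹)ᵀ)).trace := by
  have hgain := h.hasLpRate_empGain_sub.neg
  simp only [neg_sub] at hgain
  exact (h.hasLpRate_inv_approxPostCov.matrix_mul <|
    (hgain.matrix_mul (.const (dataCov S₀ Γ A))).matrix_mul hgain.transpose).trace

lemma tendstoZeroL2WithRate_klDiv_approxMarginal : TendstoZeroL2WithRate P
    (fun J ω ↦ klDiv (marginalLaw m₀ S₀ Γ (matrixCLM A)) (approxMarginal (y · ω) J))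
    (fun J ↦ (J : ℝ)⁻¹) := by
  refine h.hasLpRate_gaussianKL_data.tendstoZeroL2WithRate_of_ae_eq_ofReal ?_
  filter_upwards [h.eventually_ae_posDef_empCov] with J hJ
  filter_upwards [hJ] with ω hω
  rw [marginalLaw_eq A h.posDef_prior.posSemidef h.posDef_noise.posSemidef, approxMarginal,
    klDiv_multivariateGaussian h.posDef_dataCov hω]

lemma tendstoZeroL2WithRate_klDiv_approxPosterior (y₀ : EuclideanSpace ℝ (Fin k)) :
    TendstoZeroL2WithRate P
      (fun J ω ↦ klDiv (posteriorLaw m₀ S₀ Γ (matrixCLM A) y₀)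
        (approxPosterior (u · ω) (y · ω) J y₀))
      (fun J ↦ (J : ℝ)⁻¹) := by
  refine (h.hasLpRate_gaussianKL_post y₀).tendstoZeroL2WithRate_of_ae_eq_ofReal ?_
  filter_upwards [h.eventually_ae_posDef_approxPostCov] with J hJ
  filter_upwards [hJ] with ω hω
  rw [posteriorLaw_eq A h.posDef_prior h.posDef_noise, approxPosterior,
    klDiv_multivariateGaussian h.posDef_postCov hω]

lemma tendstoZeroL2WithRate_eigUpper_sub_EIG : TendstoZeroL2WithRate P
    (fun J ω ↦ eigUpper (y · ω) J m₀ S₀ Γ (matrixCLM A) - (EIG m₀ S₀ Γ (matrixCLM A)).toReal)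
    (fun J ↦ (J : ℝ)⁻¹) := by
  refine (h.hasLpRate_gaussianKL_data.congr ?_).tendstoZeroL2WithRate
  filter_upwards [h.eventually_ae_posDef_empCov] with J hJ
  filter_upwards [hJ] with ω hω
  rw [eigUpper_sub_EIG A h.posDef_prior h.posDef_noise hω]

lemma tendstoZeroL2WithRate_EIG_sub_eigLower : TendstoZeroL2WithRate P
    (fun J ω ↦ (EIG m₀ S₀ Γ (matrixCLM A)).toReal -
      eigLower (u · ω) (y · ω) J m₀ S₀ Γ (matrixCLM A))
    (fun J ↦ (J : ℝ)⁻¹) := by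
  have hkl := h.hasLpRate_gaussianKL_post (matrixCLM A m₀)
  simp only [postMean, sub_self, map_zero, add_zero] at hkl
  refine ((hkl.add (h.hasLpRate_trace_gainError.const_mul (1 / 2))).congr ?_).tendstoZeroL2WithRate
  filter_upwards [h.eventually_ae_posDef_approxPostCov] with J hJ
  filter_upwards [hJ] with ω hω
  rw [EIG_sub_eigLower A h.posDef_prior h.posDef_noise hω]

end LinearGaussianSample

end Sample

end BOED

theorem mainTheorem2 {d k : ℕ} {𝒟 : Type*}
    (m₀ : EuclideanSpace ℝ (Fin d)) (S₀ : Matrix (Fin d) (Fin d) ℝ) (hS₀ : S₀.PosDef)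
    (Γ : Matrix (Fin k) (Fin k) ℝ) (hΓ : Γ.PosDef)
    (G : EuclideanSpace ℝ (Fin d) → 𝒟 → EuclideanSpace ℝ (Fin k))
    (A : 𝒟 → Matrix (Fin k) (Fin d) ℝ)
    (hG : ∀ u p, G u p = WithLp.toLp 2 (A p *ᵥ u.ofLp))
    (p : 𝒟)
    {Ω : Type*} [MeasurableSpace Ω] (P : Measure Ω) [IsProbabilityMeasure P]
    (u : ℕ → Ω → EuclideanSpace ℝ (Fin d)) (y : ℕ → Ω → EuclideanSpace ℝ (Fin k))
    (hlaw : ∀ j, HasLaw (fun ω ↦ (u j ω, y j ω)) (BOED.jointLaw m₀ S₀ Γ (G · p)) P)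
    (hindep : iIndepFun (fun j ω ↦ (u j ω, y j ω)) P) :
    -- the Gaussian approximation of the marginal of the data
    BOED.TendstoZeroL2WithRate P
      (fun J ω ↦ klDiv (BOED.marginalLaw m₀ S₀ Γ (G · p)) (BOED.approxMarginal (y · ω) J))
      (fun J ↦ (J : ℝ)⁻¹) ∧
    -- the Gaussian approximation of the posterior, for every data value
    (∀ y₀ : EuclideanSpace ℝ (Fin k),
      BOED.TendstoZeroL2WithRate P
        (fun J ω ↦ klDiv (BOED.posteriorLaw m₀ S₀ Γ (G · p) y₀)
          (BOED.approxPosterior (u · ω) (y · ω) J y₀))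
        (fun J ↦ (J : ℝ)⁻¹)) ∧
    -- the bounds on the expected information gain hold almost surely and become tight
    BOED.EIG m₀ S₀ Γ (G · p) ≠ ∞ ∧
    (∀ᶠ J in atTop, ∀ᵐ ω ∂P,
      Integrable (BOED.upperIntegrand (y · ω) J Γ (G · p)) (BOED.jointLaw m₀ S₀ Γ (G · p)) ∧
      Integrable (BOED.lowerIntegrand (u · ω) (y · ω) J m₀ S₀)
        (BOED.jointLaw m₀ S₀ Γ (G · p)) ∧
      BOED.eigLower (u · ω) (y · ω) J m₀ S₀ Γ (G · p) ≤ (BOED.EIG m₀ S₀ Γ (G · p)).toReal ∧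
      (BOED.EIG m₀ S₀ Γ (G · p)).toReal ≤ BOED.eigUpper (y · ω) J m₀ S₀ Γ (G · p)) ∧
    BOED.TendstoZeroL2WithRate P
      (fun J ω ↦ BOED.eigUpper (y · ω) J m₀ S₀ Γ (G · p) - (BOED.EIG m₀ S₀ Γ (G · p)).toReal)
      (fun J ↦ (J : ℝ)⁻¹) ∧
    BOED.TendstoZeroL2WithRate P
      (fun J ω ↦ (BOED.EIG m₀ S₀ Γ (G · p)).toReal -
        BOED.eigLower (u · ω) (y · ω) J m₀ S₀ Γ (G · p))
      (fun J ↦ (J : ℝ)⁻¹) := by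
  have hGp : (G · p) = BOED.matrixCLM (A p) := funext fun v ↦ hG v p
  rw [hGp] at hlaw ⊢
  have h : BOED.LinearGaussianSample m₀ S₀ Γ (A p) P u y := ⟨hS₀, hΓ, hlaw, hindep⟩
  refine ⟨h.tendstoZeroL2WithRate_klDiv_approxMarginal,
    h.tendstoZeroL2WithRate_klDiv_approxPosterior, ?_, ?_,
    h.tendstoZeroL2WithRate_eigUpper_sub_EIG, h.tendstoZeroL2WithRate_EIG_sub_eigLower⟩
  · rw [BOED.EIG_eq (A p) hS₀ hΓ]
    exact ENNReal.ofReal_ne_top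
  · filter_upwards [h.eventually_ae_posDef_empCov, h.eventually_ae_posDef_approxPostCov]
      with J hJdata hJpost
    filter_upwards [hJdata, hJpost] with ω hdata hpost
    exact ⟨BOED.integrable_upperIntegrand (A p) hS₀ hΓ hdata,
      BOED.integrable_lowerIntegrand (A p) hS₀ hΓ hpost,
      BOED.eigLower_le_EIG (A p) hS₀ hΓ hpost, BOED.EIG_le_eigUpper (A p) hS₀ hΓ hdata⟩
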